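/- Let $n\ge 2$ be an integer, $\rho=\frac{n-1}{2}$, and $\lambda\in i[0,\infty)\cup(0,\rho)$. Write ${}_2F_1(z)={}_2F_1(\rho+\lambda,\rho-\lambda;\frac n2;z)$ for the Gauss hypergeometric function, i.e. the sum of the Gauss series for $|z|<1$, which extends to a holomorphic function on $\mathbb C\setminus[1,\infty)$. Let $(d)_k=d(d+1)\cdots(d+k-1)$ and $\psi=\Gamma'/\Gamma$; logarithm and powers are principal branches, and $1/\Gamma$ is $0$ at the poles of $\Gamma$. Then the following holds, for each choice of sign. 1. The limit ${}_2F_1(x\pm i0)=\lim_{y\downarrow 0}{}_2F_1(x\pm iy)$ exists in the sense of distributions on $\mathbb R$: there is a distribution $T_\pm$ with $\int_{\mathbb R}{}_2F_1(x\pm iy)\varphi(x)\,dx\to T_\pm(\varphi)$ for every $\varphi\in C_c^\infty(\mathbb R)$. For $x>1$ the limit exists uniformly on compact subsets of $(1,\infty)$, and on $(1,\infty)$ the distribution $T_\pm$ is given by the resulting continuous function ${}_2F_1(x\pm i0)$. 2. Let $1<x<2$. If $n$ is odd, $$\begin{aligned}{}_2F_1(x\pm i0)={}&\frac{\Gamma(\frac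 n2)\Gamma(\frac{2-n}2)}{\Gamma(\frac12+\lambda)\Gamma(\frac12-\lambda)}\,{}_2F_1\!\left(\rho+\lambda,\rho-\lambda;\tfrac n2;1-x\right)\\&+e^{\mp i\pi\frac{2-n}2}(x-1)^{\frac{2-n}2}\frac{\Gamma(\frac n2)\Gamma(\frac{n-2}2)}{\Gamma(\rho+\lambda)\Gamma(\rho-\lambda)}\,{}_2F_1\!\left(\tfrac12-\lambda,\tfrac12+\lambda;\tfrac{4-n}2;1-x\right).\end{aligned}$$ If $n$ is even, $$\begin{aligned}{}_2F_1(x\pm i0)={}&\frac{\Gamma(\frac n2)}{\Gamma(\rho+\lambda)\Gamma(\rho-\lambda)}\sum_{k=0}^{\frac n2-2}\frac{(-1)^k(\frac n2-k-2)!\,(\frac12+\lambda)_k(\frac12-\lambda)_k}{k!}(1-x)^{k+1-\frac n2}\\&+\frac{(-1)^{\frac{n-2}2}\Gamma(\frac n2)}{\Gamma(\frac12+\lambda)\Gamma(\frac12-\lambda)}\sum_{k=0}^\infty\frac{(\rho+\lambda)_k(\rho-\lambda)_k}{k!\,(\frac n2-1+k)!}\Big[\psi(k+1)+\psi(\tfrac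 n2+k)\\&\qquad-\psi(\rho+\lambda+k)-\psi(\rho-\lambda+k)-\ln(x-1)\pm i\pi\Big](1-x)^k,\end{aligned}$$ where the first sum is empty for $n=2$ and the infinite series converges. 3. Let $$L(z)=\frac{-\ln(1-z)}{\Gamma(\rho+\lambda)\Gamma(\rho-\lambda)}\quad(n=2),\qquad L(z)=\frac{\Gamma(\frac n2)\Gamma(\frac{n-2}2)}{\Gamma(\rho+\lambda)\Gamma(\rho-\lambda)}(1-z)^{\frac{2-n}2}\quad(n\ge3).$$ Then ${}_2F_1(z)\approx L(z)$ near $z=1$, both as functions and as distributions: ${}_2F_1(z)/L(z)\to1$ as $z\to1$ in $\mathbb C\setminus[1,\infty)$; and the distributional boundary value $S_\pm=L(x\pm i0)$ exists and, for every $\varphi\in C_c^\infty(\mathbb R)$ with $\varphi_\varepsilon(x)=\varepsilon^{-1}\varphi((x-1)/\varepsilon)$, $$T_\pm(\varphi_\varepsilon)-S_\pm(\varphi_\varepsilon)=o(|\ln\varepsilon|)\ \ (n=2),\qquad T_\pm(\varphi_\varepsilon)-S_\pm(\varphi_\varepsilon)=o\big(\varepsilon^{\frac{2-n}2}\big)\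 \ (n\ge3)\qquad(\varepsilon\downarrow0).$$ -/

import Mathlib

open Set Filter Topology MeasureTheory TopologicalSpace
open scoped Distributions ContDiff

/-- The cut plane `ℂ ∖ [1, ∞)`. -/
def cutPlane : Set ℂ := (Complex.ofReal '' Set.Ici (1 : ℝ))ᶜ

open Classical in
/-- The Gauss hypergeometric function `₂F₁(a, b; c; ·)` on the cut plane: the holomorphic function
on `ℂ ∖ [1, ∞)` that is the sum of the Gauss series on the unit disc. By the identity theorem its
values on the cut plane are unique; the values on the cut carry no meaning. (If no such function
existed, the value would be `0`.) -/
noncomputable def gaussHypergeometric (a b c : ℂ) : ℂ → ℂ :=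
  if h : ∃ F : ℂ → ℂ, DifferentiableOn ℂ F cutPlane ∧
      Set.EqOn F (ordinaryHypergeometric a b c) (Metric.ball 0 1)
  then h.choose else 0

/-- `ρ = (n - 1) / 2`. -/
noncomputable def rhoParam (n : ℕ) : ℂ := ((n : ℂ) - 1) / 2

/-- The spectral parameters: `λ ∈ i[0, ∞) ∪ (0, ρ)`. -/
def IsSpectralParam (n : ℕ) (lam : ℂ) : Prop :=
  (∃ t : ℝ, 0 ≤ t ∧ lam = t * Complex.I) ∨
    (∃ t : ℝ, 0 < t ∧ t < ((n : ℝ) - 1) / 2 ∧ lam = t)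

/-- `₂F₁(z) = ₂F₁(ρ + λ, ρ - λ; n/2; z)`. -/
noncomputable def hgf (n : ℕ) (lam : ℂ) : ℂ → ℂ :=
  gaussHypergeometric (rhoParam n + lam) (rhoParam n - lam) ((n : ℂ) / 2)

/-- The Pochhammer symbol `(d)_k = d (d + 1) ⋯ (d + k - 1)`. -/
noncomputable def poch (d : ℂ) (k : ℕ) : ℂ := (ascPochhammer ℂ k).eval d

/-- `T` is the boundary value `F(x + i0)` (for `σ = 1`) or `F(x - i0)` (for `σ = -1`) of `F` in the
sense of distributions on `ℝ`: for every test function `φ`,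
`∫ F(x + iσy) φ(x) dx → T(φ)` as `y ↓ 0`. -/
def IsBoundaryValue (F : ℂ → ℂ) (σ : ℝ) (T : 𝓓'((⊤ : Opens ℝ), ℂ)) : Prop :=
  ∀ φ : 𝓓((⊤ : Opens ℝ), ℝ),
    Tendsto (fun y : ℝ => ∫ x : ℝ, ((φ x : ℝ) : ℂ) * F ((x : ℂ) + (σ * y : ℝ) * Complex.I))
      (𝓝[>] 0) (𝓝 (T φ))

/-- The test function `φ_ε(x) = ε⁻¹ φ((x - x₀) / ε)`, which concentrates at `x₀` as `ε ↓ 0`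
(and `0` if `ε ≤ 0`). -/
noncomputable def rescale (φ : 𝓓((⊤ : Opens ℝ), ℝ)) (x₀ ε : ℝ) : 𝓓((⊤ : Opens ℝ), ℝ) :=
  if hε : 0 < ε then
    { toFun := fun x => ε⁻¹ * φ ((x - x₀) / ε)
      contDiff' := by
        have h := φ.contDiff
        exact contDiff_const.mul (h.comp (by fun_prop))
      hasCompactSupport' := by
        have h := φ.hasCompactSupport
        let e : ℝ ≃ₜ ℝ := (Homeomorph.subRight x₀).trans (Homeomorph.mulRight₀ ε⁻¹ (by positivity))
        have h2 : HasCompactSupport (fun x => φ (e x)) := h.comp_homeomorph e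
        have h3 : (fun x => φ (e x)) = fun x => φ ((x - x₀) / ε) := by
          funext x; simp [e, div_eq_mul_inv]
        rw [h3] at h2
        exact h2.mul_left
      tsupport_subset' := fun _ _ => trivial }
  else 0

theorem rescale_apply (φ : 𝓓((⊤ : Opens ℝ), ℝ)) (x₀ : ℝ) {ε : ℝ} (hε : 0 < ε) (x : ℝ) :
    rescale φ x₀ ε x = ε⁻¹ * φ ((x - x₀) / ε) := by
  simp only [rescale, dif_pos hε]
  rfl

/-- `T ≈ S` near `x₀` as distributions, at the scale `g`: tested on functions that concentrate at
`x₀` at scale `ε`, the two distributions differ by `o(g(ε))` as `ε ↓ 0`. -/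
def DistribAsympAt (T S : 𝓓'((⊤ : Opens ℝ), ℂ)) (x₀ : ℝ) (g : ℝ → ℝ) : Prop :=
  ∀ φ : 𝓓((⊤ : Opens ℝ), ℝ),
    (fun ε : ℝ => T (rescale φ x₀ ε) - S (rescale φ x₀ ε)) =o[𝓝[>] 0] g

/-- The right-hand side, for `n` odd, of the formula for `₂F₁(x + iσ0)`, `1 < x < 2`. -/
noncomputable def oddFormula (n : ℕ) (lam : ℂ) (σ x : ℝ) : ℂ :=
  Complex.Gamma (n / 2) * Complex.Gamma ((2 - n) / 2) /
      (Complex.Gamma (1 / 2 + lam) * Complex.Gamma (1 / 2 - lam)) *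
    ordinaryHypergeometric (rhoParam n + lam) (rhoParam n - lam) ((n : ℂ) / 2) (1 - x : ℂ) +
  Complex.exp (-(σ * Complex.I * Real.pi * ((2 - n) / 2))) * ((x - 1 : ℝ) : ℂ) ^ ((2 - n : ℂ) / 2) *
    (Complex.Gamma (n / 2) * Complex.Gamma ((n - 2) / 2) /
      (Complex.Gamma (rhoParam n + lam) * Complex.Gamma (rhoParam n - lam))) *
    ordinaryHypergeometric (1 / 2 - lam) (1 / 2 + lam) ((4 - n : ℂ) / 2) (1 - x : ℂ)

/-- The `k`-th term of the infinite series in the formula for `n = 2 m` even. -/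
noncomputable def evenTerm (m : ℕ) (lam : ℂ) (σ x : ℝ) (k : ℕ) : ℂ :=
  poch (rhoParam (2 * m) + lam) k * poch (rhoParam (2 * m) - lam) k /
      ((k.factorial : ℂ) * ((m - 1 + k).factorial : ℂ)) *
    (Complex.digamma (k + 1) + Complex.digamma (m + k)
      - Complex.digamma (rhoParam (2 * m) + lam + k)
      - Complex.digamma (rhoParam (2 * m) - lam + k)
      - Real.log (x - 1) + σ * Complex.I * Real.pi) * (1 - x : ℂ) ^ k

/-- The right-hand side, for `n = 2 m` even, of the formula for `₂F₁(x + iσ0)`, `1 < x < 2`. The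
finite sum runs over `0 ≤ k ≤ m - 2` and is empty for `m = 1`. -/
noncomputable def evenFormula (m : ℕ) (lam : ℂ) (σ x : ℝ) : ℂ :=
  Complex.Gamma m / (Complex.Gamma (rhoParam (2 * m) + lam) * Complex.Gamma (rhoParam (2 * m) - lam)) *
    ∑ k ∈ Finset.range (m - 1),
      (-1 : ℂ) ^ k * ((m - k - 2).factorial : ℂ) * poch (1 / 2 + lam) k * poch (1 / 2 - lam) k /
        (k.factorial : ℂ) * (1 - x : ℂ) ^ ((k : ℤ) + 1 - (m : ℤ)) +
  (-1 : ℂ) ^ (m - 1) * Complex.Gamma m /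
      (Complex.Gamma (1 / 2 + lam) * Complex.Gamma (1 / 2 - lam)) *
    ∑' k : ℕ, evenTerm m lam σ x k

/-- The leading singular part at `z = 1` for `n = 2`. -/
noncomputable def leadingTwo (lam : ℂ) (z : ℂ) : ℂ :=
  1 / (Complex.Gamma (rhoParam 2 + lam) * Complex.Gamma (rhoParam 2 - lam)) *
    (-Complex.log (1 - z))

/-- The leading singular part at `z = 1` for `n ≥ 3`. -/
noncomputable def leadingGeThree (n : ℕ) (lam : ℂ) (z : ℂ) : ℂ :=
  Complex.Gamma (n / 2) * Complex.Gamma ((n - 2) / 2) /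
      (Complex.Gamma (rhoParam n + lam) * Complex.Gamma (rhoParam n - lam)) *
    (1 - z) ^ ((2 - n : ℂ) / 2)

/-! ### Power series on the unit disc -/

/-! Put a = ρ + λ, b = ρ - λ, c = n/2. Since b and c - b = 1/2 + λ have positive real part, Euler's
integral of t^(b-1) (1-t)^(c-b-1) (1-zt)^(-a) over (0, 1) converges for every z off the cut. In the
unit disc it is B(b, c-b) times the Gauss series, so it supplies the continuation to the cut plane.
Rotating its path (`eulerIntegral_rotate`) moves the cut to a vertical ray issuing from 1 on the
opposite side, so from either side of [1, ∞) the function continues holomorphically across the cut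
away from 1 (`gaussHypergeometric_continuation`). This gives the locally uniform limits on (1, ∞).

Near z = 1 everything follows from the connection formula, which expresses the function through
power series in w = 1 - z. For n odd, s = c - a - b = (2-n)/2 is not an integer and the formula is
linear algebra among three solutions of the hypergeometric equation: their Wronskians, multiplied by
z^c (1-z)^(1-s), are constants, found from limits at 0 and 1 by an Abelian comparison with the
binomial series (`hypergeometric_connection`). For n = 2m, s = 1 - m and the formula degenerates.
With c = m + δ the poles 1/δ combine into a difference quotient that vanishes to first order, and
its limit is a derivative in δ: this is where digamma and the logarithm come from
(`hypergeometric_connection_log`). The identity theorem carries both formulas from the lens |z| < 1,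
|1-z| < 1 to the slit disc in w. Letting w tend to the negative axis, where log w tends to log(x-1)
∓ iπ, yields the formulas on (1, 2); subtracting the leading term leaves a remainder
O(|w|^(-(n-3)/2)) for n ≥ 3 and O(1) for n = 2.

For the distributions, let F be holomorphic in a half plane with growth at most y^(-N-1/2). On F the
derivative in y is ±i times the derivative in x, so differentiating the integral of F(x + iσy) φ(x)
in y replaces φ by φ', up to a unimodular factor. Repeated integration from y = 1 downwards removes
the growth, and the limit is bounded by the sup norms of φ, ..., φ^(N+1) (`smear_tendsto`). This
yields existence and continuity of the boundary values. Applied to the rescaled remainder z ↦ (F -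
L)(1 + εz) = O(ε^(-q) |z|^(-q)), the same bound yields the asymptotics at 1
(`boundaryValue_sub_isBigO`). -/

theorem poch_zero (d : ℂ) : poch d 0 = 1 := by simp [poch]

theorem poch_succ (d : ℂ) (k : ℕ) : poch d (k + 1) = poch d k * (d + k) := by
  simp [poch, ascPochhammer_succ_eval]

theorem poch_succ_left (d : ℂ) (k : ℕ) : poch d (k + 1) = d * poch (d + 1) k := by
  induction k with
  | zero => simp [poch_succ, poch_zero]
  | succ k ih => rw [poch_succ, ih, poch_succ]; push_cast; ring

theorem poch_ne_zero {d : ℂ} {k : ℕ} (h : ∀ j < k, d ≠ -(j : ℂ)) : poch d k ≠ 0 := by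
  induction k with
  | zero => simp [poch_zero]
  | succ k ih =>
    rw [poch_succ]
    refine mul_ne_zero (ih fun j hj => h j (by omega)) fun h0 => h k (by omega) ?_
    linear_combination h0

theorem differentiable_poch (k : ℕ) : Differentiable ℂ (fun d => poch d k) := by
  unfold poch
  exact Polynomial.differentiable _

theorem HasSum.of_terms_eq {f g : ℕ → ℂ} {a : ℂ} (h : HasSum f a) (hfg : ∀ k, f k = g k) :
    HasSum g a := funext hfg ▸ h

/-- The sum of the power series with coefficients `t`. -/
noncomputable def powerSum (t : ℕ → ℂ) (z : ℂ) : ℂ := ∑' k, t k * z ^ k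

/-- The power series with coefficients `t` converges on the unit disc. -/
def ConvergesOnDisc (t : ℕ → ℂ) : Prop := ∀ r : ℝ, 0 < r → r < 1 → Summable fun k => ‖t k‖ * r ^ k

theorem ConvergesOnDisc.summable_norm {t : ℕ → ℂ} (ht : ConvergesOnDisc t) {z : ℂ} (hz : ‖z‖ < 1) :
    Summable fun k => ‖t k * z ^ k‖ := by
  obtain ⟨r, hr1, hr2⟩ := exists_between hz
  refine (ht r ((norm_nonneg z).trans_lt hr1) hr2).of_nonneg_of_le (fun _ => norm_nonneg _)
    fun k => ?_
  rw [norm_mul, norm_pow]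
  gcongr

theorem ConvergesOnDisc.hasSum {t : ℕ → ℂ} (ht : ConvergesOnDisc t) {z : ℂ} (hz : ‖z‖ < 1) :
    HasSum (fun k => t k * z ^ k) (powerSum t z) :=
  (ht.summable_norm hz).of_norm.hasSum

/-- Data for the Weierstrass M-test on a disc around z; holomorphy and termwise differentiation rest
on it. -/
theorem ConvergesOnDisc.exists_ball {t : ℕ → ℂ} (ht : ConvergesOnDisc t) {z : ℂ} (hz : ‖z‖ < 1) :
    ∃ (r : ℝ) (u : ℕ → ℝ), z ∈ Metric.ball (0 : ℂ) r ∧ Summable u ∧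
      ∀ k, ∀ w ∈ Metric.ball (0 : ℂ) r, ‖t k * w ^ k‖ ≤ u k := by
  obtain ⟨r, hr1, hr2⟩ := exists_between hz
  refine ⟨r, _, by simpa using hr1, ht r ((norm_nonneg z).trans_lt hr1) hr2, fun k w hw => ?_⟩
  have : ‖w‖ < r := by simpa using hw
  rw [norm_mul, norm_pow]
  gcongr

theorem ConvergesOnDisc.differentiableAt {t : ℕ → ℂ} (ht : ConvergesOnDisc t) {z : ℂ}
    (hz : ‖z‖ < 1) : DifferentiableAt ℂ (powerSum t) z := by
  obtain ⟨r, u, hzr, hu, hb⟩ := ht.exists_ball hz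
  exact (Complex.differentiableOn_tsum_of_summable_norm hu (fun i => by fun_prop)
    Metric.isOpen_ball hb).differentiableAt (Metric.isOpen_ball.mem_nhds hzr)

theorem ConvergesOnDisc.hasSum_deriv {t : ℕ → ℂ} (ht : ConvergesOnDisc t) {z : ℂ} (hz : ‖z‖ < 1) :
    HasSum (fun k : ℕ => ((k : ℂ) + 1) * t (k + 1) * z ^ k) (deriv (powerSum t) z) := by
  obtain ⟨r, u, hzr, hu, hb⟩ := ht.exists_ball hz
  have h := Complex.hasSum_deriv_of_summable_norm hu (fun i => by fun_prop)
    Metric.isOpen_ball hb hzr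
  have h2 := (hasSum_nat_add_iff' 1).2 h
  have h3 : deriv (fun w => ∑' k, t k * w ^ k) z = deriv (powerSum t) z := rfl
  rw [h3] at h2
  simp only [Finset.range_one, Finset.sum_singleton, pow_zero, mul_one, deriv_const, sub_zero] at h2
  refine HasSum.of_terms_eq h2 fun k => ?_
  simp only [deriv_const_mul_field', deriv_pow_field, Nat.cast_add, Nat.cast_one, add_tsub_cancel_right]
  ring

/-! ### The Gauss series -/

/-- The coefficients of the Gauss series. -/
noncomputable def gaussCoeff (a b c : ℂ) (k : ℕ) : ℂ :=
  poch a k * poch b k / (poch c k * k.factorial)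

theorem ordinaryHypergeometric_eq_powerSum (a b c z : ℂ) :
    ordinaryHypergeometric a b c z = powerSum (gaussCoeff a b c) z := by
  rw [ordinaryHypergeometric_eq_tsum, powerSum]
  refine tsum_congr fun k => ?_
  rw [smul_eq_mul, gaussCoeff, poch, poch, poch]
  rw [div_eq_mul_inv, mul_inv]
  ring

/-- Ratio test for coefficients whose consecutive quotients tend to `1`. -/
theorem convergesOnDisc_of_succ {t : ℕ → ℂ} {q : ℕ → ℂ} (hq : Tendsto q atTop (𝓝 1))
    (h : ∀ k, t (k + 1) = q k * t k) : ConvergesOnDisc t := by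
  intro r hr0 hr1
  obtain ⟨l, hl1, hl2⟩ := exists_between hr1
  refine summable_of_ratio_norm_eventually_le (r := l) hl2 ?_
  have h1 : Tendsto (fun k => ‖q k‖ * r) atTop (𝓝 r) := by
    simpa using hq.norm.mul_const r
  filter_upwards [h1.eventually_le_const hl1] with k hk
  rw [h k]
  simp only [norm_mul, norm_norm, norm_pow, Real.norm_of_nonneg hr0.le]
  calc _ = (‖q k‖ * r) * (‖t k‖ * r ^ k) := by ring
    _ ≤ _ := by gcongr

theorem tendsto_add_div_add (a b : ℂ) :
    Tendsto (fun k : ℕ => (a + k) / (b + k)) atTop (𝓝 1) := by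
  have h : ∀ d : ℂ, Tendsto (fun k : ℕ => d / (k : ℂ) + 1) atTop (𝓝 1) := fun d => by
    simpa using (tendsto_const_div_atTop_nhds_zero_nat d).add_const 1
  have h2 := (h a).div (h b) one_ne_zero
  rw [div_one] at h2
  refine h2.congr' ?_
  filter_upwards [eventually_gt_atTop 0] with k hk
  have : (k : ℂ) ≠ 0 := by exact_mod_cast hk.ne'
  simp only [Pi.div_apply]
  rw [div_add_one this, div_add_one this, div_div_div_cancel_right₀ this]

/-- If c + k = 0, both sides are 0 because x / 0 = 0. Hence convergence and the derivative formula
below need no condition on c. -/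
theorem gaussCoeff_succ (a b c : ℂ) (k : ℕ) :
    gaussCoeff a b c (k + 1) = ((a + k) / (c + k) * ((b + k) / (1 + k))) * gaussCoeff a b c k := by
  simp only [gaussCoeff, poch_succ, Nat.factorial_succ]
  push_cast
  rw [add_comm (k : ℂ) 1]
  simp only [div_eq_mul_inv, mul_inv]
  ring

theorem convergesOnDisc_gaussCoeff (a b c : ℂ) : ConvergesOnDisc (gaussCoeff a b c) := by
  refine convergesOnDisc_of_succ ?_ (gaussCoeff_succ a b c)
  simpa using (tendsto_add_div_add a c).mul (tendsto_add_div_add b 1)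

theorem gaussCoeff_shift {a b c : ℂ} (k : ℕ) :
    ((k : ℂ) + 1) * gaussCoeff a b c (k + 1) = a * b / c * gaussCoeff (a + 1) (b + 1) (c + 1) k := by
  simp only [gaussCoeff, poch_succ_left, Nat.factorial_succ]
  have : (k : ℂ) + 1 ≠ 0 := by exact_mod_cast k.succ_ne_zero
  push_cast
  simp only [div_eq_mul_inv, mul_inv]
  field_simp

theorem hasDerivAt_ordinaryHypergeometric (a b c : ℂ) {z : ℂ} (hz : ‖z‖ < 1) :
    HasDerivAt (ordinaryHypergeometric a b c)
      (a * b / c * ordinaryHypergeometric (a + 1) (b + 1) (c + 1) z) z := by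
  have ht := convergesOnDisc_gaussCoeff a b c
  have h0 : ordinaryHypergeometric a b c = powerSum (gaussCoeff a b c) :=
    funext (ordinaryHypergeometric_eq_powerSum a b c)
  have h1 := (ht.differentiableAt hz).hasDerivAt
  have h2 := ht.hasSum_deriv hz
  have h3 := ((convergesOnDisc_gaussCoeff (a + 1) (b + 1) (c + 1)).hasSum hz).mul_left (a * b / c)
  rw [h0, ordinaryHypergeometric_eq_powerSum]
  have h4 : a * b / c * powerSum (gaussCoeff (a + 1) (b + 1) (c + 1)) z =
      deriv (powerSum (gaussCoeff a b c)) z :=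
    h3.unique (h2.of_terms_eq fun k => by rw [gaussCoeff_shift]; ring)
  rw [h4]
  exact h1

theorem ordinaryHypergeometric_at_zero (a b c : ℂ) : ordinaryHypergeometric a b c (0 : ℂ) = 1 :=
  ordinaryHypergeometric_zero a b c

theorem continuousAt_ordinaryHypergeometric (a b c : ℂ) {z : ℂ} (hz : ‖z‖ < 1) :
    ContinuousAt (ordinaryHypergeometric a b c) z :=
  (hasDerivAt_ordinaryHypergeometric a b c hz).continuousAt

/-- The hypergeometric differential equation, in terms of Gauss series. -/
theorem ordinaryHypergeometric_ode {a b c : ℂ} (hc : ∀ k : ℕ, c ≠ -k) {z : ℂ} (hz : ‖z‖ < 1) :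
    z * (1 - z) * (a * b / c * ((a + 1) * (b + 1) / (c + 1) *
        ordinaryHypergeometric (a + 2) (b + 2) (c + 2) z)) +
      (c - (a + b + 1) * z) * (a * b / c * ordinaryHypergeometric (a + 1) (b + 1) (c + 1) z) -
      a * b * ordinaryHypergeometric a b c z = 0 := by
  have hc0 : c ≠ 0 := by simpa using hc 0
  set t := gaussCoeff a b c with ht
  have e0 := (convergesOnDisc_gaussCoeff a b c).hasSum hz
  have e1 := ((convergesOnDisc_gaussCoeff (a + 1) (b + 1) (c + 1)).hasSum hz).mul_left (a * b / c)
  have e2 := (((convergesOnDisc_gaussCoeff (a + 2) (b + 2) (c + 2)).hasSum hz).mul_left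
    ((a + 1) * (b + 1) / (c + 1))).mul_left (a * b / c)
  simp only [← ordinaryHypergeometric_eq_powerSum] at e0 e1 e2
  have s1 : ∀ k : ℕ, a * b / c * gaussCoeff (a + 1) (b + 1) (c + 1) k = (k + 1) * t (k + 1) :=
    fun k => (gaussCoeff_shift k).symm
  have s2 : ∀ k : ℕ, a * b / c * ((a + 1) * (b + 1) / (c + 1) *
      gaussCoeff (a + 2) (b + 2) (c + 2) k) = (k + 1) * (k + 2) * t (k + 2) := fun k => by
    have h := gaussCoeff_shift (a := a + 1) (b := b + 1) (c := c + 1) k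
    have e : ∀ x : ℂ, x + 1 + 1 = x + 2 := fun x => by ring
    rw [e, e, e] at h
    rw [← h]
    have h' := s1 (k + 1)
    push_cast at h'
    rw [e] at h'
    linear_combination (k + 1 : ℂ) * h'
  have f1 : HasSum (fun k : ℕ => ((k : ℂ) + 1) * t (k + 1) * z ^ k)
      (a * b / c * ordinaryHypergeometric (a + 1) (b + 1) (c + 1) z) := by
    refine HasSum.of_terms_eq e1 fun k => ?_
    rw [← s1]; ring
  have f2 : HasSum (fun k : ℕ => ((k : ℂ) + 1) * (k + 2) * t (k + 2) * z ^ k)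
      (a * b / c * ((a + 1) * (b + 1) / (c + 1) *
        ordinaryHypergeometric (a + 2) (b + 2) (c + 2) z)) := by
    refine HasSum.of_terms_eq e2 fun k => ?_
    rw [← s2]; ring
  -- Multiplication by z shifts the index by one; the term that appears at index 0 carries the
  -- factor k and vanishes.
  have f1' : HasSum (fun k : ℕ => (k : ℂ) * t k * z ^ k)
      (z * (a * b / c * ordinaryHypergeometric (a + 1) (b + 1) (c + 1) z)) := by
    rw [← hasSum_nat_add_iff' 1]
    simp only [Finset.range_one, Finset.sum_singleton, Nat.cast_zero, zero_mul, sub_zero]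
    refine HasSum.of_terms_eq (f1.mul_left z) fun k => ?_
    push_cast; ring_nf
  have f2' : HasSum (fun k : ℕ => (k : ℂ) * (k + 1) * t (k + 1) * z ^ k)
      (z * (a * b / c * ((a + 1) * (b + 1) / (c + 1) *
        ordinaryHypergeometric (a + 2) (b + 2) (c + 2) z))) := by
    rw [← hasSum_nat_add_iff' 1]
    simp only [Finset.range_one, Finset.sum_singleton, Nat.cast_zero, zero_mul, sub_zero]
    refine HasSum.of_terms_eq (f2.mul_left z) fun k => ?_
    push_cast; ring_nf
  have f2'' : HasSum (fun k : ℕ => (k : ℂ) * (k - 1) * t k * z ^ k)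
      (z * (z * (a * b / c * ((a + 1) * (b + 1) / (c + 1) *
        ordinaryHypergeometric (a + 2) (b + 2) (c + 2) z)))) := by
    rw [← hasSum_nat_add_iff' 1]
    simp only [Finset.range_one, Finset.sum_singleton, Nat.cast_zero, zero_mul, sub_zero]
    refine HasSum.of_terms_eq (f2'.mul_left z) fun k => ?_
    push_cast; ring_nf
  have total := (((f2'.sub f2'').add (f1.mul_left c)).sub (f1'.mul_left (a + b + 1))).sub
    (e0.mul_left (a * b))
  -- The coefficient of z^k in the equation is (c+k)(k+1) t_(k+1) - (a+k)(b+k) t_k, which is 0 by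
  -- the recurrence.
  have hz0 : ∀ k : ℕ, (k : ℂ) * (k + 1) * t (k + 1) * z ^ k - k * (k - 1) * t k * z ^ k +
      c * ((k + 1) * t (k + 1) * z ^ k) - (a + b + 1) * (k * t k * z ^ k) -
      a * b * (t k * z ^ k) = 0 := fun k => by
    have hck : c + k ≠ 0 := fun h => hc k (by linear_combination h)
    have hk1 : (1 : ℂ) + k ≠ 0 := by rw [add_comm]; exact_mod_cast k.succ_ne_zero
    have h := gaussCoeff_succ a b c k
    have h' : (c + k) * (1 + k) * t (k + 1) = (a + k) * (b + k) * t k := by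
      rw [ht, h]; field_simp
    linear_combination z ^ k * h'
  have := total.unique (hasSum_zero.of_terms_eq fun k => (hz0 k).symm)
  linear_combination this

/-! ### Asymptotics of the Gauss series at `1` -/

theorem hasSum_binomial (a : ℂ) {z : ℂ} (hz : ‖z‖ < 1) :
    HasSum (fun k : ℕ => poch a k / k.factorial * z ^ k) ((1 - z) ^ (-a)) := by
  have h := (Complex.one_div_one_sub_cpow_hasFPowerSeriesOnBall_zero a).hasSum (y := z)
    (by
      rw [Metric.mem_eball, edist_zero_right, ← ofReal_norm, ← ENNReal.ofReal_one]
      exact (ENNReal.ofReal_lt_ofReal_iff one_pos).2 hz)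
  rw [zero_add, one_div, ← Complex.cpow_neg] at h
  refine HasSum.of_terms_eq h fun k => ?_
  have h1 : Ring.choose (a + k - 1) k = poch a k / k.factorial := by
    have h2 : Ring.choose (a + k - 1) k = Ring.multichoose a k := by
      rw [Ring.choose]
      congr 1
      ring
    have h3 := Ring.factorial_nsmul_multichoose_eq_ascPochhammer a k
    rw [Polynomial.ascPochhammer_smeval_eq_eval, nsmul_eq_mul] at h3
    rw [h2, poch, ← h3, mul_div_cancel_left₀ _ (by exact_mod_cast k.factorial_ne_zero)]
  rw [FormalMultilinearSeries.ofScalars_apply_eq, h1, smul_eq_mul]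

theorem poch_eq_prod (d : ℂ) (k : ℕ) : poch d k = ∏ j ∈ Finset.range k, (d + j) := by
  induction k with
  | zero => simp [poch_zero]
  | succ k ih => rw [poch_succ, ih, Finset.prod_range_succ]

/-- Euler's limit formula for Γ, inverted. At a pole `Complex.Gamma` takes the value 0, so its
inverse is 0, the true value of 1/Γ; there the Pochhammer symbol is eventually 0 as well. Hence
Gamma factors in denominators may have poles in the connection formulas. -/
theorem tendsto_poch_div (A : ℂ) :
    Tendsto (fun n : ℕ => poch A (n + 1) / ((n : ℂ) ^ A * n.factorial)) atTop
      (𝓝 (Complex.Gamma A)⁻¹) := by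
  by_cases hA : Complex.Gamma A = 0
  · obtain ⟨m, hm⟩ := (Complex.Gamma_eq_zero_iff A).1 hA
    rw [hA, inv_zero]
    refine tendsto_const_nhds.congr' ?_
    filter_upwards [eventually_ge_atTop m] with n hn
    rw [poch_eq_prod, Finset.prod_eq_zero (i := m) (by simp; omega) (by rw [hm]; ring), zero_div]
  · refine ((Complex.GammaSeq_tendsto_Gamma A).inv₀ hA).congr fun n => ?_
    rw [Complex.GammaSeq, inv_div, poch_eq_prod]

theorem poch_ne_zero' {d : ℂ} (h : ∀ j : ℕ, d ≠ -(j : ℂ)) (k : ℕ) : poch d k ≠ 0 :=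
  poch_ne_zero fun j _ => h j

/-- Growth of a quotient of Pochhammer symbols. -/
theorem tendsto_poch_quotient {A B C S d : ℂ} (hC : ∀ k : ℕ, C ≠ -k) (hS : ∀ k : ℕ, S ≠ -k)
    (h : A + B = C + S + d) :
    Tendsto (fun n : ℕ => poch A (n + 1) * poch B (n + 1) / (poch C (n + 1) * poch S (n + 1)) *
      (n : ℂ) ^ (-d)) atTop (𝓝 (Complex.Gamma C * Complex.Gamma S /
        (Complex.Gamma A * Complex.Gamma B))) := by
  have hC' := Complex.Gamma_ne_zero hC
  have hS' := Complex.Gamma_ne_zero hS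
  have h1 := ((tendsto_poch_div A).mul (tendsto_poch_div B)).div
    ((tendsto_poch_div C).mul (tendsto_poch_div S))
    (mul_ne_zero (inv_ne_zero hC') (inv_ne_zero hS'))
  have h2 : (Complex.Gamma A)⁻¹ * (Complex.Gamma B)⁻¹ / ((Complex.Gamma C)⁻¹ * (Complex.Gamma S)⁻¹)
      = Complex.Gamma C * Complex.Gamma S / (Complex.Gamma A * Complex.Gamma B) := by
    simp only [div_eq_mul_inv, mul_inv, inv_inv]; ring
  rw [h2] at h1
  refine h1.congr' ?_
  filter_upwards [eventually_gt_atTop 0] with n hn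
  have hn0 : (n : ℂ) ≠ 0 := by exact_mod_cast hn.ne'
  have hf : (n.factorial : ℂ) ≠ 0 := by exact_mod_cast n.factorial_ne_zero
  have e : (n : ℂ) ^ A * (n : ℂ) ^ B * (n : ℂ) ^ (-d) = (n : ℂ) ^ C * (n : ℂ) ^ S := by
    rw [← Complex.cpow_add _ _ hn0, ← Complex.cpow_add _ _ hn0, ← Complex.cpow_add _ _ hn0]
    congr 1; linear_combination h
  have p1 : (n : ℂ) ^ A ≠ 0 := by simp [Complex.cpow_eq_zero_iff, hn0]
  have p2 : (n : ℂ) ^ B ≠ 0 := by simp [Complex.cpow_eq_zero_iff, hn0]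
  have p3 : (n : ℂ) ^ C ≠ 0 := by simp [Complex.cpow_eq_zero_iff, hn0]
  have p4 : (n : ℂ) ^ S ≠ 0 := by simp [Complex.cpow_eq_zero_iff, hn0]
  have q1 := poch_ne_zero' hC (n + 1)
  have q2 := poch_ne_zero' hS (n + 1)
  simp only [Pi.div_apply]
  field_simp
  linear_combination -(poch A (n + 1) * poch B (n + 1)) * e

/-- From index K on, the coefficients are within ε u_k of l u_k; the finite head costs a constant
that does not grow as x tends to 1. -/
theorem norm_powerSum_sub_le {t : ℕ → ℂ} {u : ℕ → ℝ} {U : ℝ → ℝ} (ht : ConvergesOnDisc t)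
    (hU : ∀ x : ℝ, 0 < x → x < 1 → HasSum (fun k => u k * x ^ k) (U x)) {l : ℂ} {ε : ℝ} {K : ℕ}
    (hu : ∀ k, 0 ≤ ε * u k)
    (hK : ∀ k, K ≤ k → ‖t k - l * u k‖ ≤ ε * u k) {x : ℝ} (hx0 : 0 < x) (hx1 : x < 1) :
    ‖powerSum t x - l * U x‖ ≤ ε * U x + ∑ k ∈ Finset.range K, ‖t k - l * u k‖ := by
  have hn : ‖(x : ℂ)‖ < 1 := by rwa [Complex.norm_real, Real.norm_of_nonneg hx0.le]
  have h1 := ht.hasSum hn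
  have h2 : HasSum (fun k => l * ((u k : ℂ) * (x : ℂ) ^ k)) (l * U x) := by
    refine HasSum.mul_left _ ?_
    have := Complex.hasSum_ofReal.2 (hU x hx0 hx1)
    exact_mod_cast this
  have h3 := h1.sub h2
  have h4 : HasSum (fun k => if k < K then ‖t k - l * u k‖ else 0)
      (∑ k ∈ Finset.range K, ‖t k - l * u k‖) := by
    have := hasSum_sum_of_ne_finset_zero (L := SummationFilter.unconditional ℕ)
      (f := fun k => if k < K then ‖t k - l * u k‖ else 0) (s := Finset.range K) (fun k hk => if_neg (by simpa using hk))
    rwa [Finset.sum_congr rfl (fun k hk => if_pos (by simpa using hk))] at this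
  have h5 := ((hU x hx0 hx1).mul_left ε).add h4
  rw [← h3.tsum_eq]
  refine tsum_of_norm_bounded h5 fun k => ?_
  have e : t k * (x : ℂ) ^ k - l * ((u k : ℂ) * (x : ℂ) ^ k) = (t k - l * u k) * (x : ℂ) ^ k := by
    ring
  rw [e, norm_mul, norm_pow, Complex.norm_real, Real.norm_of_nonneg hx0.le]
  have hxk : x ^ k ≤ 1 := pow_le_one₀ hx0.le hx1.le
  have hxk0 : 0 ≤ x ^ k := by positivity
  by_cases hk : k < K
  · rw [if_pos hk]
    have h6 : 0 ≤ ε * (u k * x ^ k) := by rw [← mul_assoc]; exact mul_nonneg (hu k) hxk0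
    have h7 : ‖t k - l * u k‖ * x ^ k ≤ ‖t k - l * u k‖ := mul_le_of_le_one_right (norm_nonneg _) hxk
    linarith
  · rw [if_neg hk, add_zero, ← mul_assoc]
    exact mul_le_mul_of_nonneg_right (hK k (by omega)) hxk0

/-- An Abelian theorem: if `t k / u k → l`, `u k > 0` and `∑ u k x ^ k → ∞` as `x ↑ 1`, then
`(∑ t k x ^ k) / (∑ u k x ^ k) → l`. -/
theorem tendsto_powerSum_div {t : ℕ → ℂ} {u : ℕ → ℝ} {U : ℝ → ℝ} (ht : ConvergesOnDisc t)
    (hu : ∀ k, 0 < u k) (hU : ∀ x : ℝ, 0 < x → x < 1 → HasSum (fun k => u k * x ^ k) (U x))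
    (hUt : Tendsto U (𝓝[<] 1) atTop) {l : ℂ}
    (hl : Tendsto (fun k => t k / u k) atTop (𝓝 l)) :
    Tendsto (fun x : ℝ => powerSum t x / U x) (𝓝[<] 1) (𝓝 l) := by
  rw [Metric.tendsto_nhds]
  intro ε hε
  rw [Metric.tendsto_atTop] at hl
  obtain ⟨K, hK⟩ := hl (ε / 3) (by positivity)
  have hK' : ∀ k, K ≤ k → ‖t k - l * u k‖ ≤ ε / 3 * u k := fun k hk => by
    have h := (hK k hk).le
    have huk : (u k : ℂ) ≠ 0 := by exact_mod_cast (hu k).ne'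
    have e : t k - l * u k = (t k / u k - l) * u k := by field_simp
    rw [e, norm_mul, Complex.norm_real, Real.norm_of_nonneg (hu k).le]
    rw [dist_eq_norm] at h
    exact mul_le_mul_of_nonneg_right h (hu k).le
  set S := ∑ k ∈ Finset.range K, ‖t k - l * u k‖
  have hS : 0 ≤ S := Finset.sum_nonneg fun _ _ => norm_nonneg _
  filter_upwards [hUt.eventually_gt_atTop (S / (ε / 3)), hUt.eventually_gt_atTop 0,
    Ioo_mem_nhdsLT (show (0 : ℝ) < 1 by norm_num)] with x h1 h2 hx
  have h3 := norm_powerSum_sub_le ht hU (fun k => mul_nonneg (by positivity) (hu k).le) hK' hx.1 hx.2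
  have h4 : S < U x * (ε / 3) := (div_lt_iff₀ (by positivity)).1 h1
  have hUx : (U x : ℂ) ≠ 0 := by exact_mod_cast h2.ne'
  have e : powerSum t x / U x - l = (powerSum t x - l * U x) / U x := by field_simp
  rw [dist_eq_norm, e, norm_div, Complex.norm_real, Real.norm_of_nonneg h2.le, div_lt_iff₀ h2]
  nlinarith

/-- The comparison series is the binomial series of (1-x)^(-S), with coefficients (S)_k / k!. The
hypothesis `hl` is the limit of the coefficient quotients, and S > 0 makes the comparison series
diverge at 1. -/
theorem tendsto_rpow_mul_hypergeometric {A B C : ℂ} {S : ℝ} (hS : 0 < S) {l : ℂ}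
    (hl : Tendsto (fun k => poch A k * poch B k / (poch C k * poch S k)) atTop (𝓝 l)) :
    Tendsto (fun x : ℝ => (x : ℂ) ^ (S : ℂ) * ordinaryHypergeometric A B C (1 - x : ℂ))
      (𝓝[>] 0) (𝓝 l) := by
  have hpos : ∀ k : ℕ, 0 < (ascPochhammer ℝ k).eval S := fun k => ascPochhammer_pos k S hS
  have hcast : ∀ k : ℕ, (((ascPochhammer ℝ k).eval S : ℝ) : ℂ) = poch S k := fun k => by
    have := ascPochhammer_eval₂ (Complex.ofRealHom) k S
    exact (this.trans (Polynomial.eval₂_hom _ _)).symm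
  have key := tendsto_powerSum_div (t := gaussCoeff A B C)
    (u := fun k => (ascPochhammer ℝ k).eval S / k.factorial) (U := fun x => (1 - x) ^ (-S))
    (convergesOnDisc_gaussCoeff A B C)
    (fun k => div_pos (hpos k) (by exact_mod_cast k.factorial_pos))
    (fun x hx0 hx1 => by
      have h := hasSum_binomial (S : ℂ) (z := x)
        (by rwa [Complex.norm_real, Real.norm_of_nonneg hx0.le])
      rw [← Complex.hasSum_ofReal]
      have e : (((1 - x) ^ (-S) : ℝ) : ℂ) = (1 - x : ℂ) ^ (-(S : ℂ)) := by
        rw [Complex.ofReal_cpow (by linarith)]; push_cast; rfl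
      rw [e]
      refine h.of_terms_eq fun k => ?_
      push_cast
      rw [hcast])
    (by
      have h : Tendsto (fun x : ℝ => 1 - x) (𝓝[<] 1) (𝓝[>] 0) := by
        refine tendsto_nhdsWithin_iff.2 ⟨?_, ?_⟩
        · have : Tendsto (fun x : ℝ => 1 - x) (𝓝 1) (𝓝 (1 - 1)) :=
            (continuous_const.sub continuous_id).tendsto 1
          rw [sub_self] at this
          exact this.mono_left nhdsWithin_le_nhds
        · filter_upwards [self_mem_nhdsWithin] with x hx
          exact sub_pos.2 (show x < 1 from hx)
      exact (tendsto_rpow_neg_nhdsGT_zero (neg_neg_of_pos hS)).comp h)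
    (l := l)
    (by
      refine hl.congr fun k => ?_
      rw [gaussCoeff]
      push_cast
      rw [hcast]
      have : (k.factorial : ℂ) ≠ 0 := by exact_mod_cast k.factorial_ne_zero
      field_simp)
  have h : Tendsto (fun x : ℝ => 1 - x) (𝓝[>] 0) (𝓝[<] 1) := by
    refine tendsto_nhdsWithin_iff.2 ⟨?_, ?_⟩
    · have : Tendsto (fun x : ℝ => 1 - x) (𝓝 0) (𝓝 (1 - 0)) :=
        (continuous_const.sub continuous_id).tendsto 0
      rw [sub_zero] at this
      exact this.mono_left nhdsWithin_le_nhds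
    · filter_upwards [self_mem_nhdsWithin] with x hx
      have : 0 < x := hx
      show 1 - x < 1
      linarith
  refine (key.comp h).congr' ?_
  filter_upwards [self_mem_nhdsWithin] with x hx
  have hx : 0 < x := hx
  simp only [Function.comp_apply]
  rw [ordinaryHypergeometric_eq_powerSum, sub_sub_cancel, Real.rpow_neg hx.le, Complex.ofReal_inv,
    Complex.ofReal_cpow hx.le, div_inv_eq_mul, mul_comm]
  push_cast
  rfl

theorem real_ne_neg_nat {S : ℝ} (hS : 0 < S) (k : ℕ) : (S : ℂ) ≠ -k := by
  intro h
  have h2 : S = -(k : ℝ) := by exact_mod_cast h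
  have : (0 : ℝ) ≤ k := k.cast_nonneg
  linarith

theorem tendsto_hypergeometric_leading {A B C : ℂ} {S : ℝ} (hS : 0 < S) (hC : ∀ k : ℕ, C ≠ -k)
    (h : A + B = C + S) :
    Tendsto (fun x : ℝ => (x : ℂ) ^ (S : ℂ) * ordinaryHypergeometric A B C (1 - x : ℂ))
      (𝓝[>] 0) (𝓝 (Complex.Gamma C * Complex.Gamma S / (Complex.Gamma A * Complex.Gamma B))) := by
  refine tendsto_rpow_mul_hypergeometric hS ?_
  rw [← tendsto_add_atTop_iff_nat 1]
  refine (tendsto_poch_quotient (d := 0) hC (real_ne_neg_nat hS) (by rw [h]; ring)).congr fun n => ?_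
  simp

/-- The coefficients are smaller than those of x^(-S) by a factor of order 1/k. This disposes of the
terms of the Wronskian in which the solution at 1 is not differentiated. -/
theorem tendsto_hypergeometric_subleading {A B C : ℂ} {S : ℝ} (hS : 0 < S) (hC : ∀ k : ℕ, C ≠ -k)
    (h : A + B = C + S - 1) :
    Tendsto (fun x : ℝ => (x : ℂ) ^ (S : ℂ) * ordinaryHypergeometric A B C (1 - x : ℂ))
      (𝓝[>] 0) (𝓝 0) := by
  refine tendsto_rpow_mul_hypergeometric hS ?_
  rw [← tendsto_add_atTop_iff_nat 1]
  have h1 := tendsto_poch_quotient (d := -1) hC (real_ne_neg_nat hS) (by rw [h]; ring)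
  have h2 := h1.mul (tendsto_inv_atTop_nhds_zero_nat (𝕜 := ℂ))
  rw [mul_zero] at h2
  refine h2.congr' ?_
  filter_upwards [eventually_gt_atTop 0] with n hn
  have hn0 : (n : ℂ) ≠ 0 := by exact_mod_cast hn.ne'
  rw [neg_neg, Complex.cpow_one, mul_assoc, mul_inv_cancel₀ hn0, mul_one]

/-! ### The connection formula between `0` and `1` -/

/-- The common domain of convergence of power series in `z` and in `1 - z`. -/
def lens : Set ℂ := Metric.ball 0 1 ∩ Metric.ball 1 1

theorem mem_lens {z : ℂ} : z ∈ lens ↔ ‖z‖ < 1 ∧ ‖1 - z‖ < 1 := by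
  simp [lens, dist_eq_norm, norm_sub_rev]

theorem isOpen_lens : IsOpen lens := Metric.isOpen_ball.inter Metric.isOpen_ball

theorem isPreconnected_lens : IsPreconnected lens :=
  ((convex_ball _ _).inter (convex_ball _ _)).isPreconnected

theorem lens_slit {z : ℂ} (hz : z ∈ lens) : z ∈ Complex.slitPlane ∧ 1 - z ∈ Complex.slitPlane := by
  rw [mem_lens] at hz
  constructor
  · have := Complex.mem_slitPlane_of_norm_lt_one (z := z - 1) (by rw [norm_sub_rev]; exact hz.2)
    simpa using this
  · have := Complex.mem_slitPlane_of_norm_lt_one (z := -z) (by simpa using hz.1)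
    simpa [sub_eq_add_neg] using this

theorem ofReal_mem_lens {x : ℝ} (h0 : 0 < x) (h1 : x < 1) : (x : ℂ) ∈ lens := by
  rw [mem_lens]
  have e : (1 - x : ℂ) = ((1 - x : ℝ) : ℂ) := by push_cast; rfl
  rw [e, Complex.norm_real, Complex.norm_real, Real.norm_of_nonneg h0.le,
    Real.norm_of_nonneg (by linarith)]
  constructor <;> linarith

/-! ### Solutions of the hypergeometric equation on the lens and their Wronskians -/

theorem cpow_sub_one_mul {z : ℂ} (hz : z ≠ 0) (p : ℂ) : z ^ (p - 1) * z = z ^ p := by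
  rw [Complex.cpow_sub _ _ hz, Complex.cpow_one, div_mul_cancel₀ _ hz]

/-- `u` solves the hypergeometric equation on the lens, with derivatives `u'`, `u''`. -/
structure SolvesHypergeometric (a b c : ℂ) (u u' u'' : ℂ → ℂ) : Prop where
  deriv1 : ∀ z ∈ lens, HasDerivAt u (u' z) z
  deriv2 : ∀ z ∈ lens, HasDerivAt u' (u'' z) z
  eqn : ∀ z ∈ lens, z * (1 - z) * u'' z + (c - (a + b + 1) * z) * u' z - a * b * u z = 0

theorem SolvesHypergeometric.wronskian {a b c s : ℂ} {u u' u'' v v' v'' : ℂ → ℂ}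
    (hu : SolvesHypergeometric a b c u u' u'') (hv : SolvesHypergeometric a b c v v' v'')
    (hs : s = c - a - b) :
    ∃ K, ∀ z ∈ lens, z ^ c * (1 - z) ^ (1 - s) * (u z * v' z - u' z * v z) = K := by
  -- Abel's identity: z^c (1-z)^(1-s) has logarithmic derivative (c - (a+b+1) z) / (z (1-z)), which
  -- cancels the first-order term of the equation.
  have hd : ∀ z ∈ lens, HasDerivAt
      (fun z => z ^ c * (1 - z) ^ (1 - s) * (u z * v' z - u' z * v z)) 0 z := fun z hz => by
    obtain ⟨h0, h1⟩ := lens_slit hz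
    have hz0 := Complex.slitPlane_ne_zero h0
    have hz1 := Complex.slitPlane_ne_zero h1
    have d1 := (hasDerivAt_id z).cpow_const (c := c) h0
    have d2 := ((hasDerivAt_id z).const_sub 1).cpow_const (c := 1 - s) h1
    have d3 := ((hu.deriv1 z hz).mul (hv.deriv2 z hz)).sub ((hu.deriv2 z hz).mul (hv.deriv1 z hz))
    refine ((d1.mul d2).mul d3).congr_deriv ?_
    have e1 : z ^ c = z ^ (c - 1) * z := (cpow_sub_one_mul hz0 c).symm
    have e2 : (1 - z) ^ (1 - s) = (1 - z) ^ (1 - s - 1) * (1 - z) :=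
      (cpow_sub_one_mul hz1 _).symm
    simp only [id, Pi.mul_apply, Pi.sub_apply]
    rw [e1, e2]
    have e3 := hu.eqn z hz
    have e4 := hv.eqn z hz
    subst hs
    linear_combination (z ^ (c - 1) * (1 - z) ^ (1 - (c - a - b) - 1)) * (u z * e4 - v z * e3)
  by_cases hne : lens.Nonempty
  · obtain ⟨z₀, hz₀⟩ := hne
    refine ⟨z₀ ^ c * (1 - z₀) ^ (1 - s) * (u z₀ * v' z₀ - u' z₀ * v z₀), fun z hz => ?_⟩
    exact isOpen_lens.is_const_of_deriv_eq_zero isPreconnected_lens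
      (fun z hz => (hd z hz).differentiableAt.differentiableWithinAt)
      (fun z hz => (hd z hz).deriv) hz hz₀
  · exact ⟨0, fun z hz => (hne ⟨z, hz⟩).elim⟩

theorem solvesHypergeometric_zero {a b c : ℂ} (hc : ∀ k : ℕ, c ≠ -k) :
    SolvesHypergeometric a b c (ordinaryHypergeometric a b c)
      (fun z => a * b / c * ordinaryHypergeometric (a + 1) (b + 1) (c + 1) z)
      (fun z => a * b / c * ((a + 1) * (b + 1) / (c + 1) *
        ordinaryHypergeometric (a + 2) (b + 2) (c + 2) z)) where
  deriv1 z hz := hasDerivAt_ordinaryHypergeometric a b c (mem_lens.1 hz).1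
  deriv2 z hz := by
    have h := hasDerivAt_ordinaryHypergeometric (a + 1) (b + 1) (c + 1) (mem_lens.1 hz).1
    have e : ∀ x : ℂ, x + 1 + 1 = x + 2 := fun x => by ring
    rw [e, e, e] at h
    exact h.const_mul _
  eqn z hz := ordinaryHypergeometric_ode hc (mem_lens.1 hz).1

theorem one_sub_mem_lens {z : ℂ} (hz : z ∈ lens) : 1 - z ∈ lens := by
  rw [mem_lens] at hz ⊢
  rw [sub_sub_cancel]
  exact hz.symm

/-- The substitution z ↦ 1 - z permutes the hypergeometric equations, replacing c by a + b + 1 - c.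
-/
theorem SolvesHypergeometric.comp_one_sub {a b c : ℂ} {u u' u'' : ℂ → ℂ}
    (hu : SolvesHypergeometric a b (a + b + 1 - c) u u' u'') :
    SolvesHypergeometric a b c (fun z => u (1 - z)) (fun z => -u' (1 - z))
      (fun z => u'' (1 - z)) where
  deriv1 z hz := by
    have := (hu.deriv1 _ (one_sub_mem_lens hz)).comp z ((hasDerivAt_id z).const_sub 1)
    simpa using! this
  deriv2 z hz := by
    have := ((hu.deriv2 _ (one_sub_mem_lens hz)).comp z ((hasDerivAt_id z).const_sub 1)).neg
    simpa using! this
  eqn z hz := by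
    have := hu.eqn _ (one_sub_mem_lens hz)
    linear_combination this

/-- Conjugation with z^(1-c) turns the equation into another hypergeometric one; this produces the
second local solution at 0. -/
theorem SolvesHypergeometric.cpow_mul {a b c s : ℂ} {u u' u'' : ℂ → ℂ} (hs : s = 1 - c)
    (hu : SolvesHypergeometric (a + s) (b + s) (1 + s) u u' u'') :
    SolvesHypergeometric a b c (fun z => z ^ s * u z)
      (fun z => s * z ^ (s - 1) * u z + z ^ s * u' z)
      (fun z => s * (s - 1) * z ^ (s - 2) * u z + 2 * (s * z ^ (s - 1) * u' z) + z ^ s * u'' z) where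
  deriv1 z hz := by
    have d1 := (hasDerivAt_id z).cpow_const (c := s) (lens_slit hz).1
    refine (d1.mul (hu.deriv1 z hz)).congr_deriv ?_
    simp only [id]; ring
  deriv2 z hz := by
    have d1 := (hasDerivAt_id z).cpow_const (c := s) (lens_slit hz).1
    have d2 := ((hasDerivAt_id z).cpow_const (c := s - 1) (lens_slit hz).1).const_mul s
    refine ((d2.mul (hu.deriv1 z hz)).add (d1.mul (hu.deriv2 z hz))).congr_deriv ?_
    simp only [id]
    rw [show s - 1 - 1 = s - 2 by ring]; ring
  eqn z hz := by
    have hz0 := Complex.slitPlane_ne_zero (lens_slit hz).1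
    have e1 : z ^ (s - 1) = z ^ (s - 2) * z := by
      rw [show s - 2 = s - 1 - 1 by ring, cpow_sub_one_mul hz0]
    have e2 : z ^ s = z ^ (s - 2) * z * z := by
      rw [← e1, cpow_sub_one_mul hz0]
    rw [e2, e1]
    have := hu.eqn z hz
    obtain rfl : c = 1 - s := by rw [hs]; ring
    linear_combination z ^ (s - 2) * z * z * this

theorem div_Gamma_add_one (a : ℂ) : a / Complex.Gamma (a + 1) = 1 / Complex.Gamma a := by
  have := Complex.one_div_Gamma_eq_self_mul_one_div_Gamma_add_one a
  rw [one_div, this]; ring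

theorem tendsto_ofReal_zero_right : Tendsto (fun x : ℝ => (x : ℂ)) (𝓝[>] 0) (𝓝 0) := by
  have : Tendsto (fun x : ℝ => (x : ℂ)) (𝓝 0) (𝓝 ((0 : ℝ) : ℂ)) :=
    Complex.continuous_ofReal.tendsto 0
  rw [Complex.ofReal_zero] at this
  exact this.mono_left nhdsWithin_le_nhds

theorem tendsto_hypergeometric_zero_right (a b c : ℂ) :
    Tendsto (fun x : ℝ => ordinaryHypergeometric a b c (x : ℂ)) (𝓝[>] 0) (𝓝 1) := by
  have h := (continuousAt_ordinaryHypergeometric a b c (z := 0) (by simp)).tendsto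
  rw [ordinaryHypergeometric_at_zero] at h
  exact h.comp tendsto_ofReal_zero_right

theorem tendsto_one_sub_cpow (s : ℂ) :
    Tendsto (fun x : ℝ => (1 - x : ℂ) ^ s) (𝓝[>] 0) (𝓝 1) := by
  have h1 : ContinuousAt (fun z : ℂ => (1 - z) ^ s) 0 := by
    refine ContinuousAt.cpow (by fun_prop) continuousAt_const ?_
    simp
  have h2 := h1.tendsto.comp tendsto_ofReal_zero_right
  simpa [Function.comp_def] using h2

theorem eventually_mem_lens : ∀ᶠ x : ℝ in 𝓝[>] 0, (x : ℂ) ∈ lens := by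
  filter_upwards [Ioo_mem_nhdsGT (show (0 : ℝ) < 1 by norm_num)] with x hx
  exact ofReal_mem_lens hx.1 hx.2

/-- The connection formula `0 ↔ 1` for the Gauss series, away from integral `c - a - b`. -/
theorem hypergeometric_connection {a b : ℂ} {c s : ℝ} (hs : (s : ℂ) = c - a - b) (hc : 0 < c)
    (hsZ : ∀ k : ℤ, s ≠ k) {z : ℂ} (hz : z ∈ lens) :
    ordinaryHypergeometric a b (c : ℂ) z =
      Complex.Gamma c * Complex.Gamma s / (Complex.Gamma (c - a) * Complex.Gamma (c - b)) *
        ordinaryHypergeometric a b (1 - s : ℂ) (1 - z) +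
      Complex.Gamma c * Complex.Gamma (-s) / (Complex.Gamma a * Complex.Gamma b) *
        ((1 - z) ^ (s : ℂ) * ordinaryHypergeometric (c - a : ℂ) (c - b) (1 + s) (1 - z)) := by
  have hcN : ∀ k : ℕ, (c : ℂ) ≠ -k := real_ne_neg_nat hc
  have h1s : ∀ k : ℕ, (1 - s : ℂ) ≠ -k := fun k h => hsZ (1 + k) (by
    have h2 : (1 - s : ℝ) = -(k : ℝ) := by exact_mod_cast h
    push_cast; linarith)
  have h2s : ∀ k : ℕ, (1 + s : ℂ) ≠ -k := fun k h => hsZ (-(1 + k)) (by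
    have h2 : (1 + s : ℝ) = -(k : ℝ) := by exact_mod_cast h
    push_cast; linarith)
  have hs0 : (s : ℂ) ≠ 0 := by
    have := hsZ 0
    simpa using this
  have h1s0 : (1 - s : ℂ) ≠ 0 := by simpa using h1s 0
  have h2s0 : (1 + s : ℂ) ≠ 0 := by simpa using h2s 0
  have h1s1 : ∀ k : ℕ, (1 - s + 1 : ℂ) ≠ -k := fun k h => h1s (k + 1) (by
    push_cast; linear_combination h)
  have h2s1 : ∀ k : ℕ, (1 + s + 1 : ℂ) ≠ -k := fun k h => h2s (k + 1) (by
    push_cast; linear_combination h)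
  have solF := solvesHypergeometric_zero (a := a) (b := b) hcN
  have sol1 := SolvesHypergeometric.comp_one_sub (c := (c : ℂ)) (a := a) (b := b)
    (by rw [show a + b + 1 - (c : ℂ) = 1 - s by rw [hs]; ring]
        exact solvesHypergeometric_zero (a := a) (b := b) h1s)
  have sol2' := SolvesHypergeometric.cpow_mul (a := a) (b := b) (c := 1 - s) (s := s) (by ring)
    (solvesHypergeometric_zero (a := a + s) (b := b + s) h2s)
  have sol2 := SolvesHypergeometric.comp_one_sub (c := (c : ℂ)) (a := a) (b := b)
    (by rw [show a + b + 1 - (c : ℂ) = 1 - s by rw [hs]; ring]; exact sol2')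
  have ea : a + s = c - b := by rw [hs]; ring
  have eb : b + s = c - a := by rw [hs]; ring
  rw [ea, eb] at sol2
  -- The constants K1 and K2 are evaluated at z → 0, where only z^c times the derivative of the
  -- solution at 1 survives. K3 is evaluated at z → 1, where both solutions are explicit.
  obtain ⟨K1, hK1⟩ := solF.wronskian sol1 hs
  obtain ⟨K2, hK2⟩ := solF.wronskian sol2 hs
  obtain ⟨K3, hK3⟩ := sol1.wronskian sol2 hs
  have lF := tendsto_hypergeometric_zero_right a b c
  have lF' := (tendsto_hypergeometric_zero_right (a + 1) (b + 1) (c + 1)).const_mul (a * b / (c : ℂ))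
  have v1 : K1 = -(Complex.Gamma (1 - s) * Complex.Gamma c / (Complex.Gamma a * Complex.Gamma b)) := by
    have l1 := (tendsto_hypergeometric_leading (A := a + 1) (B := b + 1) (C := 1 - s + 1) hc h1s1
      (by rw [hs]; ring)).const_mul (a * b / (1 - s : ℂ))
    have l2 := tendsto_hypergeometric_subleading (A := a) (B := b) (C := 1 - s) hc h1s
      (by rw [hs]; ring)
    have l3 := (tendsto_one_sub_cpow (1 - s : ℂ)).mul ((lF.mul l1.neg).sub (lF'.mul l2))
    have l4 : Tendsto (fun _ : ℝ => K1) (𝓝[>] 0) (𝓝 K1) := tendsto_const_nhds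
    refine (tendsto_nhds_unique (l4.congr' ?_) l3).trans ?_
    · filter_upwards [eventually_mem_lens] with x hx
      rw [← hK1 x hx]; ring
    · rw [Complex.Gamma_add_one _ h1s0]
      have e1 := div_Gamma_add_one a
      have e2 := div_Gamma_add_one b
      have e3 : a * b / (1 - s : ℂ) * ((1 - s) * Complex.Gamma (1 - s) * Complex.Gamma c /
          (Complex.Gamma (a + 1) * Complex.Gamma (b + 1))) = Complex.Gamma (1 - s) * Complex.Gamma c *
          (a / Complex.Gamma (a + 1) * (b / Complex.Gamma (b + 1))) := by
        simp only [div_eq_mul_inv, mul_inv]; field_simp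
      rw [e3, e1, e2]
      simp only [div_eq_mul_inv, mul_inv]
      ring
  have v2 : K2 = -(Complex.Gamma (1 + s) * Complex.Gamma c /
      (Complex.Gamma (c - a) * Complex.Gamma (c - b))) := by
    have l1 := (tendsto_hypergeometric_leading (A := c - b + 1) (B := c - a + 1) (C := 1 + s + 1) hc
      h2s1 (by rw [hs]; ring)).const_mul ((c - b) * (c - a) / (1 + s : ℂ))
    have l2 := tendsto_hypergeometric_subleading (A := c - b) (B := c - a) (C := 1 + s) hc h2s
      (by rw [hs]; ring)
    have l0 := ((tendsto_one_sub_cpow (s - 1 : ℂ)).const_mul (s : ℂ)).mul l2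
    have l0' := (tendsto_one_sub_cpow (s : ℂ)).mul l1
    have l0'' := (tendsto_one_sub_cpow (s : ℂ)).mul l2
    have l3 := (tendsto_one_sub_cpow (1 - s : ℂ)).mul ((lF.mul (l0.add l0').neg).sub (lF'.mul l0''))
    have l4 : Tendsto (fun _ : ℝ => K2) (𝓝[>] 0) (𝓝 K2) := tendsto_const_nhds
    refine (tendsto_nhds_unique (l4.congr' ?_) l3).trans ?_
    · filter_upwards [eventually_mem_lens] with x hx
      rw [← hK2 x hx]; ring
    · rw [Complex.Gamma_add_one _ h2s0]
      have e1 := div_Gamma_add_one (c - a)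
      have e2 := div_Gamma_add_one (c - b)
      have e3 : (c - b) * (c - a) / (1 + s : ℂ) * ((1 + s) * Complex.Gamma (1 + s) * Complex.Gamma c /
          (Complex.Gamma (c - b + 1) * Complex.Gamma (c - a + 1))) =
          Complex.Gamma (1 + s) * Complex.Gamma c *
          ((c - a) / Complex.Gamma (c - a + 1) * ((c - b) / Complex.Gamma (c - b + 1))) := by
        simp only [div_eq_mul_inv, mul_inv]; field_simp
      rw [e3, e1, e2]
      simp only [div_eq_mul_inv, mul_inv]
      ring
  have v3 : K3 = -s := by
    have hone : ∀ᶠ x : ℝ in 𝓝[>] 0, ((1 : ℂ) - x) ∈ lens ∧ (x : ℂ) ∈ lens := by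
      filter_upwards [eventually_mem_lens] with x hx using ⟨one_sub_mem_lens hx, hx⟩
    have l1 := tendsto_hypergeometric_zero_right a b (1 - s)
    have l1' := (tendsto_hypergeometric_zero_right (a + 1) (b + 1) (1 - s + 1)).const_mul
      (a * b / (1 - s : ℂ))
    have l2 := tendsto_hypergeometric_zero_right (c - b) (c - a) (1 + s)
    have l2' := (tendsto_hypergeometric_zero_right (c - b + 1) (c - a + 1) (1 + s + 1)).const_mul
      ((c - b) * (c - a) / (1 + s : ℂ))
    have l3 := (tendsto_one_sub_cpow (c : ℂ)).mul ((l1.mul ((l2.const_mul (-s : ℂ)).sub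
      (tendsto_ofReal_zero_right.mul l2'))).add (l1'.mul (tendsto_ofReal_zero_right.mul l2)))
    have l4 : Tendsto (fun _ : ℝ => K3) (𝓝[>] 0) (𝓝 K3) := tendsto_const_nhds
    refine (tendsto_nhds_unique (l4.congr' ?_) l3).trans ?_
    · filter_upwards [hone] with x hx
      have hx0 := Complex.slitPlane_ne_zero (lens_slit hx.2).1
      rw [← hK3 (1 - x) hx.1, sub_sub_cancel]
      have e0 : (x : ℂ) ^ (1 - s : ℂ) * (x : ℂ) ^ (s : ℂ) = x := by
        rw [← Complex.cpow_add _ _ hx0]; simp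
      have e1 : (x : ℂ) ^ (1 - s : ℂ) * (x : ℂ) ^ (s - 1 : ℂ) = 1 := by
        rw [← Complex.cpow_add _ _ hx0]; simp
      generalize ordinaryHypergeometric a b (1 - s : ℂ) (x : ℂ) = g1
      generalize ordinaryHypergeometric (a + 1) (b + 1) (1 - s + 1 : ℂ) (x : ℂ) = g1'
      generalize ordinaryHypergeometric (c - b : ℂ) (c - a) (1 + s) (x : ℂ) = g2
      generalize ordinaryHypergeometric (c - b + 1 : ℂ) (c - a + 1) (1 + s + 1) (x : ℂ) = g2'
      linear_combination (1 - (x : ℂ)) ^ (c : ℂ) * (a * b / (1 - s) * g1' * g2 -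
        g1 * ((c - b) * (c - a) / (1 + s) * g2')) * e0 - (1 - (x : ℂ)) ^ (c : ℂ) * g1 * s * g2 * e1
    · ring
  obtain ⟨hz0, hz1⟩ := lens_slit hz
  have hne : z ^ (c : ℂ) * (1 - z) ^ (1 - s : ℂ) ≠ 0 := by
    have a0 := Complex.slitPlane_ne_zero hz0
    have a1 := Complex.slitPlane_ne_zero hz1
    simp [Complex.cpow_eq_zero_iff, a0, a1]
  have w1 := hK1 z hz
  have w2 := hK2 z hz
  have w3 := hK3 z hz
  have hsymm : ordinaryHypergeometric (c - a : ℂ) (c - b) (1 + s) (1 - z) =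
      ordinaryHypergeometric (c - b : ℂ) (c - a) (1 + s) (1 - z) := by
    rw [ordinaryHypergeometric, ordinaryHypergeometricSeries_symm]; rfl
  rw [hsymm]
  -- A determinant with two equal rows: u W(v,w) - v W(u,w) + w W(u,v) = 0. As K3 = -s is not 0, it
  -- can be solved for the Gauss series at 0.
  have lin : ordinaryHypergeometric a b (c : ℂ) z * K3 -
      ordinaryHypergeometric a b (1 - s : ℂ) (1 - z) * K2 +
      ((1 - z) ^ (s : ℂ) * ordinaryHypergeometric (c - b : ℂ) (c - a) (1 + s) (1 - z)) * K1 = 0 := by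
    rw [← w1, ← w2, ← w3]; ring
  rw [v1, v2, v3] at lin
  have g1 : Complex.Gamma (1 + s) = s * Complex.Gamma s := by
    rw [add_comm, Complex.Gamma_add_one _ hs0]
  have g2 : Complex.Gamma (1 - s) = -s * Complex.Gamma (-s) := by
    rw [show (1 - s : ℂ) = -s + 1 by ring, Complex.Gamma_add_one _ (neg_ne_zero.2 hs0)]
  rw [g1, g2] at lin
  refine mul_left_cancel₀ hs0 ?_
  linear_combination -lin

/-! ### Euler's integral and continuation across the cut -/

/-- Two holomorphic functions that agree on a real interval to the right of a point of a connected
domain agree on the domain. -/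
theorem eqOn_of_eventually_eq_real {U : Set ℂ} (hU : IsOpen U) (hU' : IsPreconnected U)
    {f g : ℂ → ℂ} (hf : DifferentiableOn ℂ f U) (hg : DifferentiableOn ℂ g U) {x₀ : ℝ}
    (hx₀ : (x₀ : ℂ) ∈ U) (h : ∀ᶠ x : ℝ in 𝓝[>] x₀, f x = g x) : EqOn f g U := by
  refine (hf.analyticOnNhd hU).eqOn_of_preconnected_of_frequently_eq (hg.analyticOnNhd hU) hU' hx₀ ?_
  have ht : Tendsto (fun x : ℝ => (x : ℂ)) (𝓝[>] x₀) (𝓝[≠] (x₀ : ℂ)) := by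
    refine tendsto_nhdsWithin_iff.2 ⟨?_, ?_⟩
    · exact (Complex.continuous_ofReal.tendsto x₀).mono_left nhdsWithin_le_nhds
    · filter_upwards [self_mem_nhdsWithin] with x hx
      have : x ≠ x₀ := ne_of_gt hx
      simpa using this
  exact ht.frequently h.frequently

/-- Differentiation under the integral sign. Cauchy's estimate on discs of radius R/4 inside a
compact disc where P is bounded dominates the derivative by a multiple of |k|. Measurability of the
derivative in t comes from writing it as a limit of difference quotients. -/
theorem differentiableOn_integral_param {U : Set ℂ} (hU : IsOpen U) {k : ℝ → ℂ}
    (hk : IntegrableOn k (Ioo 0 1)) {P : ℂ → ℝ → ℂ}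
    (hP : ContinuousOn (Function.uncurry P) (U ×ˢ Icc 0 1))
    (hd : ∀ t ∈ Icc (0 : ℝ) 1, DifferentiableOn ℂ (fun ξ => P ξ t) U) :
    DifferentiableOn ℂ (fun ξ => ∫ t in Ioo (0 : ℝ) 1, k t * P ξ t) U := by
  intro ξ₀ hξ₀
  obtain ⟨R, hR, hRU⟩ := Metric.isOpen_iff.1 hU ξ₀ hξ₀
  have hcb : Metric.closedBall ξ₀ (R / 2) ⊆ U :=
    (Metric.closedBall_subset_ball (by linarith)).trans hRU
  have hcomp : IsCompact (Metric.closedBall ξ₀ (R / 2) ×ˢ Icc (0 : ℝ) 1) :=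
    (isCompact_closedBall _ _).prod isCompact_Icc
  obtain ⟨M, hM⟩ := hcomp.exists_bound_of_continuousOn (hP.mono (prod_mono hcb le_rfl))
  have hsec : ∀ ξ ∈ U, ContinuousOn (P ξ) (Icc 0 1) := fun ξ hξ =>
    hP.comp (f := fun t => (ξ, t)) (by fun_prop) fun t ht => ⟨hξ, ht⟩
  have hmeasP : ∀ ξ ∈ U, AEStronglyMeasurable (P ξ) (volume.restrict (Ioo (0 : ℝ) 1)) :=
    fun ξ hξ => ((hsec ξ hξ).mono Ioo_subset_Icc_self).aestronglyMeasurable measurableSet_Ioo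
  have hball : Metric.ball ξ₀ (R / 4) ∈ 𝓝 ξ₀ := Metric.ball_mem_nhds _ (by positivity)
  have hderiv : ∀ t ∈ Ioo (0 : ℝ) 1, ∀ ξ ∈ U, HasDerivAt (fun ξ => P ξ t) (deriv (fun ξ => P ξ t) ξ) ξ :=
    fun t ht ξ hξ => ((hd t (Ioo_subset_Icc_self ht)).differentiableAt (hU.mem_nhds hξ)).hasDerivAt
  have hmeas' : AEStronglyMeasurable (fun t => deriv (fun ξ => P ξ t) ξ₀)
      (volume.restrict (Ioo (0 : ℝ) 1)) := by
    have hseq : Tendsto (fun n : ℕ => ξ₀ + (((1 : ℝ) / ((n : ℝ) + 1) : ℝ) : ℂ)) atTop (𝓝[≠] ξ₀) := by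
      refine tendsto_nhdsWithin_iff.2 ⟨?_, Eventually.of_forall fun n => ?_⟩
      · have h1 := (Complex.continuous_ofReal.tendsto 0).comp
          (tendsto_one_div_add_atTop_nhds_zero_nat (𝕜 := ℝ))
        have h2 := h1.const_add ξ₀
        simpa using! h2
      · have : ((1 : ℝ) / ((n : ℝ) + 1)) ≠ 0 := by positivity
        simp only [mem_compl_iff, mem_singleton_iff, add_eq_left, Complex.ofReal_eq_zero]
        exact this
    have hev : ∀ᶠ n : ℕ in atTop, ξ₀ + (((1 : ℝ) / ((n : ℝ) + 1) : ℝ) : ℂ) ∈ U :=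
      (hseq.mono_right nhdsWithin_le_nhds).eventually (hU.mem_nhds hξ₀)
    obtain ⟨N, hN⟩ := eventually_atTop.1 hev
    refine aestronglyMeasurable_of_tendsto_ae atTop
      (f := fun n t => slope (fun ξ => P ξ t) ξ₀ (ξ₀ + (((1 : ℝ) / (((n + N : ℕ) : ℝ) + 1) : ℝ) : ℂ)))
      (fun n => ?_) ?_
    · simp only [slope, vsub_eq_sub]
      exact AEStronglyMeasurable.const_smul
        (((hmeasP _ (hN (n + N) (Nat.le_add_left N n))).sub (hmeasP _ hξ₀))) (_ : ℂ)
    · filter_upwards [ae_restrict_mem measurableSet_Ioo] with t ht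
      have h1 := hasDerivAt_iff_tendsto_slope.1 (hderiv t ht ξ₀ hξ₀)
      exact (h1.comp hseq).comp (tendsto_add_atTop_nat N)
  have hb : ∀ t ∈ Ioo (0 : ℝ) 1, ∀ ξ ∈ Metric.ball ξ₀ (R / 4),
      ‖deriv (fun ξ => P ξ t) ξ‖ ≤ M / (R / 4) := by
    intro t ht ξ hξ
    have hsub : Metric.closedBall ξ (R / 4) ⊆ Metric.closedBall ξ₀ (R / 2) := by
      intro y hy
      rw [Metric.mem_closedBall] at hy ⊢
      rw [Metric.mem_ball] at hξ
      linarith [dist_triangle y ξ ξ₀]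
    refine Complex.norm_deriv_le_of_forall_mem_sphere_norm_le (by positivity) ?_ ?_
    · refine ((hd t (Ioo_subset_Icc_self ht)).mono ?_).diffContOnCl
      rw [closure_ball _ (by positivity)]
      exact hsub.trans hcb
    · intro y hy
      exact hM (y, t) ⟨hsub (Metric.sphere_subset_closedBall hy), Ioo_subset_Icc_self ht⟩
  have key := hasDerivAt_integral_of_dominated_loc_of_deriv_le (𝕜 := ℂ)
    (μ := volume.restrict (Ioo (0 : ℝ) 1)) (F := fun ξ t => k t * P ξ t)
    (F' := fun ξ t => k t * deriv (fun ξ => P ξ t) ξ) (x₀ := ξ₀)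
    (bound := fun t => ‖k t‖ * (M / (R / 4))) hball ?_ ?_ ?_ ?_ ?_ ?_
  · exact key.2.differentiableAt.differentiableWithinAt
  · filter_upwards [hU.mem_nhds hξ₀] with ξ hξ
    exact hk.aestronglyMeasurable.mul (hmeasP ξ hξ)
  · refine Integrable.mono' (hk.norm.mul_const M) (hk.aestronglyMeasurable.mul (hmeasP ξ₀ hξ₀)) ?_
    filter_upwards [ae_restrict_mem measurableSet_Ioo] with t ht
    rw [norm_mul]
    exact mul_le_mul_of_nonneg_left (hM (ξ₀, t)
      ⟨Metric.mem_closedBall_self (by positivity), Ioo_subset_Icc_self ht⟩) (norm_nonneg _)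
  · exact hk.aestronglyMeasurable.mul hmeas'
  · filter_upwards [ae_restrict_mem measurableSet_Ioo] with t ht ξ hξ
    rw [norm_mul]
    exact mul_le_mul_of_nonneg_left (hb t ht ξ hξ) (norm_nonneg _)
  · exact hk.norm.mul_const _
  · filter_upwards [ae_restrict_mem measurableSet_Ioo] with t ht ξ hξ
    refine (hderiv t ht ξ (hcb ?_)).const_mul _
    exact Metric.ball_subset_closedBall.trans (Metric.closedBall_subset_closedBall (by linarith)) hξ

/-- The homogeneous form of Euler's integral. -/
noncomputable def eulerIntegral (a b c u v : ℂ) : ℂ :=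
  ∫ t in Ioo (0 : ℝ) 1, (t : ℂ) ^ (b - 1) * (1 - (t : ℂ)) ^ (c - b - 1) *
    (((1 - t) + u * t) ^ (a - c) * ((1 - t) + v * t) ^ (-a))

theorem integrableOn_beta {b c : ℂ} (hb : 0 < b.re) (hc : 0 < c.re) :
    IntegrableOn (fun t : ℝ => (t : ℂ) ^ (b - 1) * (1 - (t : ℂ)) ^ (c - 1)) (Ioo 0 1) := by
  have := (intervalIntegrable_iff_integrableOn_Ioo_of_le zero_le_one).1
    (Complex.betaIntegral_convergent hb hc)
  exact this

theorem integral_Ioo_beta (b c : ℂ) :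
    ∫ t in Ioo (0 : ℝ) 1, (t : ℂ) ^ (b - 1) * (1 - (t : ℂ)) ^ (c - 1) = Complex.betaIntegral b c := by
  rw [Complex.betaIntegral, intervalIntegral.integral_of_le zero_le_one, integral_Ioc_eq_integral_Ioo]

theorem segment_mem_slitPlane {v : ℂ} (hv : v ∈ Complex.slitPlane) {t : ℝ} (ht : t ∈ Icc (0 : ℝ) 1) :
    (1 - t : ℂ) + v * t ∈ Complex.slitPlane := by
  have h := Complex.starConvex_one_slitPlane hv (sub_nonneg.2 ht.2) ht.1 (sub_add_cancel 1 t)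
  simpa [mul_comm] using h

theorem differentiableOn_eulerIntegral {a b c : ℂ} (hb : 0 < b.re) (hcb : 0 < (c - b).re)
    {U : Set ℂ} (hU : IsOpen U) {α β : ℂ → ℂ} (hα : DifferentiableOn ℂ α U)
    (hβ : DifferentiableOn ℂ β U) (hα' : ∀ ξ ∈ U, α ξ ∈ Complex.slitPlane)
    (hβ' : ∀ ξ ∈ U, β ξ ∈ Complex.slitPlane) :
    DifferentiableOn ℂ (fun ξ => eulerIntegral a b c (α ξ) (β ξ)) U := by
  refine differentiableOn_integral_param hU (integrableOn_beta hb hcb)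
    (P := fun ξ t => ((1 - t) + α ξ * t) ^ (a - c) * ((1 - t) + β ξ * t) ^ (-a)) ?_ ?_
  · have h1 : ContinuousOn (fun p : ℂ × ℝ => α p.1) (U ×ˢ Icc 0 1) :=
      hα.continuousOn.comp continuousOn_fst fun p hp => hp.1
    have h2 : ContinuousOn (fun p : ℂ × ℝ => β p.1) (U ×ˢ Icc 0 1) :=
      hβ.continuousOn.comp continuousOn_fst fun p hp => hp.1
    have h3 : ContinuousOn (fun p : ℂ × ℝ => (p.2 : ℂ)) (U ×ˢ Icc 0 1) := by fun_prop
    refine ContinuousOn.mul (ContinuousOn.cpow_const ?_ fun p hp => ?_)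
      (ContinuousOn.cpow_const ?_ fun p hp => ?_)
    · exact (continuousOn_const.sub h3).add (h1.mul h3)
    · exact segment_mem_slitPlane (hα' _ hp.1) hp.2
    · exact (continuousOn_const.sub h3).add (h2.mul h3)
    · exact segment_mem_slitPlane (hβ' _ hp.1) hp.2
  · intro t ht
    refine DifferentiableOn.mul (DifferentiableOn.cpow_const ?_ fun ξ hξ => ?_)
      (DifferentiableOn.cpow_const ?_ fun ξ hξ => ?_)
    · fun_prop
    · exact segment_mem_slitPlane (hα' _ hξ) ht
    · fun_prop
    · exact segment_mem_slitPlane (hβ' _ hξ) ht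

theorem ofReal_mul_cpow {x : ℝ} (hx : 0 < x) {z : ℂ} (hz : z ≠ 0) (p : ℂ) :
    ((x : ℂ) * z) ^ p = (x : ℂ) ^ p * z ^ p := by
  have hx0 : (x : ℂ) ≠ 0 := by exact_mod_cast hx.ne'
  rw [Complex.cpow_def_of_ne_zero (mul_ne_zero hx0 hz), Complex.cpow_def_of_ne_zero hx0,
    Complex.cpow_def_of_ne_zero hz, Complex.log_ofReal_mul hx hz, ← Complex.exp_add,
    Complex.ofReal_log hx.le]
  ring_nf

theorem projective_image {r : ℝ} (hr : 0 < r) :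
    (fun t : ℝ => r * t / ((1 - t) + r * t)) '' Ioo 0 1 = Ioo 0 1 := by
  ext y
  constructor
  · rintro ⟨t, ⟨h0, h1⟩, rfl⟩
    have hD : 0 < (1 - t) + r * t := by nlinarith [mul_pos hr h0]
    refine ⟨by positivity, ?_⟩
    simp only
    rw [div_lt_one hD]; linarith
  · rintro ⟨h0, h1⟩
    have hD : 0 < r * (1 - y) + y := by nlinarith [mul_pos hr (sub_pos.2 h1)]
    refine ⟨y / (r * (1 - y) + y), ⟨by positivity, ?_⟩, ?_⟩
    · rw [div_lt_one hD]; nlinarith [mul_pos hr (sub_pos.2 h1)]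
    · have e : (1 - y / (r * (1 - y) + y)) + r * (y / (r * (1 - y) + y)) = r / (r * (1 - y) + y) := by
        field_simp; ring
      simp only
      rw [e]
      field_simp

/-- Substitution t ↦ rt / ((1-t) + rt). The four exponents of the integrand add up to -2, which the
Jacobian r / ((1-t) + rt)^2 compensates: the powers of the denominator that remain are exactly the
factor with u = r. Only positive reals are pulled out of complex powers, so no branch is crossed. -/
theorem eulerIntegral_smul {a b c w : ℂ} {r : ℝ} (hr : 0 < r) (hw : w ∈ Complex.slitPlane) :
    eulerIntegral a b c 1 w = (r : ℂ) ^ b * eulerIntegral a b c r (r * w) := by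
  have hD : ∀ t ∈ Ioo (0 : ℝ) 1, 0 < (1 - t) + r * t := fun t ht => by
    nlinarith [mul_pos hr ht.1, ht.2]
  have hderiv : ∀ t ∈ Ioo (0 : ℝ) 1, HasDerivWithinAt (fun t : ℝ => r * t / ((1 - t) + r * t))
      (r / ((1 - t) + r * t) ^ 2) (Ioo 0 1) t := fun t ht => by
    have d1 : HasDerivAt (fun t : ℝ => r * t) (r * 1) t := (hasDerivAt_id t).const_mul r
    have d2 : HasDerivAt (fun t : ℝ => (1 - t) + r * t) (-1 + r * 1) t :=
      ((hasDerivAt_id t).const_sub 1).add d1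
    refine ((d1.div d2 (hD t ht).ne').congr_deriv ?_).hasDerivWithinAt
    congr 1; ring
  have hinj : InjOn (fun t : ℝ => r * t / ((1 - t) + r * t)) (Ioo 0 1) := fun x hx y hy h => by
    simp only at h
    rw [div_eq_div_iff (hD x hx).ne' (hD y hy).ne'] at h
    have : r * (x - y) = 0 := by linear_combination h
    rcases mul_eq_zero.1 this with h | h
    · exact (hr.ne' h).elim
    · linarith
  have key := integral_image_eq_integral_abs_deriv_smul measurableSet_Ioo hderiv hinj
    (fun t : ℝ => (t : ℂ) ^ (b - 1) * (1 - (t : ℂ)) ^ (c - b - 1) *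
    (((1 - t) + 1 * t) ^ (a - c) * ((1 - t) + w * t) ^ (-a)))
  rw [projective_image hr] at key
  rw [eulerIntegral, key, eulerIntegral, ← integral_const_mul]
  refine setIntegral_congr_fun measurableSet_Ioo fun t ht => ?_
  have hDt := hD t ht
  have ht0 : (t : ℂ) ≠ 0 := by exact_mod_cast ht.1.ne'
  have ht1' : 0 < 1 - t := sub_pos.2 ht.2
  have ht1 : (1 - t : ℂ) ≠ 0 := by exact_mod_cast ht1'.ne'
  have hr0 : (r : ℂ) ≠ 0 := by exact_mod_cast hr.ne'
  have hrw : (r : ℂ) * w ∈ Complex.slitPlane := by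
    rw [Complex.mem_slitPlane_iff] at hw ⊢
    simp only [Complex.mul_re, Complex.ofReal_re, Complex.ofReal_im, zero_mul, sub_zero,
      Complex.mul_im, add_zero]
    rcases hw with h | h
    · exact Or.inl (mul_pos hr h)
    · exact Or.inr (mul_ne_zero hr.ne' h)
  have hq := Complex.slitPlane_ne_zero (segment_mem_slitPlane hrw (Ioo_subset_Icc_self ht))
  set x : ℝ := ((1 - t) + r * t)⁻¹ with hx
  have hxpos : 0 < x := inv_pos.2 hDt
  have hDx : ((1 - t : ℂ) + r * t) * x = 1 := by
    have : ((1 - t) + r * t) * x = 1 := mul_inv_cancel₀ hDt.ne'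
    exact_mod_cast this
  have hx0 : (x : ℂ) ≠ 0 := by exact_mod_cast hxpos.ne'
  have hD0 : (1 - t : ℂ) + r * t ≠ 0 := left_ne_zero_of_mul_eq_one hDx
  have e1 : ((r * t / ((1 - t) + r * t) : ℝ) : ℂ) = r * (x * t) := by
    rw [div_eq_mul_inv]; push_cast [hx]; ring
  have e2 : 1 - ((r * t / ((1 - t) + r * t) : ℝ) : ℂ) = x * (1 - t) := by
    rw [e1]; linear_combination -hDx
  have e3 : |r / ((1 - t) + r * t) ^ 2| = r * x ^ 2 := by
    rw [abs_of_pos (by positivity), div_eq_mul_inv, hx, inv_pow]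
  have e4 : (1 - ((r * t / ((1 - t) + r * t) : ℝ) : ℂ)) +
      w * ((r * t / ((1 - t) + r * t) : ℝ) : ℂ) = x * ((1 - t) + r * w * t) := by
    rw [e2, e1]; ring
  have e5 : (1 - ((r * t / ((1 - t) + r * t) : ℝ) : ℂ)) +
      1 * ((r * t / ((1 - t) + r * t) : ℝ) : ℂ) = 1 := by ring
  have e6 : ((1 - t : ℂ) + r * t) ^ (a - c) = (x : ℂ) ^ (c - a) := by
    have h1 : ((x : ℂ) * ((1 - t : ℂ) + r * t)) ^ (a - c) = 1 := by
      rw [mul_comm, hDx, Complex.one_cpow]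
    rw [ofReal_mul_cpow hxpos hD0] at h1
    have h2 : (x : ℂ) ^ (c - a) * (x : ℂ) ^ (a - c) = 1 := by
      rw [← Complex.cpow_add _ _ hx0]; simp
    have h3 : (x : ℂ) ^ (a - c) ≠ 0 := by simp [Complex.cpow_eq_zero_iff, hx0]
    refine mul_left_cancel₀ h3 ?_
    rw [h1, ← h2]; ring
  rw [e3, e5, e4, e2, e1, e6, Complex.one_cpow, ofReal_mul_cpow hr (mul_ne_zero hx0 ht0),
    ofReal_mul_cpow hxpos ht0, ofReal_mul_cpow hxpos ht1, ofReal_mul_cpow hxpos hq,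
    Complex.real_smul]
  have f1 : (r : ℂ) ^ b = (r : ℂ) ^ (b - 1) * r := (cpow_sub_one_mul hr0 b).symm
  have f2 : (x : ℂ) ^ (c - a) = (x : ℂ) ^ (b - 1) * (x : ℂ) ^ (c - b - 1) * (x : ℂ) ^ (-a) * x ^ 2 := by
    rw [← Complex.cpow_natCast (x : ℂ) 2, ← Complex.cpow_add _ _ hx0, ← Complex.cpow_add _ _ hx0,
      ← Complex.cpow_add _ _ hx0]
    congr 1; push_cast; ring
  rw [f1, f2]
  push_cast
  ring

theorem Gamma_add_nat {d : ℂ} (hd : ∀ k : ℕ, d ≠ -k) (k : ℕ) :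
    Complex.Gamma (d + k) = poch d k * Complex.Gamma d := by
  rw [poch, ← Complex.Gamma_add_nat_div_Gamma_eq d hd, div_mul_cancel₀ _ (Complex.Gamma_ne_zero hd)]

theorem ne_neg_nat_of_re_pos {d : ℂ} (hd : 0 < d.re) (k : ℕ) : d ≠ -k := by
  rintro rfl
  have : (0 : ℝ) ≤ k := k.cast_nonneg
  simp at hd
  linarith

theorem betaIntegral_add_nat {b c : ℂ} (hb : 0 < b.re) (hcb : 0 < (c - b).re) (k : ℕ) :
    Complex.betaIntegral (b + k) (c - b) =
      poch b k / poch c k * Complex.betaIntegral b (c - b) := by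
  have hc : 0 < c.re := by
    have : c.re = b.re + (c - b).re := by simp
    linarith
  have hk : (0 : ℝ) ≤ k := k.cast_nonneg
  have h1 := Complex.Gamma_mul_Gamma_eq_betaIntegral (s := b + k) (t := c - b)
    (by simp; linarith) hcb
  have h2 := Complex.Gamma_mul_Gamma_eq_betaIntegral hb hcb
  rw [show b + k + (c - b) = c + k by ring, Gamma_add_nat (ne_neg_nat_of_re_pos hb),
    Gamma_add_nat (ne_neg_nat_of_re_pos hc)] at h1
  rw [add_sub_cancel] at h2
  have h3 := poch_ne_zero' (ne_neg_nat_of_re_pos hc) k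
  have h4 := Complex.Gamma_ne_zero_of_re_pos hc
  refine mul_left_cancel₀ (mul_ne_zero h3 h4) ?_
  rw [← h1]
  field_simp
  linear_combination poch b k * h2

/-- Binomial expansion of (1-zt)^(-a), integrated term by term; each term is a Beta integral. -/
theorem eulerIntegral_eq {a b c z : ℂ} (hb : 0 < b.re) (hcb : 0 < (c - b).re) (hz : ‖z‖ < 1) :
    eulerIntegral a b c 1 (1 - z) =
      Complex.betaIntegral b (c - b) * ordinaryHypergeometric a b c z := by
  set κ : ℝ → ℂ := fun t => (t : ℂ) ^ (b - 1) * (1 - (t : ℂ)) ^ (c - b - 1) with hκ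
  have hκi : IntegrableOn κ (Ioo 0 1) := integrableOn_beta hb hcb
  set q : ℕ → ℂ := fun k => poch a k / k.factorial * z ^ k with hq
  set F : ℕ → ℝ → ℂ := fun k t => q k * (κ t * (t : ℂ) ^ k) with hF
  have hbk : ∀ k : ℕ, 0 < (b + k).re := fun k => by
    have : (0 : ℝ) ≤ k := k.cast_nonneg
    simp; linarith
  have hFe : ∀ k : ℕ, ∀ t ∈ Ioo (0 : ℝ) 1,
      κ t * (t : ℂ) ^ k = (t : ℂ) ^ (b + k - 1) * (1 - (t : ℂ)) ^ (c - b - 1) := fun k t ht => by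
    have ht0 : (t : ℂ) ≠ 0 := by exact_mod_cast ht.1.ne'
    rw [show b + k - 1 = b - 1 + k by ring, Complex.cpow_add _ _ ht0, Complex.cpow_natCast, hκ]
    ring
  have hFi : ∀ k, Integrable (F k) (volume.restrict (Ioo 0 1)) := fun k => by
    have h1 := integrableOn_beta (hbk k) hcb
    exact (h1.congr_fun (fun t ht => (hFe k t ht).symm) measurableSet_Ioo).const_mul _
  have hsum : Summable fun k => ∫ t in Ioo (0 : ℝ) 1, ‖F k t‖ := by
    have h1 : Summable fun k => ‖q k‖ := (hasSum_binomial a hz).summable.norm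
    refine Summable.of_nonneg_of_le (fun k => integral_nonneg fun _ => norm_nonneg _)
      (fun k => ?_) (h1.mul_right (∫ t in Ioo (0 : ℝ) 1, ‖κ t‖))
    rw [← integral_const_mul]
    refine setIntegral_mono_on (hFi k).norm (hκi.norm.const_mul _) measurableSet_Ioo fun t ht => ?_
    rw [hF]
    simp only [norm_mul, norm_pow, Complex.norm_real, Real.norm_of_nonneg ht.1.le]
    refine mul_le_mul_of_nonneg_left ?_ (by positivity)
    exact mul_le_of_le_one_right (norm_nonneg _) (pow_le_one₀ ht.1.le ht.2.le)
  have key := hasSum_integral_of_summable_integral_norm hFi hsum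
  have e1 : ∫ t in Ioo (0 : ℝ) 1, ∑' k, F k t = eulerIntegral a b c 1 (1 - z) := by
    refine setIntegral_congr_fun measurableSet_Ioo fun t ht => ?_
    have hzt : ‖z * t‖ < 1 := by
      rw [norm_mul, Complex.norm_real, Real.norm_of_nonneg ht.1.le]
      have h1 : ‖z‖ * t ≤ ‖z‖ := mul_le_of_le_one_right (norm_nonneg _) ht.2.le
      linarith
    have h1 := (hasSum_binomial a hzt).mul_left (κ t)
    rw [show (1 - t : ℂ) + 1 * t = 1 by ring, show (1 - t : ℂ) + (1 - z) * t = 1 - z * t by ring,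
      Complex.one_cpow, one_mul, ← h1.tsum_eq]
    refine tsum_congr fun k => ?_
    rw [hF, hq, mul_pow]; ring
  have e2 : ∀ k, ∫ t in Ioo (0 : ℝ) 1, F k t =
      Complex.betaIntegral b (c - b) * (gaussCoeff a b c k * z ^ k) := fun k => by
    rw [hF, integral_const_mul, setIntegral_congr_fun measurableSet_Ioo (hFe k), integral_Ioo_beta,
      betaIntegral_add_nat hb hcb, hq, gaussCoeff]
    simp only [div_eq_mul_inv, mul_inv]
    ring
  rw [e1] at key
  have h2 := ((convergesOnDisc_gaussCoeff a b c).hasSum hz).mul_left (Complex.betaIntegral b (c - b))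
  rw [← ordinaryHypergeometric_eq_powerSum] at h2
  exact (key.of_terms_eq e2).unique h2

/-- Rotating the path of integration: for `w` below (`σ = 1`) or above (`σ = -1`) the real axis,
Euler's integral is a function that is holomorphic across the negative real axis. -/
theorem eulerIntegral_rotate {a b c w : ℂ} (hb : 0 < b.re) (hcb : 0 < (c - b).re) {σ : ℝ}
    (hσ : σ = 1 ∨ σ = -1) (hw : σ * w.im < 0) :
    eulerIntegral a b c 1 w =
      (σ * Complex.I) ^ b * eulerIntegral a b c (σ * Complex.I) (σ * Complex.I * w) := by
  have hσ2 : σ * σ = 1 := by rcases hσ with rfl | rfl <;> norm_num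
  -- The slope is taken larger than |Re w| / |Im w|. Then the half plane V, which contains both 1
  -- and σi, avoids every r for which r or r w lies on (-∞, 0].
  set k : ℝ := |w.re| / |w.im| + 1 with hk
  have hwim : w.im ≠ 0 := fun h => by simp [h] at hw
  have hk0 : 0 < k := by positivity
  have hkw : |w.re| < k * |w.im| := by
    rw [hk, add_mul, div_mul_cancel₀ _ (abs_pos.2 hwim).ne', one_mul]
    linarith [abs_pos.2 hwim]
  have hwabs : |w.im| = -(σ * w.im) := by
    rcases hσ with rfl | rfl
    · rw [one_mul] at hw ⊢; exact abs_of_neg hw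
    · rw [abs_of_pos (by linarith)]; ring
  set V : Set ℂ := {r : ℂ | 0 < k * σ * r.im + r.re} with hV
  have hVo : IsOpen V := isOpen_lt continuous_const (by fun_prop)
  have hVc : Convex ℝ V := by
    intro x hx y hy s t hs ht hst
    simp only [hV, mem_ofPred_eq, Complex.add_im, Complex.add_re, Complex.smul_re, Complex.smul_im,
      smul_eq_mul] at hx hy ⊢
    have h1 : 0 < s * (k * σ * x.im + x.re) + t * (k * σ * y.im + y.re) := by
      rcases hs.eq_or_lt with h0 | h0
      · have : t = 1 := by linarith
        rw [← h0, this]; linarith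
      · have h2 := mul_pos h0 hx
        have h3 := mul_nonneg ht hy.le
        linarith
    linarith
  have hV1 : ∀ r ∈ V, r ∈ Complex.slitPlane := fun r hr => by
    rw [Complex.mem_slitPlane_iff]
    by_contra! h
    simp only [hV, mem_ofPred_eq, h.2, mul_zero, zero_add] at hr
    linarith [h.1]
  have hV2 : ∀ r ∈ V, r * w ∈ Complex.slitPlane := fun r hr => by
    rw [Complex.mem_slitPlane_iff]
    by_contra! h
    obtain ⟨h1, h2⟩ := h
    rw [Complex.mul_re] at h1
    rw [Complex.mul_im] at h2
    simp only [hV, mem_ofPred_eq] at hr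
    -- multiply the inequality defining `V` by `|w|²`
    have hn : 0 < w.re ^ 2 + w.im ^ 2 := by positivity
    set T := r.re * w.re - r.im * w.im with hT
    have i1 : r.im * (w.re ^ 2 + w.im ^ 2) = -(T * w.im) := by
      rw [hT]; linear_combination w.re * h2
    have i2 : r.re * (w.re ^ 2 + w.im ^ 2) = T * w.re := by
      rw [hT]; linear_combination w.im * h2
    have i3 : 0 < (k * σ * r.im + r.re) * (w.re ^ 2 + w.im ^ 2) := mul_pos hr hn
    have i4 : (k * σ * r.im + r.re) * (w.re ^ 2 + w.im ^ 2) = T * (k * |w.im| + w.re) := by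
      rw [hwabs]; linear_combination k * σ * i1 + i2
    rw [i4] at i3
    have i5 : 0 < k * |w.im| + w.re := by linarith [neg_abs_le w.re]
    have i6 := mul_nonneg (neg_nonneg.2 h1) i5.le
    linarith
  have h1V : ((1 : ℝ) : ℂ) ∈ V := by simp [hV]
  have hIV : σ * Complex.I ∈ V := by
    simp only [hV, mem_ofPred_eq, Complex.mul_im, Complex.ofReal_re, Complex.I_im, mul_one,
      Complex.ofReal_im, Complex.I_re, mul_zero, add_zero, Complex.mul_re, sub_zero]
    rw [mul_assoc, hσ2]; simpa using hk0
  have hwslit : w ∈ Complex.slitPlane := Complex.mem_slitPlane_iff.2 (Or.inr hwim)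
  have hd1 : DifferentiableOn ℂ (fun r => r ^ b * eulerIntegral a b c r (r * w)) V := by
    refine DifferentiableOn.mul ?_ (differentiableOn_eulerIntegral hb hcb hVo differentiableOn_id
      (by fun_prop) hV1 hV2)
    exact DifferentiableOn.cpow_const differentiableOn_id hV1
  -- Both sides are holomorphic in r on V and agree for real r > 1 by the scaling law, hence also at
  -- r = σi.
  have key := eqOn_of_eventually_eq_real hVo hVc.isPreconnected
    (differentiableOn_const (eulerIntegral a b c 1 w)) hd1 h1V (by
      filter_upwards [self_mem_nhdsWithin] with x hx
      exact eulerIntegral_smul (lt_trans one_pos hx) hwslit)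
  exact key hIV

/-! ### The continuation of the Gauss series to the cut plane -/

theorem mem_cutPlane {z : ℂ} : z ∈ cutPlane ↔ 1 - z ∈ Complex.slitPlane := by
  rw [cutPlane, Complex.mem_slitPlane_iff]
  constructor
  · intro h
    by_contra! h2
    refine h ⟨z.re, ?_, ?_⟩
    · simpa using h2.1
    · refine Complex.ext rfl ?_
      have := h2.2
      simp at this
      simp [this]
  · rintro h ⟨x, hx, rfl⟩
    have : 1 ≤ x := hx
    simp at h
    linarith

theorem isOpen_cutPlane : IsOpen cutPlane := by
  have : cutPlane = (fun z => 1 - z) ⁻¹' Complex.slitPlane := ext fun z => mem_cutPlane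
  rw [this]
  exact Complex.isOpen_slitPlane.preimage (by fun_prop)

theorem isPreconnected_cutPlane : IsPreconnected cutPlane := by
  have : cutPlane = (fun z => 1 - z) '' Complex.slitPlane := by
    ext z
    rw [mem_cutPlane]
    exact ⟨fun h => ⟨_, h, sub_sub_cancel 1 z⟩, by rintro ⟨y, hy, rfl⟩; rwa [sub_sub_cancel]⟩
  rw [this]
  exact (Complex.starConvex_one_slitPlane.isPathConnected (by simp)).isConnected.isPreconnected.image _
    (by fun_prop)

theorem ball_subset_cutPlane : Metric.ball (0 : ℂ) 1 ⊆ cutPlane := fun z hz => by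
  rw [mem_cutPlane]
  have := Complex.mem_slitPlane_of_norm_lt_one (z := -z) (by simpa using hz)
  simpa [sub_eq_add_neg] using this

theorem betaIntegral_ne_zero {b c : ℂ} (hb : 0 < b.re) (hc : 0 < c.re) :
    Complex.betaIntegral b c ≠ 0 := by
  have h := Complex.Gamma_mul_Gamma_eq_betaIntegral hb hc
  intro h0
  rw [h0, mul_zero] at h
  exact mul_ne_zero (Complex.Gamma_ne_zero_of_re_pos hb) (Complex.Gamma_ne_zero_of_re_pos hc) h

theorem gaussHypergeometric_exists {a b c : ℂ} (hb : 0 < b.re) (hcb : 0 < (c - b).re) :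
    ∃ F : ℂ → ℂ, DifferentiableOn ℂ F cutPlane ∧
      Set.EqOn F (ordinaryHypergeometric a b c) (Metric.ball 0 1) := by
  refine ⟨fun z => (Complex.betaIntegral b (c - b))⁻¹ * eulerIntegral a b c 1 (1 - z), ?_, ?_⟩
  · refine DifferentiableOn.const_mul (differentiableOn_eulerIntegral hb hcb isOpen_cutPlane
      (by fun_prop) (by fun_prop) (fun _ _ => by simp) fun z hz => mem_cutPlane.1 hz) _
  · intro z hz
    simp only
    rw [eulerIntegral_eq hb hcb (by simpa using hz), ← mul_assoc,
      inv_mul_cancel₀ (betaIntegral_ne_zero hb hcb), one_mul]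

theorem gaussHypergeometric_spec {a b c : ℂ} (hb : 0 < b.re) (hcb : 0 < (c - b).re) :
    DifferentiableOn ℂ (gaussHypergeometric a b c) cutPlane ∧
      Set.EqOn (gaussHypergeometric a b c) (ordinaryHypergeometric a b c) (Metric.ball 0 1) := by
  have h := gaussHypergeometric_exists (a := a) hb hcb
  rw [gaussHypergeometric, dif_pos h]
  exact h.choose_spec

theorem eventually_nhdsGT_zero_eq {f g : ℝ → ℂ} (h : ∀ x : ℝ, 0 < x → x < 1 → f x = g x) :
    ∀ᶠ x in 𝓝[>] (0 : ℝ), f x = g x := by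
  filter_upwards [Ioo_mem_nhdsGT (show (0 : ℝ) < 1 by norm_num)] with x hx
  exact h x hx.1 hx.2

theorem gaussHypergeometric_eq_eulerIntegral {a b c z : ℂ} (hb : 0 < b.re) (hcb : 0 < (c - b).re)
    (hz : z ∈ cutPlane) :
    gaussHypergeometric a b c z = (Complex.betaIntegral b (c - b))⁻¹ * eulerIntegral a b c 1 (1 - z) := by
  obtain ⟨h1, h2⟩ := gaussHypergeometric_spec (a := a) hb hcb
  refine eqOn_of_eventually_eq_real isOpen_cutPlane isPreconnected_cutPlane h1 (g := fun z =>
    (Complex.betaIntegral b (c - b))⁻¹ * eulerIntegral a b c 1 (1 - z)) ?_ (x₀ := 0)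
    (ball_subset_cutPlane (by simp)) (eventually_nhdsGT_zero_eq fun x hx0 hx1 => ?_) hz
  · refine DifferentiableOn.const_mul (differentiableOn_eulerIntegral hb hcb isOpen_cutPlane
      (by fun_prop) (by fun_prop) (fun _ _ => by simp) fun z hz => mem_cutPlane.1 hz) _
  · have hx : ‖(x : ℂ)‖ < 1 := by rwa [Complex.norm_real, Real.norm_of_nonneg hx0.le]
    rw [h2 (by simpa using hx), eulerIntegral_eq hb hcb hx, ← mul_assoc,
      inv_mul_cancel₀ (betaIntegral_ne_zero hb hcb), one_mul]

/-- The function `gaussHypergeometric` on either side of the cut extends holomorphically across the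
cut. -/
theorem gaussHypergeometric_continuation {a b c : ℂ} (hb : 0 < b.re) (hcb : 0 < (c - b).re) {σ : ℝ}
    (hσ : σ = 1 ∨ σ = -1) :
    ∃ Ψ : ℂ → ℂ, DifferentiableOn ℂ Ψ {z | σ * Complex.I * (1 - z) ∈ Complex.slitPlane} ∧
      ∀ z : ℂ, 0 < σ * z.im → gaussHypergeometric a b c z = Ψ z := by
  refine ⟨fun z => (Complex.betaIntegral b (c - b))⁻¹ * ((σ * Complex.I) ^ b *
    eulerIntegral a b c (σ * Complex.I) (σ * Complex.I * (1 - z))), ?_, fun z hz => ?_⟩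
  · refine ((differentiableOn_eulerIntegral hb hcb
      (U := {z : ℂ | σ * Complex.I * (1 - z) ∈ Complex.slitPlane})
      (α := fun _ => σ * Complex.I) (β := fun z => σ * Complex.I * (1 - z))
      (Complex.isOpen_slitPlane.preimage (f := fun z : ℂ => σ * Complex.I * (1 - z)) (by fun_prop))
      (by fun_prop) (by fun_prop) (fun _ _ => ?_) fun z hz => hz).const_mul _).const_mul _
    rw [Complex.mem_slitPlane_iff]
    right
    rcases hσ with rfl | rfl <;> simp
  · have h1 : σ * (1 - z).im < 0 := by simp; linarith
    have h2 : z ∈ cutPlane := by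
      rw [mem_cutPlane, Complex.mem_slitPlane_iff]
      right
      intro h
      rw [h] at h1
      simp at h1
    rw [gaussHypergeometric_eq_eulerIntegral hb hcb h2, eulerIntegral_rotate hb hcb hσ h1]

/-! ### The logarithmic case of the connection formula -/

theorem norm_poch_le {d : ℂ} {R : ℝ} (hd : ‖d‖ ≤ R) (k : ℕ) : ‖poch d k‖ ≤ ‖poch (R : ℂ) k‖ := by
  have hR : 0 ≤ R := (norm_nonneg d).trans hd
  induction k with
  | zero => simp [poch_zero]
  | succ k ih =>
    rw [poch_succ, poch_succ, norm_mul, norm_mul]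
    refine mul_le_mul ih ?_ (norm_nonneg _) (norm_nonneg _)
    have h1 : ‖(R : ℂ) + k‖ = R + k := by
      rw [show (R : ℂ) + k = ((R + k : ℝ) : ℂ) by push_cast; ring, Complex.norm_real,
        Real.norm_of_nonneg (by positivity)]
    rw [h1]
    exact (norm_add_le _ _).trans (add_le_add hd (by simp))

/-- Together with `norm_poch_le` this gives majorants that do not depend on a varying parameter: a
Gauss series with numerator parameters bounded in norm and with 1/2 as denominator parameter. -/
theorem norm_poch_half_le {d : ℂ} (hd : 1 / 2 ≤ d.re) (k : ℕ) :
    ‖poch (1 / 2 : ℂ) k‖ ≤ ‖poch d k‖ := by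
  induction k with
  | zero => simp [poch_zero]
  | succ k ih =>
    rw [poch_succ, poch_succ, norm_mul, norm_mul]
    refine mul_le_mul ih ?_ (norm_nonneg _) (norm_nonneg _)
    have h1 : ‖(1 / 2 : ℂ) + k‖ = 1 / 2 + k := by
      rw [show (1 / 2 : ℂ) + k = ((1 / 2 + k : ℝ) : ℂ) by push_cast; ring, Complex.norm_real,
        Real.norm_of_nonneg (by positivity)]
    rw [h1]
    refine le_trans ?_ (Complex.re_le_norm _)
    simpa using hd

theorem poch_half_ne_zero (k : ℕ) : poch (1 / 2 : ℂ) k ≠ 0 :=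
  poch_ne_zero' (fun j => by
    have := real_ne_neg_nat (S := 1 / 2) (by norm_num) j
    push_cast at this
    exact this) k

theorem poch_reflect (x : ℂ) (k : ℕ) : poch (1 - x - k) k = (-1) ^ k * poch x k := by
  induction k with
  | zero => simp [poch_zero]
  | succ k ih =>
    rw [poch_succ_left, poch_succ, show (1 - x - ((k + 1 : ℕ) : ℂ) + 1) = 1 - x - k by push_cast; ring,
      ih]
    push_cast
    ring

/-- The functional equation of the entire function 1/Γ, so no pole has to be excluded. -/
theorem inv_Gamma_eq_poch_mul (d : ℂ) (k : ℕ) :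
    (Complex.Gamma d)⁻¹ = poch d k * (Complex.Gamma (d + k))⁻¹ := by
  induction k with
  | zero => simp [poch_zero]
  | succ k ih =>
    rw [ih, Complex.one_div_Gamma_eq_self_mul_one_div_Gamma_add_one (d + k), poch_succ]
    push_cast
    ring_nf

theorem hasDerivAt_inv_Gamma {z : ℂ} (hz : ∀ k : ℕ, z ≠ -k) :
    HasDerivAt (fun z => (Complex.Gamma z)⁻¹)
      (-(Complex.digamma z) * (Complex.Gamma z)⁻¹) z := by
  have h := (Complex.differentiableAt_Gamma z hz).hasDerivAt.inv (Complex.Gamma_ne_zero hz)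
  refine h.congr_deriv ?_
  rw [Complex.digamma_def, logDeriv_apply]
  have := Complex.Gamma_ne_zero hz
  field_simp

theorem hasDerivAt_Gamma {z : ℂ} (hz : ∀ k : ℕ, z ≠ -k) :
    HasDerivAt Complex.Gamma (Complex.digamma z * Complex.Gamma z) z := by
  refine (Complex.differentiableAt_Gamma z hz).hasDerivAt.congr_deriv ?_
  rw [Complex.digamma_def, logDeriv_apply]
  have := Complex.Gamma_ne_zero hz
  field_simp

/-- The Gauss series divided by `Γ(c)`. -/
noncomputable def regularizedGauss (a b w c : ℂ) : ℂ :=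
  ∑' k : ℕ, poch a k * poch b k / k.factorial * (Complex.Gamma (c + k))⁻¹ * w ^ k

theorem regularizedGauss_eq {a b w c : ℂ} (hc : ∀ k : ℕ, c ≠ -k) :
    regularizedGauss a b w c = (Complex.Gamma c)⁻¹ * ordinaryHypergeometric a b c w := by
  rw [ordinaryHypergeometric_eq_powerSum, powerSum, ← tsum_mul_left]
  refine tsum_congr fun k => ?_
  have := poch_ne_zero' hc k
  rw [inv_Gamma_eq_poch_mul c k, gaussCoeff]
  field_simp

theorem add_nat_ne_neg_nat {z : ℂ} (hz : 0 < z.re) (k : ℕ) : ∀ j : ℕ, z + k ≠ -j :=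
  ne_neg_nat_of_re_pos (by simp; positivity)

theorem summable_majorant (A B : ℝ) {w : ℂ} (hw : ‖w‖ < 1) :
    Summable fun k => ‖gaussCoeff A B (1 / 2) k * w ^ k‖ :=
  (convergesOnDisc_gaussCoeff A B (1 / 2)).summable_norm hw

/-- On the disc of radius 1/2 around c the real part stays at least 1/2, so one convergent Gauss
series dominates all the series there and termwise differentiation in c is allowed. Dividing by Γ(c)
makes every term entire in c. -/
theorem exists_hasDerivAt_regularizedGauss (a b : ℂ) {w : ℂ} (hw : ‖w‖ < 1) {c : ℂ} (hc : 1 ≤ c.re) :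
    ∃ D, HasDerivAt (regularizedGauss a b w) D c ∧
      HasSum (fun k : ℕ => poch a k * poch b k / k.factorial *
        (-(Complex.digamma (c + k)) * (Complex.Gamma (c + k))⁻¹) * w ^ k) D := by
  obtain ⟨M, hM⟩ := (isCompact_closedBall c (1 / 2)).exists_bound_of_continuousOn
    Complex.differentiable_one_div_Gamma.continuous.continuousOn
  have hre : ∀ x ∈ Metric.ball c (1 / 2), 1 / 2 ≤ x.re := fun x hx => by
    have h1 := (Complex.abs_re_le_norm (x - c)).trans (mem_ball_iff_norm.1 hx).le
    rw [Complex.sub_re] at h1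
    linarith [(abs_le.1 h1).1]
  have hu : Summable fun k => M * ‖gaussCoeff ‖a‖ ‖b‖ (1 / 2) k * w ^ k‖ :=
    (summable_majorant ‖a‖ ‖b‖ hw).mul_left M
  have hd : ∀ k : ℕ, DifferentiableOn ℂ (fun c => poch a k * poch b k / k.factorial *
      (Complex.Gamma (c + k))⁻¹ * w ^ k) (Metric.ball c (1 / 2)) := fun k =>
    (((Complex.differentiable_one_div_Gamma.comp (differentiable_id.add_const (k : ℂ))).const_mul
      _).mul_const _).differentiableOn
  have hb : ∀ k : ℕ, ∀ x ∈ Metric.ball c (1 / 2), ‖poch a k * poch b k / k.factorial *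
      (Complex.Gamma (x + k))⁻¹ * w ^ k‖ ≤ M * ‖gaussCoeff ‖a‖ ‖b‖ (1 / 2) k * w ^ k‖ := by
    intro k x hx
    have h1 := hM x (Metric.ball_subset_closedBall hx)
    have h2 := norm_poch_half_le (hre x hx) k
    have h3 := norm_pos_iff.2 (poch_half_ne_zero k)
    have h4 : (Complex.Gamma (x + k))⁻¹ = (Complex.Gamma x)⁻¹ * (poch x k)⁻¹ := by
      rw [inv_Gamma_eq_poch_mul x k]
      field_simp [norm_pos_iff.1 (h3.trans_le h2)]
    have hM0 : 0 ≤ M := (norm_nonneg _).trans h1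
    rw [h4]
    simp only [gaussCoeff, norm_mul, norm_div, norm_inv]
    have i1 := norm_poch_le (le_refl ‖a‖) k
    have i2 := norm_poch_le (le_refl ‖b‖) k
    have i3 : ‖poch x k‖⁻¹ ≤ ‖poch (1 / 2 : ℂ) k‖⁻¹ := inv_anti₀ h3 h2
    calc _ ≤ ‖poch (‖a‖ : ℂ) k‖ * ‖poch (‖b‖ : ℂ) k‖ / ‖(k.factorial : ℂ)‖ *
          (M * ‖poch (1 / 2 : ℂ) k‖⁻¹) * ‖w ^ k‖ := by
          rw [← norm_inv (Complex.Gamma x)]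
          gcongr
      _ = _ := by
          generalize ‖poch (1 / 2 : ℂ) k‖ = p
          ring
  have hc0 : c ∈ Metric.ball c (1 / 2) := Metric.mem_ball_self (by norm_num)
  refine ⟨_, ((Complex.differentiableOn_tsum_of_summable_norm hu hd Metric.isOpen_ball
    hb).differentiableAt (Metric.isOpen_ball.mem_nhds hc0)).hasDerivAt,
    (Complex.hasSum_deriv_of_summable_norm hu hd Metric.isOpen_ball hb hc0).of_terms_eq fun k => ?_⟩
  have h1 := ((hasDerivAt_inv_Gamma (add_nat_ne_neg_nat (by linarith : 0 < c.re) k)).comp_add_const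
    c (k : ℂ)).const_mul (poch a k * poch b k / k.factorial) |>.mul_const (w ^ k)
  exact h1.deriv

/-- The series that multiplies `w ^ δ` in the perturbed connection formula. -/
noncomputable def shiftedSeries (m : ℕ) (a b w δ : ℂ) : ℂ :=
  ∑' k : ℕ, Complex.Gamma (a + k + δ) * Complex.Gamma (b + k + δ) *
    (Complex.Gamma (1 + k + δ))⁻¹ / (m - 1 + k).factorial * w ^ k

theorem exists_hasDerivAt_shiftedSeries (m : ℕ) {a b w : ℂ} (ha : 0 < a.re) (hb : 0 < b.re)
    (hw : ‖w‖ < 1) :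
    ∃ D, HasDerivAt (shiftedSeries m a b w) D 0 ∧
      HasSum (fun k : ℕ => Complex.Gamma (a + k) * Complex.Gamma (b + k) *
        (Complex.Gamma (1 + k))⁻¹ / (m - 1 + k).factorial * w ^ k *
        (Complex.digamma (a + k) + Complex.digamma (b + k) - Complex.digamma (1 + k))) D := by
  -- Small enough that a + x and b + x keep positive real part, away from the poles of Γ, and that 1
  -- + x keeps real part at least 1/2 for the majorant.
  set r : ℝ := min (1 / 2) (min (a.re / 2) (b.re / 2)) with hr
  have hr0 : 0 < r := by positivity
  have hrh : r ≤ 1 / 2 := min_le_left _ _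
  have hre : ∀ x ∈ Metric.closedBall (0 : ℂ) r, 0 < (a + x).re ∧ 0 < (b + x).re ∧
      1 / 2 ≤ (1 + x).re := fun x hx => by
    have h1 := (Complex.abs_re_le_norm x).trans (mem_closedBall_zero_iff.1 hx)
    have h2 := (abs_le.1 h1).1
    have h3 : r ≤ a.re / 2 := (min_le_right _ _).trans (min_le_left _ _)
    have h4 : r ≤ b.re / 2 := (min_le_right _ _).trans (min_le_right _ _)
    simp only [Complex.add_re, Complex.one_re]
    exact ⟨by linarith, by linarith, by linarith⟩
  have hG : ∀ {z : ℂ}, 0 < z.re → DifferentiableAt ℂ Complex.Gamma z := fun hz =>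
    Complex.differentiableAt_Gamma _ (ne_neg_nat_of_re_pos hz)
  obtain ⟨M, hM⟩ := (isCompact_closedBall (0 : ℂ) r).exists_bound_of_continuousOn
    (f := fun x => Complex.Gamma (a + x) * Complex.Gamma (b + x) * (Complex.Gamma (1 + x))⁻¹)
    (fun x hx => by
      obtain ⟨h1, h2, h3⟩ := hre x hx
      refine ContinuousAt.continuousWithinAt (((ContinuousAt.comp (f := fun x => a + x)
        (hG h1).continuousAt (by fun_prop)).mul (ContinuousAt.comp (f := fun x => b + x)
        (hG h2).continuousAt (by fun_prop))).mul
        (Complex.differentiable_one_div_Gamma.continuous.comp (by fun_prop)).continuousAt))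
  have hu : Summable fun k => M * ‖gaussCoeff (‖a‖ + 1 : ℝ) (‖b‖ + 1 : ℝ) (1 / 2) k * w ^ k‖ :=
    (summable_majorant (‖a‖ + 1) (‖b‖ + 1) hw).mul_left M
  have hpos : ∀ {z : ℂ} (k : ℕ), 0 < z.re → 0 < (z + k).re := fun k hz => by
    simp; positivity
  have hd : ∀ k : ℕ, DifferentiableOn ℂ (fun δ => Complex.Gamma (a + k + δ) *
      Complex.Gamma (b + k + δ) * (Complex.Gamma (1 + k + δ))⁻¹ / (m - 1 + k).factorial * w ^ k)
      (Metric.ball 0 r) := fun k x hx => by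
    obtain ⟨h1, h2, h3⟩ := hre x (Metric.ball_subset_closedBall hx)
    have h1' := hpos k h1
    have h2' := hpos k h2
    rw [add_right_comm] at h1' h2'
    exact (((((DifferentiableAt.comp (f := fun x => a + k + x) x (hG h1') (by fun_prop)).mul
      (DifferentiableAt.comp (f := fun x => b + k + x) x (hG h2') (by fun_prop))).mul
      (DifferentiableAt.comp (f := fun x : ℂ => 1 + (k : ℂ) + x) x
        (Complex.differentiable_one_div_Gamma _) (by fun_prop))).div_const _).mul_const _).differentiableWithinAt
  have hbd : ∀ k : ℕ, ∀ x ∈ Metric.ball (0 : ℂ) r, ‖Complex.Gamma (a + k + x) *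
      Complex.Gamma (b + k + x) * (Complex.Gamma (1 + k + x))⁻¹ / (m - 1 + k).factorial * w ^ k‖ ≤
      M * ‖gaussCoeff (‖a‖ + 1 : ℝ) (‖b‖ + 1 : ℝ) (1 / 2) k * w ^ k‖ := by
    intro k x hx
    have hx' := Metric.ball_subset_closedBall hx
    have h0 := hM x hx'
    obtain ⟨h1, h2, h3⟩ := hre x hx'
    have hx1 : ‖x‖ ≤ 1 := (mem_closedBall_zero_iff.1 hx').trans (by linarith)
    have j1 := norm_poch_half_le h3 k
    have j0 := norm_pos_iff.2 (poch_half_ne_zero k)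
    have hM0 : 0 ≤ M := (norm_nonneg _).trans h0
    have h4 : (Complex.Gamma (1 + x + k))⁻¹ = (Complex.Gamma (1 + x))⁻¹ * (poch (1 + x) k)⁻¹ := by
      rw [inv_Gamma_eq_poch_mul (1 + x) k]
      field_simp [norm_pos_iff.1 (j0.trans_le j1)]
    rw [add_right_comm a, add_right_comm b, add_right_comm 1, h4,
      Gamma_add_nat (ne_neg_nat_of_re_pos h1), Gamma_add_nat (ne_neg_nat_of_re_pos h2)]
    have i1 : ‖poch (a + x) k‖ ≤ ‖poch ((‖a‖ + 1 : ℝ) : ℂ) k‖ :=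
      norm_poch_le ((norm_add_le _ _).trans (by linarith)) k
    have i2 : ‖poch (b + x) k‖ ≤ ‖poch ((‖b‖ + 1 : ℝ) : ℂ) k‖ :=
      norm_poch_le ((norm_add_le _ _).trans (by linarith)) k
    have i3 : ‖poch (1 + x) k‖⁻¹ ≤ ‖poch (1 / 2 : ℂ) k‖⁻¹ := inv_anti₀ j0 j1
    have i4 : ‖((m - 1 + k).factorial : ℂ)‖⁻¹ ≤ ‖(k.factorial : ℂ)‖⁻¹ := by
      rw [Complex.norm_natCast, Complex.norm_natCast]
      refine inv_anti₀ (by positivity) ?_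
      exact_mod_cast Nat.factorial_le (by omega)
    calc _ = ‖poch (a + x) k‖ * ‖poch (b + x) k‖ * ‖Complex.Gamma (a + x) * Complex.Gamma (b + x) *
          (Complex.Gamma (1 + x))⁻¹‖ * ‖poch (1 + x) k‖⁻¹ * ‖((m - 1 + k).factorial : ℂ)‖⁻¹ *
          ‖w ^ k‖ := by
          simp only [norm_mul, norm_div, norm_inv]
          ring
      _ ≤ ‖poch ((‖a‖ + 1 : ℝ) : ℂ) k‖ * ‖poch ((‖b‖ + 1 : ℝ) : ℂ) k‖ * M *
          ‖poch (1 / 2 : ℂ) k‖⁻¹ * ‖(k.factorial : ℂ)‖⁻¹ * ‖w ^ k‖ := by gcongr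
      _ = _ := by
          simp only [gaussCoeff, norm_mul, norm_div]
          generalize ‖poch (1 / 2 : ℂ) k‖ = p
          ring
  have hc0 : (0 : ℂ) ∈ Metric.ball (0 : ℂ) r := Metric.mem_ball_self hr0
  refine ⟨_, ((Complex.differentiableOn_tsum_of_summable_norm hu hd Metric.isOpen_ball
    hbd).differentiableAt (Metric.isOpen_ball.mem_nhds hc0)).hasDerivAt,
    (Complex.hasSum_deriv_of_summable_norm hu hd Metric.isOpen_ball hbd hc0).of_terms_eq
    fun k => ?_⟩
  have hz : ∀ {z : ℂ}, 0 < z.re → ∀ j : ℕ, z + k + 0 ≠ -j := fun h => by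
    rw [add_zero]; exact add_nat_ne_neg_nat h k
  have g1 := (hasDerivAt_Gamma (hz ha)).comp_const_add (a + k) 0
  have g2 := (hasDerivAt_Gamma (hz hb)).comp_const_add (b + k) 0
  have g3 := (hasDerivAt_inv_Gamma (hz (z := 1) (by simp))).comp_const_add (1 + k : ℂ) 0
  have g4 := ((((g1.mul g2).mul g3).div_const ((m - 1 + k).factorial : ℂ)).mul_const (w ^ k)).deriv
  refine g4.trans ?_
  simp only [add_zero, Pi.mul_apply]
  ring

/-- The product Γ(x) Γ(1-x) only changes sign when x moves by 1. Here this comes from Pochhammer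
symbols, without the sine. -/
theorem Gamma_mul_Gamma_shift {x : ℂ} (hx : ∀ k : ℤ, x ≠ k) (k : ℕ) :
    Complex.Gamma (x + k) * Complex.Gamma (1 - x - k) =
      (-1) ^ k * (Complex.Gamma x * Complex.Gamma (1 - x)) := by
  have h1 := Gamma_add_nat (d := x) (fun j h => hx (-j) (by simpa using h)) k
  have h2 := Gamma_add_nat (d := 1 - x - k) (fun j h => hx (1 - k + j) (by
    push_cast; linear_combination -h)) k
  rw [poch_reflect, sub_add_cancel] at h2
  have h3 : ((-1 : ℂ) ^ k) * (-1) ^ k = 1 := by rw [← mul_pow]; simp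
  rw [h1, h2]
  linear_combination (-(poch x k * Complex.Gamma x * Complex.Gamma (1 - x - k))) * h3

theorem ofReal_ne_intCast {δ : ℝ} (h0 : 0 < δ) (h1 : δ < 1) (k : ℤ) : (δ : ℂ) ≠ k := fun h => by
  have h2 : δ = k := by exact_mod_cast h
  rw [h2] at h0 h1
  have h3 : (0 : ℤ) < k := by exact_mod_cast h0
  have h4 : k < (1 : ℤ) := by exact_mod_cast h1
  omega

/-- From index m - 1 on, the Pochhammer symbol of 2 - m + δ contains the factor δ, so these
coefficients have a pole 1/δ. They are the ones that must be paired with the other solution. -/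
theorem Gamma_mul_gaussCoeff_tail {m : ℕ} (hm : 1 ≤ m) {a b : ℂ} (ha : 0 < a.re) (hb : 0 < b.re)
    (hab : a + b = 2 * m - 1) {δ : ℝ} (h0 : 0 < δ) (h1 : δ < 1) (j : ℕ) :
    Complex.Gamma (m - 1 - δ) * gaussCoeff (m + δ - a) (m + δ - b) (2 - m + δ) (j + (m - 1)) =
      -((-1) ^ (m - 1) * Complex.Gamma (1 + δ) * Complex.Gamma (1 - δ) *
        (Complex.Gamma (m + δ - a))⁻¹ * (Complex.Gamma (m + δ - b))⁻¹ * (δ : ℂ)⁻¹) *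
        (Complex.Gamma (a + j + δ) * Complex.Gamma (b + j + δ) *
          (Complex.Gamma (1 + j + δ))⁻¹ / (m - 1 + j).factorial) := by
  obtain ⟨m, rfl⟩ := Nat.exists_eq_add_of_le' hm
  simp only [Nat.add_sub_cancel] at *
  push_cast at *
  have hδ : (δ : ℂ) ≠ 0 := by exact_mod_cast h0.ne'
  have hre : ∀ {z : ℂ}, 0 < z.re → Complex.Gamma (z + j + δ) ≠ 0 := fun hz =>
    Complex.Gamma_ne_zero_of_re_pos (by simp; positivity)
  have e1 := inv_Gamma_eq_poch_mul (m + 1 + δ - a) (j + m)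
  have e2 := inv_Gamma_eq_poch_mul (m + 1 + δ - b) (j + m)
  have e3 := inv_Gamma_eq_poch_mul (2 - (m + 1) + δ) (j + m)
  push_cast at e1 e2 e3
  rw [show (m + 1 + δ - a + (j + m) : ℂ) = b + j + δ by linear_combination -hab] at e1
  rw [show (m + 1 + δ - b + (j + m) : ℂ) = a + j + δ by linear_combination -hab] at e2
  rw [show (2 - (m + 1) + δ + (j + m) : ℂ) = 1 + j + δ by ring] at e3
  have hne := ofReal_ne_intCast h0 h1
  have e4 := Gamma_mul_Gamma_shift (x := -δ) (fun k h => hne (-k) (by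
    push_cast; linear_combination -h)) m
  rw [show (1 - -(δ : ℂ) - m) = 2 - (m + 1) + δ by ring, show -(δ : ℂ) + m = m + 1 - 1 - δ by ring,
    sub_neg_eq_add] at e4
  have e5 := Complex.Gamma_add_one (-δ : ℂ) (neg_ne_zero.2 hδ)
  rw [show -(δ : ℂ) + 1 = 1 - δ by ring] at e5
  have n1 := hre ha
  have n2 := hre hb
  have n3 := hre (z := 1) (by simp)
  have n4 : Complex.Gamma (2 - (m + 1) + δ) ≠ 0 := Complex.Gamma_ne_zero fun k h =>
    hne (-k - 2 + (m + 1)) (by push_cast; linear_combination h)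
  have n5 : poch (2 - (m + 1) + δ : ℂ) (j + m) ≠ 0 := fun h => by
    rw [h, zero_mul] at e3
    exact inv_ne_zero n4 e3
  rw [gaussCoeff, e1, e2, e5, add_comm m j]
  have e6 : poch (2 - (m + 1) + δ : ℂ) (j + m) = Complex.Gamma (1 + j + δ) *
      (Complex.Gamma (2 - (m + 1) + δ))⁻¹ := by
    rw [e3]; field_simp
  rw [e6]
  generalize ((j + m).factorial : ℂ) = f
  field_simp
  linear_combination (poch (m + 1 + δ - a) (j + m) * poch (m + 1 + δ - b) (j + m) * f⁻¹) * e4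

/-- Below index m - 1 the coefficients stay finite as δ → 0; they become the finite sum of the
logarithmic formula. -/
theorem Gamma_mul_gaussCoeff_head {m k : ℕ} {a b : ℂ} {δ : ℝ} (h0 : 0 < δ)
    (h1 : δ < 1) :
    Complex.Gamma (m - 1 - δ) * gaussCoeff a b (2 - m + δ) k =
      (-1) ^ k * Complex.Gamma (m - 1 - k - δ) * poch a k * poch b k / k.factorial := by
  have hne := ofReal_ne_intCast h0 h1
  have e1 := Gamma_add_nat (d := m - 1 - k - δ) (fun j h => hne (m - 1 - k + j) (by
    push_cast; linear_combination -h)) k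
  have e2 := poch_reflect (m - 1 - k - δ) k
  rw [show (m - 1 - k - δ + k : ℂ) = m - 1 - δ by ring] at e1
  rw [show (1 - (m - 1 - k - δ) - k : ℂ) = 2 - m + δ by ring] at e2
  have n1 : poch (2 - m + δ : ℂ) k ≠ 0 := poch_ne_zero' (fun j h => hne (-2 + m - j) (by
    push_cast; linear_combination h)) k
  have h3 : ((-1 : ℂ) ^ k) * (-1) ^ k = 1 := by rw [← mul_pow]; simp
  rw [gaussCoeff, e1]
  have e3 : poch (m - 1 - k - δ : ℂ) k = (-1) ^ k * poch (2 - m + δ : ℂ) k := by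
    rw [e2, ← mul_assoc, h3, one_mul]
  rw [e3]
  field_simp

/-- The connection formula for c = m + δ, s = 1 - m + δ, rearranged. The pole 1/δ of Γ(s) and that
of the tail of the second series are collected into a single quotient by δ, and everything else is
continuous at δ = 0. -/
theorem hypergeometric_connection_perturbed {m : ℕ} (hm : 1 ≤ m) {a b : ℂ} (ha : 0 < a.re)
    (hb : 0 < b.re) (hab : a + b = 2 * m - 1) {δ : ℝ} (h0 : 0 < δ) (h1 : δ < 1) {w : ℂ}
    (hw : w ∈ lens) :
    regularizedGauss a b (1 - w) (m + δ) = (Complex.Gamma a)⁻¹ * (Complex.Gamma b)⁻¹ *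
        ∑ k ∈ Finset.range (m - 1), (-1) ^ k * Complex.Gamma (m - 1 - k - δ) *
          poch (m + δ - a) k * poch (m + δ - b) k / k.factorial * w ^ (1 - m + δ + k : ℂ) +
      (-1) ^ (m - 1) * Complex.Gamma (1 + δ) * Complex.Gamma (1 - δ) *
        (Complex.Gamma (m + δ - a))⁻¹ * (Complex.Gamma (m + δ - b))⁻¹ * ((δ : ℂ)⁻¹ *
        (regularizedGauss a b w (m - δ) - w ^ (δ : ℂ) * ((Complex.Gamma a)⁻¹ *
          (Complex.Gamma b)⁻¹ * shiftedSeries m a b w δ))) := by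
  have hm' : (1 : ℝ) ≤ m := by exact_mod_cast hm
  have hne := ofReal_ne_intCast h0 h1
  have hδ : (δ : ℂ) ≠ 0 := by exact_mod_cast h0.ne'
  have hw0 : w ≠ 0 := Complex.slitPlane_ne_zero (lens_slit hw).1
  have hw1 : ‖w‖ < 1 := (mem_lens.1 hw).1
  have hc : ∀ k : ℕ, (m + δ : ℂ) ≠ -k := fun k h => hne (-k - m) (by
    push_cast; linear_combination h)
  have hc' : ∀ k : ℕ, (m - δ : ℂ) ≠ -k := fun k h => hne (k + m) (by
    push_cast; linear_combination -h)
  have h := hypergeometric_connection (a := a) (b := b) (c := m + δ) (s := 1 - m + δ) (z := 1 - w)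
    (by push_cast; linear_combination hab) (by linarith)
    (fun k h => hne (k - 1 + m) (by
      have : ((1 - m + δ : ℝ) : ℂ) = k := by exact_mod_cast congrArg Complex.ofReal h
      push_cast at this ⊢; linear_combination this)) (one_sub_mem_lens hw)
  push_cast at h
  rw [sub_sub_cancel, show (1 - (1 - m + δ) : ℂ) = m - δ by ring,
    show (1 + (1 - m + δ) : ℂ) = 2 - m + δ by ring, show (-(1 - m + δ) : ℂ) = m - 1 - δ by ring] at h
  rw [regularizedGauss_eq hc, regularizedGauss_eq hc', h]
  have nc := Complex.Gamma_ne_zero hc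
  have nc' := Complex.Gamma_ne_zero hc'
  -- the second solution, split at the index `m - 1`
  have hG : Complex.Gamma (m - 1 - δ) * (w ^ (1 - m + δ : ℂ) *
      ordinaryHypergeometric (m + δ - a) (m + δ - b) (2 - m + δ) w) =
      ∑ k ∈ Finset.range (m - 1), (-1) ^ k * Complex.Gamma (m - 1 - k - δ) *
          poch (m + δ - a) k * poch (m + δ - b) k / k.factorial * w ^ (1 - m + δ + k : ℂ) -
      ((-1) ^ (m - 1) * Complex.Gamma (1 + δ) * Complex.Gamma (1 - δ) *
        (Complex.Gamma (m + δ - a))⁻¹ * (Complex.Gamma (m + δ - b))⁻¹ * (δ : ℂ)⁻¹) *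
        (w ^ (δ : ℂ) * shiftedSeries m a b w δ) := by
    rw [ordinaryHypergeometric_eq_powerSum, powerSum, ← Summable.sum_add_tsum_nat_add (m - 1)
      ((convergesOnDisc_gaussCoeff _ _ _).hasSum hw1).summable, mul_add, mul_add]
    refine (congrArg₂ (· + ·) ?_ ?_).trans (sub_eq_add_neg _ _).symm
    · rw [Finset.mul_sum, Finset.mul_sum]
      refine Finset.sum_congr rfl fun k hk => ?_
      rw [← Gamma_mul_gaussCoeff_head h0 h1,
        Complex.cpow_add _ (k : ℂ) hw0, Complex.cpow_natCast]
      ring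
    · rw [shiftedSeries, ← tsum_mul_left, ← tsum_mul_left, ← tsum_mul_left, ← tsum_mul_left, ← tsum_neg]
      refine tsum_congr fun j => ?_
      have e := Gamma_mul_gaussCoeff_tail hm ha hb hab h0 h1 j
      have e2 : w ^ (1 - m + δ : ℂ) * w ^ (j + (m - 1)) = w ^ (δ : ℂ) * w ^ j := by
        rw [← Complex.cpow_natCast w (j + (m - 1)), ← Complex.cpow_natCast w j,
          ← Complex.cpow_add _ _ hw0, ← Complex.cpow_add _ _ hw0]
        congr 1
        push_cast [Nat.cast_sub hm]
        ring
      linear_combination (w ^ (1 - m + δ : ℂ) * w ^ (j + (m - 1))) * e -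
        ((-1) ^ (m - 1) * Complex.Gamma (1 + δ) * Complex.Gamma (1 - δ) *
        (Complex.Gamma (m + δ - a))⁻¹ * (Complex.Gamma (m + δ - b))⁻¹ * (δ : ℂ)⁻¹) *
        (Complex.Gamma (a + j + δ) * Complex.Gamma (b + j + δ) *
          (Complex.Gamma (1 + j + δ))⁻¹ / (m - 1 + j).factorial) * e2
  have hs := Gamma_mul_Gamma_shift (x := 1 - δ) (fun k h => hne (1 - k) (by
    push_cast; linear_combination -h)) (m - 1)
  have e5 := Complex.Gamma_add_one (δ : ℂ) hδ
  rw [add_comm] at e5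
  rw [Nat.cast_sub hm, Nat.cast_one, sub_sub_cancel, show (1 - (δ : ℂ) + (m - 1)) = m - δ by ring,
    show ((δ : ℂ) - (m - 1)) = 1 - m + δ by ring] at hs
  have hs2 : Complex.Gamma (1 - m + δ) = (-1) ^ (m - 1) * Complex.Gamma (1 + δ) *
      Complex.Gamma (1 - δ) * (δ : ℂ)⁻¹ * (Complex.Gamma (m - δ))⁻¹ := by
    rw [e5]; field_simp; linear_combination hs
  rw [hs2]
  have hcc : (Complex.Gamma (m + δ))⁻¹ * Complex.Gamma (m + δ) = 1 := inv_mul_cancel₀ nc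
  simp only [div_eq_mul_inv, mul_inv] at hG ⊢
  generalize Complex.Gamma (m + δ) = Gc at *
  generalize ordinaryHypergeometric a b (m - δ : ℂ) w = f1 at *
  linear_combination ((Complex.Gamma a)⁻¹ * (Complex.Gamma b)⁻¹) * hG +
    ((-1) ^ (m - 1) * Complex.Gamma (1 + δ) *
      Complex.Gamma (1 - δ) * (δ : ℂ)⁻¹ * (Complex.Gamma (m - δ))⁻¹ * (Complex.Gamma (m + δ - a))⁻¹ * (Complex.Gamma (m + δ - b))⁻¹ * f1 + (Complex.Gamma a)⁻¹ * (Complex.Gamma b)⁻¹ * Complex.Gamma (m - 1 - δ) * (w ^ (1 - m + δ : ℂ) *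
      ordinaryHypergeometric (m + δ - a) (m + δ - b) (2 - m + δ) w)) * hcc

/-- The coefficients of the series that multiplies the logarithm. -/
noncomputable def logCoeff (m : ℕ) (a b : ℂ) (k : ℕ) : ℂ :=
  poch a k * poch b k / ((k.factorial : ℂ) * ((m - 1 + k).factorial : ℂ))

/-- The coefficients of the regular series in the logarithmic connection formula. -/
noncomputable def digammaCoeff (m : ℕ) (a b : ℂ) (k : ℕ) : ℂ :=
  logCoeff m a b k * (Complex.digamma (k + 1) + Complex.digamma (m + k) -
    Complex.digamma (a + k) - Complex.digamma (b + k))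

theorem convergesOnDisc_logCoeff {m : ℕ} (hm : 1 ≤ m) (a b : ℂ) :
    ConvergesOnDisc (logCoeff m a b) := by
  refine convergesOnDisc_of_succ (q := fun k => (a + k) / (1 + k) * ((b + k) / (m + k)))
    (by simpa using (tendsto_add_div_add a 1).mul (tendsto_add_div_add b m)) fun k => ?_
  simp only [logCoeff, poch_succ, ← add_assoc, Nat.factorial_succ]
  have h1 : ((m - 1 + k + 1 : ℕ) : ℂ) = m + k := by
    rw [show m - 1 + k + 1 = m + k by omega]; push_cast; ring
  push_cast at h1 ⊢
  rw [h1, add_comm (k : ℂ) 1]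
  simp only [div_eq_mul_inv, mul_inv]
  ring

theorem Gamma_natCast_add {m : ℕ} (hm : 1 ≤ m) (k : ℕ) :
    Complex.Gamma (m + k) = (m - 1 + k).factorial := by
  rw [← Complex.Gamma_nat_eq_factorial]
  congr 1
  push_cast [Nat.cast_sub hm]
  ring

/-! ### The limit δ → 0 of the perturbed connection formula -/

section Log

variable {m : ℕ} {a b w : ℂ}

/-- At δ = 0 both terms equal the series with coefficients `logCoeff`, so the difference vanishes.
Differentiating w^δ gives the logarithm, differentiating the Gamma factors gives the digamma values.
-/
theorem exists_hasDerivAt_difference (hm : 1 ≤ m) (ha : 0 < a.re) (hb : 0 < b.re)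
    (hw0 : w ≠ 0) (hw : ‖w‖ < 1) :
    ∃ D, HasDerivAt (fun δ => regularizedGauss a b w (m - δ) - w ^ δ * ((Complex.Gamma a)⁻¹ *
          (Complex.Gamma b)⁻¹ * shiftedSeries m a b w δ)) (D - Complex.log w *
          powerSum (logCoeff m a b) w) 0 ∧
      HasSum (fun k : ℕ => digammaCoeff m a b k * w ^ k) D ∧
      regularizedGauss a b w (m - 0) - w ^ (0 : ℂ) * ((Complex.Gamma a)⁻¹ *
          (Complex.Gamma b)⁻¹ * shiftedSeries m a b w 0) = 0 := by
  have hm' : (1 : ℝ) ≤ (m : ℂ).re := by simpa using hm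
  have na := Complex.Gamma_ne_zero_of_re_pos ha
  have nb := Complex.Gamma_ne_zero_of_re_pos hb
  have ga := fun k => Gamma_add_nat (ne_neg_nat_of_re_pos ha) k
  have gb := fun k => Gamma_add_nat (ne_neg_nat_of_re_pos hb) k
  have g1 : ∀ k : ℕ, Complex.Gamma (1 + k) = k.factorial := fun k => by
    rw [add_comm, Complex.Gamma_nat_eq_factorial]
  obtain ⟨D1, h1, s1⟩ := exists_hasDerivAt_regularizedGauss a b hw hm'
  obtain ⟨D2, h2, s2⟩ := exists_hasDerivAt_shiftedSeries m ha hb hw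
  have hS : (Complex.Gamma a)⁻¹ * (Complex.Gamma b)⁻¹ * shiftedSeries m a b w 0 =
      powerSum (logCoeff m a b) w := by
    rw [shiftedSeries, powerSum, ← tsum_mul_left]
    refine tsum_congr fun k => ?_
    rw [add_zero, add_zero, add_zero, ga, gb, g1, logCoeff]
    field_simp
  refine ⟨-D1 - (Complex.Gamma a)⁻¹ * (Complex.Gamma b)⁻¹ * D2, ?_, ?_, ?_⟩
  · have h1' : HasDerivAt (fun δ => regularizedGauss a b w (m - δ)) (-D1) 0 :=
      HasDerivAt.comp_const_sub (m : ℂ) 0 (by rwa [sub_zero])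
    have h3 : HasDerivAt (fun δ : ℂ => w ^ δ) (Complex.log w) 0 := by
      simpa using (hasDerivAt_id (0 : ℂ)).const_cpow (c := w) (Or.inl hw0)
    refine (h1'.sub (h3.mul (h2.const_mul ((Complex.Gamma a)⁻¹ * (Complex.Gamma b)⁻¹)))).congr_deriv ?_
    rw [hS, Complex.cpow_zero]
    ring
  · refine ((s1.neg).sub (s2.mul_left ((Complex.Gamma a)⁻¹ * (Complex.Gamma b)⁻¹))).of_terms_eq
      fun k => ?_
    rw [ga, gb, g1, Gamma_natCast_add hm, digammaCoeff, logCoeff, add_comm (k : ℂ) 1]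
    field_simp
    ring
  · rw [hS, sub_zero, Complex.cpow_zero, one_mul, sub_eq_zero, regularizedGauss, powerSum]
    refine tsum_congr fun k => ?_
    rw [Gamma_natCast_add hm, logCoeff]
    field_simp

/-- No growth estimate for digamma is needed: summability at w = r is part of the termwise
differentiation. -/
theorem convergesOnDisc_digammaCoeff (hm : 1 ≤ m) (ha : 0 < a.re) (hb : 0 < b.re) :
    ConvergesOnDisc (digammaCoeff m a b) := fun r h0 h1 => by
  obtain ⟨D, -, h, -⟩ := exists_hasDerivAt_difference (w := r) hm ha hb (by exact_mod_cast h0.ne')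
    (by rwa [Complex.norm_real, Real.norm_of_nonneg h0.le])
  refine h.summable.norm.congr fun k => ?_
  rw [norm_mul, norm_pow, Complex.norm_real, Real.norm_of_nonneg h0.le]

theorem hypergeometric_connection_log (hm : 1 ≤ m) (ha : 0 < a.re) (hb : 0 < b.re)
    (hab : a + b = 2 * m - 1) (hw : w ∈ lens) :
    ordinaryHypergeometric a b (m : ℂ) (1 - w) =
      Complex.Gamma m / (Complex.Gamma a * Complex.Gamma b) *
        ∑ k ∈ Finset.range (m - 1), (-1) ^ k * ((m - k - 2).factorial : ℂ) *
          poch (m - a) k * poch (m - b) k / k.factorial * w ^ ((k : ℤ) + 1 - (m : ℤ)) +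
      (-1) ^ (m - 1) * Complex.Gamma m / (Complex.Gamma (m - a) * Complex.Gamma (m - b)) *
        (powerSum (digammaCoeff m a b) w - Complex.log w * powerSum (logCoeff m a b) w) := by
  have hm' : (1 : ℝ) ≤ (m : ℂ).re := by simpa using hm
  have hw0 : w ≠ 0 := Complex.slitPlane_ne_zero (lens_slit hw).1
  obtain ⟨hw1, hw2⟩ := mem_lens.1 hw
  have hmn : ∀ k : ℕ, (m : ℂ) ≠ -k := ne_neg_nat_of_re_pos (by linarith)
  have nm := Complex.Gamma_ne_zero hmn
  have T : Tendsto (fun δ : ℝ => (δ : ℂ)) (𝓝[>] 0) (𝓝 0) :=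
    (Complex.continuous_ofReal.tendsto' 0 0 rfl).mono_left nhdsWithin_le_nhds
  -- the left-hand side
  obtain ⟨D', hD', -⟩ := exists_hasDerivAt_regularizedGauss a b hw2 hm'
  have l1 : Tendsto (fun δ : ℝ => regularizedGauss a b (1 - w) (m + δ)) (𝓝[>] 0)
      (𝓝 (regularizedGauss a b (1 - w) m)) :=
    hD'.continuousAt.tendsto.comp (by simpa using T.const_add (m : ℂ))
  -- the difference quotient
  obtain ⟨D, hd, hs, hz⟩ := exists_hasDerivAt_difference hm ha hb hw0 hw1
  have hDe : D = powerSum (digammaCoeff m a b) w :=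
    hs.unique ((convergesOnDisc_digammaCoeff hm ha hb).hasSum hw1)
  have l2 : Tendsto (fun δ : ℝ => (δ : ℂ)⁻¹ *
        (regularizedGauss a b w (m - δ) - w ^ (δ : ℂ) * ((Complex.Gamma a)⁻¹ *
          (Complex.Gamma b)⁻¹ * shiftedSeries m a b w δ))) (𝓝[>] 0)
      (𝓝 (D - Complex.log w * powerSum (logCoeff m a b) w)) := by
    have h := (hd.comp_ofReal (z := 0)).tendsto_slope_zero_right
    refine h.congr fun δ => ?_
    rw [zero_add, Complex.ofReal_zero, hz, sub_zero, Complex.real_smul, Complex.ofReal_inv]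
  have cG : ∀ z : ℂ, Continuous fun δ : ℂ => (Complex.Gamma (z + δ))⁻¹ := fun z =>
    Complex.differentiable_one_div_Gamma.continuous.comp (by fun_prop)
  have l3 : ∀ z : ℂ, Tendsto (fun δ : ℝ => (Complex.Gamma (z + δ))⁻¹) (𝓝[>] 0)
      (𝓝 ((Complex.Gamma z)⁻¹)) := fun z => by
    have := ((cG z).tendsto 0).comp T
    simpa [Function.comp_def] using this
  have l4 : ∀ z : ℂ, 0 < z.re → ∀ s : ℂ, Tendsto (fun δ : ℝ => Complex.Gamma (z + s * δ)) (𝓝[>] 0)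
      (𝓝 (Complex.Gamma z)) := fun z hz s =>
    (Complex.continuousAt_Gamma z (ne_neg_nat_of_re_pos hz)).tendsto.comp
      (by simpa using (T.const_mul s).const_add z)
  have l5 : ∀ (z : ℂ) k, Tendsto (fun δ : ℝ => poch (m + δ - z) k) (𝓝[>] 0)
      (𝓝 (poch (m - z) k)) := fun z k =>
    ((differentiable_poch k).continuous.tendsto (m - z)).comp
      (by simpa using (T.const_add (m : ℂ)).sub_const z)
  have l6 : Tendsto (fun δ : ℝ => ∑ k ∈ Finset.range (m - 1), (-1 : ℂ) ^ k *
      Complex.Gamma (m - 1 - k - δ) *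
          poch (m + δ - a) k * poch (m + δ - b) k / k.factorial * w ^ (1 - m + δ + k : ℂ)) (𝓝[>] 0)
      (𝓝 (∑ k ∈ Finset.range (m - 1), (-1) ^ k * ((m - k - 2).factorial : ℂ) *
          poch (m - a) k * poch (m - b) k / k.factorial * w ^ ((k : ℤ) + 1 - (m : ℤ)))) := by
    refine tendsto_finsetSum _ fun k hk => ?_
    have hk' : k + 2 ≤ m := by have := Finset.mem_range.1 hk; omega
    have e1 : Complex.Gamma (m - 1 - k) = ((m - k - 2).factorial : ℂ) := by
      rw [← Complex.Gamma_nat_eq_factorial, Nat.sub_sub, Nat.cast_sub hk']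
      congr 1
      push_cast
      ring
    have e2 : w ^ ((k : ℤ) + 1 - (m : ℤ)) = w ^ (1 - m + 0 + k : ℂ) := by
      rw [← Complex.cpow_intCast]
      congr 1
      push_cast
      ring
    rw [← e1, e2]
    have hre : 0 < ((m : ℂ) - 1 - k).re := by
      have : (k : ℝ) + 2 ≤ m := by exact_mod_cast hk'
      simp
      linarith
    have i1 := l4 _ hre (-1)
    simp only [neg_one_mul, ← sub_eq_add_neg] at i1
    have i2 : Tendsto (fun δ : ℝ => w ^ (1 - m + δ + k : ℂ)) (𝓝[>] 0)
        (𝓝 (w ^ (1 - m + 0 + k : ℂ))) :=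
      Tendsto.const_cpow ((T.const_add _).add_const _) (Or.inl hw0)
    exact ((((i1.const_mul _).mul (l5 a k)).mul (l5 b k)).div_const _).mul i2
  have l7 := (l6.const_mul ((Complex.Gamma a)⁻¹ * (Complex.Gamma b)⁻¹)).add
    ((((((l4 1 (by simp) 1).const_mul ((-1) ^ (m - 1))).mul (l4 1 (by simp) (-1))).mul
      (l3 (m - a))).mul (l3 (m - b))).mul l2)
  have l8 := tendsto_nhds_unique (l1.congr' ?_) l7
  · rw [regularizedGauss_eq hmn, Complex.Gamma_one, hDe] at l8
    rw [← mul_inv_cancel_left₀ nm (ordinaryHypergeometric a b (m : ℂ) (1 - w)), l8]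
    simp only [div_eq_mul_inv, mul_inv]
    ring
  · filter_upwards [Ioo_mem_nhdsGT (show (0 : ℝ) < 1 by norm_num)] with δ hδ
    rw [hypergeometric_connection_perturbed hm ha hb hab hδ.1 hδ.2 hw]
    simp only [one_mul, neg_one_mul, ← sub_eq_add_neg, add_sub_right_comm]

end Log

/-! ### Distributional boundary values -/

/-- Integration of the bound on h'. The exponent p = 1 would produce a logarithm; growth orders are
taken of the form N + 1/2 below so that it never occurs. -/
theorem norm_sub_le_of_deriv_rpow {h h' : ℝ → ℂ} {B p : ℝ} (hp : p ≠ 1)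
    (hd : ∀ y, 0 < y → HasDerivAt h (h' y) y) (hc : ∀ y, 0 < y → ContinuousAt h' y)
    (hb : ∀ y, 0 < y → y ≤ 1 → ‖h' y‖ ≤ B * y ^ (-p)) {x y : ℝ} (hx : 0 < x) (hxy : x ≤ y)
    (hy : y ≤ 1) :
    ‖h y - h x‖ ≤ B * ((y ^ (1 - p) - x ^ (1 - p)) / (1 - p)) := by
  have hpos : ∀ t ∈ uIcc x y, 0 < t := fun t ht => by
    rw [uIcc_of_le hxy] at ht; exact hx.trans_le ht.1
  have h0 : (0 : ℝ) ∉ uIcc x y := fun h => (hpos 0 h).ne' rfl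
  rw [← intervalIntegral.integral_eq_sub_of_hasDerivAt (fun t ht => hd t (hpos t ht))
    (ContinuousOn.intervalIntegrable fun t ht => (hc t (hpos t ht)).continuousWithinAt)]
  have e : ∫ t in x..y, B * t ^ (-p) = B * ((y ^ (1 - p) - x ^ (1 - p)) / (1 - p)) := by
    rw [intervalIntegral.integral_const_mul, integral_rpow (Or.inr ⟨fun h => hp (by linarith), h0⟩),
      show -p + 1 = 1 - p by ring]
  rw [← e]
  refine intervalIntegral.norm_integral_le_of_norm_le hxy ?_ ?_
  · exact ae_of_all _ fun t ht => hb t (hx.trans ht.1) (ht.2.trans hy)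
  · refine ((ContinuousOn.rpow_const continuousOn_id fun t ht => ?_).const_smul B).intervalIntegrable
    exact Or.inl (hpos t ht).ne'

/-- A sequence of functions, each the derivative of the preceding one up to a unimodular factor,
that blow up at most polynomially at `0`, has a limit there. -/
theorem exists_limit_of_polynomial_growth {κ : ℂ} (hκ : ‖κ‖ = 1) (N : ℕ) :
    ∀ {h : ℕ → ℝ → ℂ} {B : ℝ}, 0 ≤ B →
    (∀ k y, 0 < y → HasDerivAt (h k) (κ * h (k + 1) y) y) →
    (∀ k, k ≤ N + 1 → ∀ y, 0 < y → y ≤ 1 → ‖h k y‖ ≤ B * y ^ (-((N : ℝ) + 1 / 2))) →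
    ∃ l, Tendsto (h 0) (𝓝[>] 0) (𝓝 l) ∧ ‖l‖ ≤ 3 ^ (N + 1) * B := by
  induction N with
  | zero =>
    intro h B hB hd hb
    have hb' : ∀ y, 0 < y → y ≤ 1 → ‖κ * h 1 y‖ ≤ B * y ^ (-(1 / 2 : ℝ)) := fun y h0 h1 => by
      have := hb 1 le_rfl y h0 h1
      rw [norm_mul, hκ, one_mul]
      simpa using this
    have hdiff : ∀ x y, 0 < x → x ≤ y → y ≤ 1 → ‖h 0 y - h 0 x‖ ≤ 2 * B * y ^ (1 / 2 : ℝ) :=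
      fun x y hx hxy hy => by
        have h1 := norm_sub_le_of_deriv_rpow (p := 1 / 2) (by norm_num) (hd 0)
          (fun y hy => (hd 1 y hy).continuousAt.const_mul κ) hb' hx hxy hy
        refine h1.trans ?_
        have : 0 ≤ x ^ (1 - 1 / 2 : ℝ) := Real.rpow_nonneg hx.le _
        rw [show (1 - 1 / 2 : ℝ) = 1 / 2 by norm_num] at *
        nlinarith
    have hlim : Tendsto (fun y : ℝ => 2 * B * y ^ (1 / 2 : ℝ)) (𝓝[>] 0) (𝓝 0) := by
      have h1 : ContinuousAt (fun y : ℝ => 2 * B * y ^ (1 / 2 : ℝ)) 0 :=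
        (Real.continuousAt_rpow_const 0 (1 / 2) (Or.inr (by norm_num))).const_mul _
      have h2 := h1.tendsto
      rw [Real.zero_rpow (by norm_num), mul_zero] at h2
      exact h2.mono_left nhdsWithin_le_nhds
    have hcau : Cauchy (map (h 0) (𝓝[>] 0)) := by
      rw [Metric.cauchy_iff]
      refine ⟨inferInstance, fun ε hε => ?_⟩
      obtain ⟨δ, hδ, hδ0, hδ1⟩ := ((hlim.eventually_lt_const (half_pos hε)).and
        (Ioc_mem_nhdsGT (show (0 : ℝ) < 1 by norm_num))).exists
      refine ⟨h 0 '' Ioc 0 δ, image_mem_map (Ioc_mem_nhdsGT hδ0), ?_⟩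
      rintro _ ⟨x, hx, rfl⟩ _ ⟨y, hy, rfl⟩
      have i1 := hdiff x δ hx.1 hx.2 hδ1
      have i2 := hdiff y δ hy.1 hy.2 hδ1
      rw [← dist_eq_norm] at i1 i2
      calc dist (h 0 x) (h 0 y) ≤ dist (h 0 δ) (h 0 x) + dist (h 0 δ) (h 0 y) :=
            dist_triangle_left _ _ _
        _ < ε := by linarith
    obtain ⟨l, hl⟩ := cauchy_map_iff_exists_tendsto.1 hcau
    refine ⟨l, hl, ?_⟩
    refine le_of_tendsto hl.norm ?_
    filter_upwards [Ioc_mem_nhdsGT (show (0 : ℝ) < 1 by norm_num)] with y hy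
    have i1 := hdiff y 1 hy.1 hy.2 le_rfl
    have i2 := hb 0 (by omega) 1 one_pos le_rfl
    rw [Real.one_rpow] at i1 i2
    have i3 : ‖h 0 y‖ ≤ ‖h 0 1‖ + ‖h 0 1 - h 0 y‖ := by
      have := norm_sub_le (h 0 1) (h 0 1 - h 0 y)
      rwa [sub_sub_cancel] at this
    norm_num at *
    linarith
  | succ N ih =>
    intro h B hB hd hb
    -- Integrating from y = 1 downwards lowers the order of growth by one. The value at 1
    -- contributes B and the integral at most 2B, hence the factor 3.
    have step : ∀ k, k ≤ N + 1 → ∀ y, 0 < y → y ≤ 1 →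
        ‖h k y‖ ≤ (3 * B) * y ^ (-((N : ℝ) + 1 / 2)) := by
      intro k hk y hy hy1
      have hN : (0 : ℝ) ≤ N := N.cast_nonneg
      have i0 : ∀ t, 0 < t → t ≤ 1 → ‖κ * h (k + 1) t‖ ≤ B * t ^ (-((N : ℝ) + 3 / 2)) :=
        fun t ht ht1 => by
          have := hb (k + 1) (by omega) t ht ht1
          rw [norm_mul, hκ, one_mul]
          refine this.trans_eq ?_
          push_cast
          ring_nf
      have i1 := norm_sub_le_of_deriv_rpow (p := N + 3 / 2) (by intro h; linarith) (hd k)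
        (fun y hy => (hd (k + 1) y hy).continuousAt.const_mul κ) i0 hy hy1 le_rfl
      have i2 := hb k (by omega) 1 one_pos le_rfl
      rw [Real.one_rpow] at i1 i2
      rw [show (1 - ((N : ℝ) + 3 / 2)) = -(N + 1 / 2) by ring] at i1
      set Y := y ^ (-((N : ℝ) + 1 / 2)) with hY
      have hY1 : 1 ≤ Y := Real.one_le_rpow_of_pos_of_le_one_of_nonpos hy hy1 (by linarith)
      have i3 : (1 - Y) / (-((N : ℝ) + 1 / 2)) ≤ 2 * Y := by
        rw [div_le_iff_of_neg (by linarith)]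
        nlinarith
      have i4 : ‖h k y‖ ≤ ‖h k 1‖ + ‖h k 1 - h k y‖ := by
        have := norm_sub_le (h k 1) (h k 1 - h k y)
        rwa [sub_sub_cancel] at this
      have i5 := mul_le_mul_of_nonneg_left i3 hB
      nlinarith
    obtain ⟨l, hl, hl2⟩ := ih (by positivity) hd step
    exact ⟨l, hl, hl2.trans_eq (by ring)⟩

/-- The integral of `F` on a horizontal line against a function of the real part. -/
noncomputable def smear (F : ℂ → ℂ) (σ : ℝ) (φ : ℝ → ℝ) (y : ℝ) : ℂ :=
  ∫ x : ℝ, ((φ x : ℝ) : ℂ) * F ((x : ℂ) + (σ * y : ℝ) * Complex.I)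

/-- The half plane above (`σ = 1`) or below (`σ = -1`) the real axis. -/
def sideHalfPlane (σ : ℝ) : Set ℂ := {z | 0 < σ * z.im}

theorem isOpen_sideHalfPlane (σ : ℝ) : IsOpen (sideHalfPlane σ) :=
  isOpen_lt continuous_const (by fun_prop)

theorem line_mem_sideHalfPlane {σ : ℝ} (hσ : σ = 1 ∨ σ = -1) (x : ℝ) {y : ℝ} (hy : 0 < y) :
    (x : ℂ) + (σ * y : ℝ) * Complex.I ∈ sideHalfPlane σ := by
  have hσ2 : σ * σ = 1 := by rcases hσ with rfl | rfl <;> norm_num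
  have : ((x : ℂ) + (σ * y : ℝ) * Complex.I).im = σ * y := by simp
  simp only [sideHalfPlane, mem_ofPred_eq, this]
  rwa [← mul_assoc, hσ2, one_mul]

theorem continuous_line {σ : ℝ} (hσ : σ = 1 ∨ σ = -1) {G : ℂ → ℂ}
    (hG : ContinuousOn G (sideHalfPlane σ)) {y : ℝ} (hy : 0 < y) :
    Continuous fun x : ℝ => G ((x : ℂ) + (σ * y : ℝ) * Complex.I) :=
  hG.comp_continuous (by fun_prop) fun x => line_mem_sideHalfPlane hσ x hy

/-- By holomorphy, the derivative of F(x + iσy) in y is iσ times its derivative in x; integration by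
parts moves the latter onto φ. -/
theorem hasDerivAt_smear {F : ℂ → ℂ} {σ : ℝ} (hσ : σ = 1 ∨ σ = -1)
    (hF : DifferentiableOn ℂ F (sideHalfPlane σ)) {φ : ℝ → ℝ} (hφ : ContDiff ℝ 1 φ)
    (hc : HasCompactSupport φ) {y : ℝ} (hy : 0 < y) :
    HasDerivAt (smear F σ φ) (-(σ * Complex.I) * smear F σ (deriv φ) y) y := by
  have hF' : ContinuousOn (deriv F) (sideHalfPlane σ) :=
    (hF.deriv (isOpen_sideHalfPlane σ)).continuousOn
  have hFd : ∀ z ∈ sideHalfPlane σ, HasDerivAt F (deriv F z) z := fun z hz =>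
    (hF.differentiableAt ((isOpen_sideHalfPlane σ).mem_nhds hz)).hasDerivAt
  have hφc : Continuous φ := hφ.continuous
  have hcC : HasCompactSupport fun x => ((φ x : ℝ) : ℂ) := hc.comp_left Complex.ofReal_zero
  have hcC' : HasCompactSupport fun x => ((deriv φ x : ℝ) : ℂ) :=
    hc.deriv.comp_left Complex.ofReal_zero
  have hφ'c : Continuous (deriv φ) := hφ.continuous_deriv le_rfl
  -- bound for the derivative near `y`
  have hK : IsCompact (tsupport φ ×ˢ Icc (y / 2) (2 * y)) := hc.isCompact.prod isCompact_Icc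
  obtain ⟨M, hM⟩ := hK.exists_bound_of_continuousOn
    (f := fun p : ℝ × ℝ => deriv F ((p.1 : ℂ) + (σ * p.2 : ℝ) * Complex.I))
    (hF'.comp (by fun_prop) fun p hp =>
      line_mem_sideHalfPlane hσ p.1 (lt_of_lt_of_le (by positivity) hp.2.1))
  have key := hasDerivAt_integral_of_dominated_loc_of_deriv_le (𝕜 := ℝ) (μ := volume)
    (F := fun y x => ((φ x : ℝ) : ℂ) * F ((x : ℂ) + (σ * y : ℝ) * Complex.I))
    (F' := fun y x => ((φ x : ℝ) : ℂ) *
      (σ * Complex.I * deriv F ((x : ℂ) + (σ * y : ℝ) * Complex.I)))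
    (x₀ := y) (s := Ioo (y / 2) (2 * y)) (bound := fun x => ‖((φ x : ℝ) : ℂ)‖ * M)
    (Ioo_mem_nhds (by linarith) (by linarith)) ?_ ?_ ?_ ?_ ?_ ?_
  · have h2 := key.2
    refine h2.congr_deriv ?_
    have parts := integral_mul_deriv_eq_deriv_mul_of_integrable
      (u := fun x : ℝ => ((φ x : ℝ) : ℂ)) (u' := fun x : ℝ => ((deriv φ x : ℝ) : ℂ))
      (v := fun x : ℝ => F ((x : ℂ) + (σ * y : ℝ) * Complex.I))
      (v' := fun x : ℝ => deriv F ((x : ℂ) + (σ * y : ℝ) * Complex.I))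
      (fun x _ => ((hφ.differentiable one_ne_zero) x).hasDerivAt.ofReal_comp)
      (fun x _ => by
        have h1 := hFd _ (line_mem_sideHalfPlane hσ x hy)
        have h3 : HasDerivAt (fun z : ℂ => z + (σ * y : ℝ) * Complex.I) 1 (x : ℂ) :=
          (hasDerivAt_id _).add_const _
        have h4 := (h1.comp (x : ℂ) h3).comp_ofReal
        simpa [Function.comp_def] using h4)
      ((Complex.continuous_ofReal.comp hφc).mul (continuous_line hσ hF' hy) |>.integrable_of_hasCompactSupport
        hcC.mul_right)
      ((Complex.continuous_ofReal.comp hφ'c).mul (continuous_line hσ hF.continuousOn hy) |>.integrable_of_hasCompactSupport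
        hcC'.mul_right)
      ((Complex.continuous_ofReal.comp hφc).mul (continuous_line hσ hF.continuousOn hy) |>.integrable_of_hasCompactSupport
        hcC.mul_right)
    have e : ∀ x : ℝ, ((φ x : ℝ) : ℂ) * (σ * Complex.I *
        deriv F ((x : ℂ) + (σ * y : ℝ) * Complex.I)) = (σ * Complex.I) * (((φ x : ℝ) : ℂ) *
        deriv F ((x : ℂ) + (σ * y : ℝ) * Complex.I)) := fun x => by ring
    simp only [e]
    rw [integral_const_mul, parts, smear]
    ring
  · filter_upwards [Ioi_mem_nhds hy] with t ht
    exact ((Complex.continuous_ofReal.comp hφc).mul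
      (continuous_line hσ hF.continuousOn ht)).aestronglyMeasurable
  · exact ((Complex.continuous_ofReal.comp hφc).mul (continuous_line hσ hF.continuousOn hy)).integrable_of_hasCompactSupport
        hcC.mul_right
  · exact ((Complex.continuous_ofReal.comp hφc).mul
      (continuous_const.mul (continuous_line hσ hF' hy))).aestronglyMeasurable
  · refine ae_of_all _ fun x t ht => ?_
    rw [norm_mul]
    by_cases hx : x ∈ tsupport φ
    · refine mul_le_mul_of_nonneg_left ?_ (norm_nonneg _)
      have h1 := hM (x, t) ⟨hx, Ioo_subset_Icc_self ht⟩
      have h2 : ‖(σ : ℂ) * Complex.I‖ = 1 := by rcases hσ with rfl | rfl <;> simp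
      rw [norm_mul, h2, one_mul]
      exact h1
    · have : φ x = 0 := image_eq_zero_of_notMem_tsupport hx
      simp [this]
  · exact ((Complex.continuous_ofReal.comp hφc).integrable_of_hasCompactSupport hcC).norm.mul_const _
  · refine ae_of_all _ fun x t ht => ?_
    have ht0 : 0 < t := lt_trans (by positivity) ht.1
    have h1 := hFd _ (line_mem_sideHalfPlane hσ x ht0)
    have h3 : HasDerivAt (fun z : ℂ => (x : ℂ) + (σ * z) * Complex.I) (σ * 1 * Complex.I) (t : ℂ) :=
      (((hasDerivAt_id _).const_mul _).mul_const _).const_add _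
    have e : (x : ℂ) + (σ * (t : ℂ)) * Complex.I = (x : ℂ) + (σ * t : ℝ) * Complex.I := by
      push_cast; ring
    rw [← e] at h1
    have h4 := ((h1.comp (t : ℂ) h3).comp_ofReal).const_mul ((φ x : ℝ) : ℂ)
    refine (h4.congr_deriv ?_).congr_of_eventuallyEq (Eventually.of_forall fun t => ?_)
    · rw [e]; ring
    · simp

theorem norm_smear_le {F : ℂ → ℂ} {σ : ℝ} {φ : ℝ → ℝ} {M S C y : ℝ} (hM : 0 ≤ M)
    (hsupp : ∀ x, x ∉ Icc (-M) M → φ x = 0) (hS : ∀ x, ‖φ x‖ ≤ S)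
    (hC : ∀ x ∈ Icc (-M) M, ‖F ((x : ℂ) + (σ * y : ℝ) * Complex.I)‖ ≤ C) :
    ‖smear F σ φ y‖ ≤ S * C * (2 * M) := by
  have e : smear F σ φ y =
      ∫ x in Icc (-M) M, ((φ x : ℝ) : ℂ) * F ((x : ℂ) + (σ * y : ℝ) * Complex.I) := by
    rw [smear, setIntegral_eq_integral_of_forall_compl_eq_zero fun x hx => ?_]
    rw [hsupp x hx]; simp
  rw [e]
  have hv : volume.real (Icc (-M) M) = 2 * M := by
    rw [Real.volume_real_Icc_of_le (by linarith)]; ring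
  rw [← hv]
  refine norm_setIntegral_le_of_norm_le_const ?_ fun x hx => ?_
  · simp
  · rw [norm_mul, Complex.norm_real]
    exact mul_le_mul (hS x) (hC x hx) (norm_nonneg _) ((norm_nonneg _).trans (hS x))

/-- The integrals against φ, φ', φ'', ... form a sequence as in `exists_limit_of_polynomial_growth`,
with κ = -iσ. The explicit bound on the limit is used twice: for continuity in φ and for the
rescaled remainders. -/
theorem smear_tendsto {F : ℂ → ℂ} {σ : ℝ} (hσ : σ = 1 ∨ σ = -1)
    (hF : DifferentiableOn ℂ F (sideHalfPlane σ)) {φ : ℝ → ℝ} (hφ : ContDiff ℝ ∞ φ) {M S C : ℝ}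
    (hM : 0 ≤ M) (hS0 : 0 ≤ S) (hC0 : 0 ≤ C) (hsupp : tsupport φ ⊆ Icc (-M) M) {N : ℕ}
    (hS : ∀ k ≤ N + 1, ∀ x, ‖iteratedDeriv k φ x‖ ≤ S)
    (hC : ∀ x ∈ Icc (-M) M, ∀ y, 0 < y → y ≤ 1 →
      ‖F ((x : ℂ) + (σ * y : ℝ) * Complex.I)‖ ≤ C * y ^ (-((N : ℝ) + 1 / 2))) :
    ∃ l, Tendsto (smear F σ φ) (𝓝[>] 0) (𝓝 l) ∧ ‖l‖ ≤ 3 ^ (N + 1) * (S * C * (2 * M)) := by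
  have hsk : ∀ k, tsupport (iteratedDeriv k φ) ⊆ tsupport φ := fun k => by
    induction k with
    | zero => rw [iteratedDeriv_zero]
    | succ k ih => rw [iteratedDeriv_succ]; exact (tsupport_deriv_subset).trans ih
  have hcφ : HasCompactSupport φ := HasCompactSupport.of_support_subset_isCompact isCompact_Icc
    ((subset_tsupport φ).trans hsupp)
  have hck : ∀ k, HasCompactSupport (iteratedDeriv k φ) := fun k =>
    hcφ.mono' ((subset_tsupport _).trans (hsk k))
  have key := exists_limit_of_polynomial_growth (κ := -(σ * Complex.I))
    (by rcases hσ with rfl | rfl <;> simp) N (h := fun k => smear F σ (iteratedDeriv k φ))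
    (B := S * C * (2 * M)) (by positivity) (fun k y hy => by
      have h1 : ContDiff ℝ 1 (iteratedDeriv k φ) := by
        rw [iteratedDeriv_eq_iterate]
        exact ContDiff.iterate_deriv' 1 k (hφ.of_le (by exact_mod_cast le_top))
      have := hasDerivAt_smear hσ hF h1 (hck k) hy
      rwa [← iteratedDeriv_succ] at this)
    (fun k hk y hy hy1 => by
      refine (norm_smear_le hM (fun x hx => ?_) (hS k hk) fun x hx => hC x hx y hy hy1).trans_eq
        (by ring)
      exact image_eq_zero_of_notMem_tsupport fun h => hx (hsupp (hsk k h)))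
  simpa using key

theorem exists_tsupport_subset (φ : 𝓓((⊤ : Opens ℝ), ℝ)) :
    ∃ M : ℝ, 0 < M ∧ tsupport φ ⊆ Icc (-M) M := by
  obtain ⟨M, hM⟩ := φ.hasCompactSupport.isCompact.isBounded.subset_closedBall 0
  refine ⟨max M 1, by positivity, fun x hx => ?_⟩
  have h := hM hx
  rw [Metric.mem_closedBall, dist_zero_right, Real.norm_eq_abs] at h
  exact abs_le.1 (h.trans (le_max_left _ _))

/-- The order of growth of `F` at the real line is at most `N + 1 / 2`, locally uniformly. -/
def HasPolynomialGrowth (F : ℂ → ℂ) (σ : ℝ) (N : ℕ) : Prop :=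
  ∀ M : ℝ, ∃ C : ℝ, 0 ≤ C ∧ ∀ x ∈ Icc (-M) M, ∀ y, 0 < y → y ≤ 1 →
      ‖F ((x : ℂ) + (σ * y : ℝ) * Complex.I)‖ ≤ C * y ^ (-((N : ℝ) + 1 / 2))

theorem exists_iteratedDeriv_bound {φ : ℝ → ℝ} (hφ : ContDiff ℝ ∞ φ) (hc : HasCompactSupport φ)
    (N : ℕ) : ∃ S, 0 ≤ S ∧ ∀ k ≤ N, ∀ x, ‖iteratedDeriv k φ x‖ ≤ S := by
  have h1 : ∀ k : ℕ, ∃ C, ∀ x, ‖iteratedDeriv k φ x‖ ≤ C := fun k => by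
    have := Continuous.bounded_above_of_compact_support
      (hφ.continuous_iteratedFDeriv (m := k) (by exact_mod_cast le_top)) (hc.iteratedFDeriv k)
    simpa only [norm_iteratedFDeriv_eq_norm_iteratedDeriv] using this
  choose C hC using h1
  refine ⟨∑ k ∈ Finset.range (N + 1), |C k|, Finset.sum_nonneg fun _ _ => abs_nonneg _,
    fun k hk x => ?_⟩
  exact ((hC k x).trans (le_abs_self _)).trans
    (Finset.single_le_sum (f := fun k => |C k|) (fun _ _ => abs_nonneg _) (by simp; omega))

theorem smear_integrable {F : ℂ → ℂ} {σ : ℝ} (hσ : σ = 1 ∨ σ = -1)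
    (hF : ContinuousOn F (sideHalfPlane σ)) (φ : 𝓓((⊤ : Opens ℝ), ℝ)) {y : ℝ} (hy : 0 < y) :
    Integrable fun x : ℝ => ((φ x : ℝ) : ℂ) * F ((x : ℂ) + (σ * y : ℝ) * Complex.I) :=
  ((Complex.continuous_ofReal.comp φ.continuous).mul
    (continuous_line hσ hF hy)).integrable_of_hasCompactSupport
    (HasCompactSupport.mul_right (φ.hasCompactSupport.comp_left Complex.ofReal_zero))

/-- A holomorphic function of polynomial growth at the real line has a distributional boundary
value. -/
theorem exists_isBoundaryValue {F : ℂ → ℂ} {σ : ℝ} (hσ : σ = 1 ∨ σ = -1)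
    (hF : DifferentiableOn ℂ F (sideHalfPlane σ)) {N : ℕ} (hg : HasPolynomialGrowth F σ N) :
    ∃ T : 𝓓'((⊤ : Opens ℝ), ℂ), IsBoundaryValue F σ T := by
  have hex : ∀ φ : 𝓓((⊤ : Opens ℝ), ℝ), ∃ l, Tendsto (smear F σ φ) (𝓝[>] 0) (𝓝 l) := fun φ => by
    obtain ⟨M, hM, hsupp⟩ := exists_tsupport_subset φ
    obtain ⟨S, hS0, hS⟩ := exists_iteratedDeriv_bound φ.contDiff φ.hasCompactSupport (N + 1)
    obtain ⟨C, hC0, hC⟩ := hg M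
    obtain ⟨l, hl, -⟩ := smear_tendsto hσ hF φ.contDiff hM.le hS0 hC0 hsupp hS hC
    exact ⟨l, hl⟩
  choose T hT using hex
  have hadd : ∀ φ ψ, T (φ + ψ) = T φ + T ψ := fun φ ψ => by
    refine tendsto_nhds_unique (hT (φ + ψ)) (((hT φ).add (hT ψ)).congr' ?_)
    filter_upwards [self_mem_nhdsWithin] with y hy
    simp only [smear]
    rw [← integral_add (smear_integrable hσ hF.continuousOn φ hy)
      (smear_integrable hσ hF.continuousOn ψ hy)]
    refine integral_congr_ae (ae_of_all _ fun x => ?_)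
    simp [add_mul]
  have hsmul : ∀ (c : ℝ) φ, T (c • φ) = c • T φ := fun c φ => by
    refine tendsto_nhds_unique (hT (c • φ)) (((hT φ).const_smul c).congr' ?_)
    filter_upwards with y
    simp only [smear]
    rw [← integral_smul]
    refine integral_congr_ae (ae_of_all _ fun x => ?_)
    simp [mul_assoc]
  refine ⟨TestFunction.mkCLM ℝ T hadd hsmul fun K hK => ?_, hT⟩
  -- Continuity on test functions supported in K: the limit is controlled by the seminorms of order
  -- at most N + 1, with a constant that depends only on K, N and F.
  have hbound : ∃ (s : Finset ℕ) (C : ℝ), 0 ≤ C ∧ ∀ f : 𝓓^{⊤}_{K}(ℝ, ℝ),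
      ‖T (TestFunction.ofSupportedIn hK f)‖ ≤
        C * (s.sup fun i => ContDiffMapSupportedIn.seminorm ℝ ℝ ℝ ⊤ K i) f := by
    obtain ⟨M0, hM0⟩ := K.isCompact.isBounded.subset_closedBall 0
    set M := max M0 1
    have hM : 0 < M := by positivity
    obtain ⟨C, hC0, hC⟩ := hg M
    refine ⟨Finset.range (N + 2), 3 ^ (N + 1) * (C * (2 * M)), by positivity, fun f => ?_⟩
    set p := (Finset.range (N + 2)).sup fun i => ContDiffMapSupportedIn.seminorm ℝ ℝ ℝ ⊤ K i
    have hsupp : tsupport f ⊆ Icc (-M) M := fun x hx => by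
      have h := hM0 (f.tsupport_subset hx)
      rw [Metric.mem_closedBall, dist_zero_right, Real.norm_eq_abs] at h
      exact abs_le.1 (h.trans (le_max_left _ _))
    obtain ⟨l, hl, hl2⟩ := smear_tendsto hσ hF f.contDiff hM.le (apply_nonneg p f) hC0 hsupp
      (S := p f) (N := N) (fun k hk x => by
        rw [← norm_iteratedFDeriv_eq_norm_iteratedDeriv]
        refine (ContDiffMapSupportedIn.norm_iteratedFDeriv_apply_le_seminorm_top ℝ).trans ?_
        have := Finset.le_sup (f := fun i => ContDiffMapSupportedIn.seminorm ℝ ℝ ℝ ⊤ K i)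
          (show k ∈ Finset.range (N + 2) by simp; omega)
        exact this f) hC
    rw [tendsto_nhds_unique (hT (TestFunction.ofSupportedIn hK f)) hl]
    exact hl2.trans_eq (by ring)
  exact (ContDiffMapSupportedIn.mkCLMtoNormedSpace ℝ
    (fun f : 𝓓^{⊤}_{K}(ℝ, ℝ) => T (TestFunction.ofSupportedIn hK f))
    (fun f g => hadd (TestFunction.ofSupportedIn hK f) (TestFunction.ofSupportedIn hK g)) (fun c f => hsmul c (TestFunction.ofSupportedIn hK f)) hbound).continuous

/-! ### The function `₂F₁(ρ + λ, ρ - λ; n/2; ·)` near `z = 1` -/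

theorem rhoParam_re (n : ℕ) : (rhoParam n).re = ((n : ℝ) - 1) / 2 := by
  rw [rhoParam, show ((n : ℂ) - 1) / 2 = ((((n : ℝ) - 1) / 2 : ℝ) : ℂ) by push_cast; ring,
    Complex.ofReal_re]

section Parameters

variable {n : ℕ} {lam : ℂ}

theorem IsSpectralParam.re_nonneg (h : IsSpectralParam n lam) : 0 ≤ lam.re := by
  rcases h with ⟨t, -, rfl⟩ | ⟨t, ht, -, rfl⟩
  · simp
  · simpa using ht.le

theorem IsSpectralParam.re_lt (hn : 2 ≤ n) (h : IsSpectralParam n lam) :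
    lam.re < ((n : ℝ) - 1) / 2 := by
  have hn' : (2 : ℝ) ≤ n := by exact_mod_cast hn
  rcases h with ⟨t, -, rfl⟩ | ⟨t, -, ht, rfl⟩
  · simp; linarith
  · simpa using ht

theorem IsSpectralParam.add_re_pos (hn : 2 ≤ n) (h : IsSpectralParam n lam) :
    0 < (rhoParam n + lam).re := by
  rw [Complex.add_re, rhoParam_re]
  linarith [h.re_nonneg, h.re_lt hn]

theorem IsSpectralParam.sub_re_pos (hn : 2 ≤ n) (h : IsSpectralParam n lam) :
    0 < (rhoParam n - lam).re := by
  rw [Complex.sub_re, rhoParam_re]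
  linarith [h.re_lt hn]

theorem half_sub_rho_add (n : ℕ) (lam : ℂ) : (n : ℂ) / 2 - (rhoParam n + lam) = 1 / 2 - lam := by
  rw [rhoParam]; ring

theorem half_sub_rho_sub (n : ℕ) (lam : ℂ) : (n : ℂ) / 2 - (rhoParam n - lam) = 1 / 2 + lam := by
  rw [rhoParam]; ring

theorem IsSpectralParam.half_sub_re_pos (h : IsSpectralParam n lam) :
    0 < ((n : ℂ) / 2 - (rhoParam n - lam)).re := by
  rw [half_sub_rho_sub, Complex.add_re]
  have := h.re_nonneg
  norm_num
  linarith

theorem hgf_spec (hn : 2 ≤ n) (h : IsSpectralParam n lam) :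
    DifferentiableOn ℂ (hgf n lam) cutPlane ∧ Set.EqOn (hgf n lam)
      (ordinaryHypergeometric (rhoParam n + lam) (rhoParam n - lam) ((n : ℂ) / 2))
      (Metric.ball 0 1) :=
  gaussHypergeometric_spec (h.sub_re_pos hn) h.half_sub_re_pos

/-- The unit disc without the negative real axis. -/
def slitDisc : Set ℂ := Complex.slitPlane ∩ Metric.ball 0 1

theorem isOpen_slitDisc : IsOpen slitDisc := Complex.isOpen_slitPlane.inter Metric.isOpen_ball

theorem half_mem_slitDisc : ((1 / 2 : ℝ) : ℂ) ∈ slitDisc := by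
  refine ⟨Complex.ofReal_mem_slitPlane.2 (by norm_num), ?_⟩
  rw [mem_ball_zero_iff, Complex.norm_real]
  norm_num

theorem isPreconnected_slitDisc : IsPreconnected slitDisc :=
  ((Complex.starConvex_ofReal_slitPlane (x := 1 / 2) (by norm_num)).inter
    ((convex_ball (0 : ℂ) 1).starConvex half_mem_slitDisc.2)).isPathConnected
      half_mem_slitDisc |>.isConnected.isPreconnected

/-- Identity theorem. On the slit disc in w both sides are holomorphic, and it reaches the points w
just above and below (-1, 0), which correspond to z near (1, 2) and lie outside the lens. -/
theorem hgf_one_sub_eq (hn : 2 ≤ n) (h : IsSpectralParam n lam) {G : ℂ → ℂ}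
    (hG : DifferentiableOn ℂ G slitDisc)
    (he : ∀ w ∈ lens, ordinaryHypergeometric (rhoParam n + lam) (rhoParam n - lam) ((n : ℂ) / 2)
      (1 - w) = G w) {w : ℂ} (hw : w ∈ slitDisc) : hgf n lam (1 - w) = G w := by
  obtain ⟨h1, h2⟩ := hgf_spec hn h
  refine eqOn_of_eventually_eq_real isOpen_slitDisc isPreconnected_slitDisc
    (f := fun w => hgf n lam (1 - w)) (h1.comp (by fun_prop) fun w hw => ?_) hG
    half_mem_slitDisc ?_ hw
  · rw [mem_cutPlane, sub_sub_cancel]; exact hw.1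
  · filter_upwards [Ioo_mem_nhdsGT (show (1 / 2 : ℝ) < 1 by norm_num)] with x hx
    have hl : (x : ℂ) ∈ lens := ofReal_mem_lens (by linarith [hx.1]) hx.2
    rw [← he _ hl]
    exact h2 (mem_ball_zero_iff.2 (mem_lens.1 hl).2)

theorem differentiableOn_powerSum {t : ℕ → ℂ} (ht : ConvergesOnDisc t) :
    DifferentiableOn ℂ (powerSum t) slitDisc := fun _ hz =>
  (ht.differentiableAt (mem_ball_zero_iff.1 hz.2)).differentiableWithinAt

theorem hgf_one_sub_odd (hn : 2 ≤ n) (h : IsSpectralParam n lam) (ho : Odd n) {w : ℂ}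
    (hw : w ∈ slitDisc) :
    hgf n lam (1 - w) = Complex.Gamma (n / 2) * Complex.Gamma ((2 - n) / 2) /
        (Complex.Gamma (1 / 2 + lam) * Complex.Gamma (1 / 2 - lam)) *
        powerSum (gaussCoeff (rhoParam n + lam) (rhoParam n - lam) ((n : ℂ) / 2)) w +
      Complex.Gamma (n / 2) * Complex.Gamma ((n - 2) / 2) /
        (Complex.Gamma (rhoParam n + lam) * Complex.Gamma (rhoParam n - lam)) *
        (w ^ ((2 - n : ℂ) / 2) *
          powerSum (gaussCoeff (1 / 2 - lam) (1 / 2 + lam) ((4 - n : ℂ) / 2)) w) := by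
  have hn' : (2 : ℝ) ≤ n := by exact_mod_cast hn
  refine hgf_one_sub_eq hn h (G := fun w => _ * powerSum _ w + _ * (w ^ ((2 - n : ℂ) / 2) *
    powerSum _ w)) ?_ (fun w hw => ?_) hw
  · refine ((differentiableOn_powerSum (convergesOnDisc_gaussCoeff _ _ _)).const_mul _).add
      (DifferentiableOn.const_mul (DifferentiableOn.mul (fun z hz => ?_)
        (differentiableOn_powerSum (convergesOnDisc_gaussCoeff _ _ _))) _)
    exact (differentiableAt_id.cpow_const hz.1).differentiableWithinAt
  · have e := hypergeometric_connection (a := rhoParam n + lam) (b := rhoParam n - lam)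
      (c := n / 2) (s := (2 - n) / 2) (z := 1 - w) (by rw [rhoParam]; push_cast; ring) (by linarith)
      -- An odd n makes (2-n)/2 a half-integer.
      (fun k hk => by
        have h1 : (2 - n : ℝ) = 2 * k := by linarith
        have h2 : (2 - n : ℤ) = 2 * k := by exact_mod_cast h1
        obtain ⟨j, rfl⟩ := ho
        push_cast at h2
        omega) (one_sub_mem_lens hw)
    push_cast at e
    rw [half_sub_rho_add, half_sub_rho_sub, sub_sub_cancel,
      show (1 - (2 - n) / 2 : ℂ) = n / 2 by ring, show (1 + (2 - n) / 2 : ℂ) = (4 - n) / 2 by ring,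
      show (-((2 - n) / 2) : ℂ) = (n - 2) / 2 by ring] at e
    rw [e, ordinaryHypergeometric_eq_powerSum, ordinaryHypergeometric_eq_powerSum,
      mul_comm (Complex.Gamma (1 / 2 - lam))]

theorem rhoParam_two_mul (m : ℕ) (lam : ℂ) :
    rhoParam (2 * m) + lam + (rhoParam (2 * m) - lam) = 2 * m - 1 := by
  rw [rhoParam]; push_cast; ring

theorem differentiableOn_log_expansion (A B : ℂ) (d : ℕ → ℂ) (m : ℕ) {s t : ℕ → ℂ}
    (hs : ConvergesOnDisc s) (ht : ConvergesOnDisc t) :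
    DifferentiableOn ℂ (fun w => A * ∑ k ∈ Finset.range (m - 1), d k * w ^ ((k : ℤ) + 1 - (m : ℤ)) +
      B * (powerSum s w - Complex.log w * powerSum t w)) slitDisc := by
  refine DifferentiableOn.add (DifferentiableOn.const_mul (DifferentiableOn.fun_sum
    fun k _ => DifferentiableOn.const_mul (fun z hz => ?_) _) _) (DifferentiableOn.const_mul
    ((differentiableOn_powerSum hs).sub (DifferentiableOn.mul (fun z hz => ?_)
    (differentiableOn_powerSum ht))) _)
  · exact (differentiableAt_zpow.2 (Or.inl (Complex.slitPlane_ne_zero hz.1))).differentiableWithinAt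
  · exact (Complex.differentiableAt_log hz.1).differentiableWithinAt

theorem hgf_one_sub_even {m : ℕ} (hn : 2 ≤ 2 * m) (h : IsSpectralParam (2 * m) lam) {w : ℂ}
    (hw : w ∈ slitDisc) :
    hgf (2 * m) lam (1 - w) = Complex.Gamma m /
        (Complex.Gamma (rhoParam (2 * m) + lam) * Complex.Gamma (rhoParam (2 * m) - lam)) *
        ∑ k ∈ Finset.range (m - 1), (-1) ^ k * ((m - k - 2).factorial : ℂ) *
          poch (1 / 2 + lam) k * poch (1 / 2 - lam) k / k.factorial * w ^ ((k : ℤ) + 1 - (m : ℤ)) +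
      (-1) ^ (m - 1) * Complex.Gamma m /
        (Complex.Gamma (1 / 2 + lam) * Complex.Gamma (1 / 2 - lam)) *
        (powerSum (digammaCoeff m (rhoParam (2 * m) + lam) (rhoParam (2 * m) - lam)) w -
          Complex.log w *
            powerSum (logCoeff m (rhoParam (2 * m) + lam) (rhoParam (2 * m) - lam)) w) := by
  have hm : 1 ≤ m := by omega
  refine hgf_one_sub_eq hn h (differentiableOn_log_expansion _ _
    (fun k => (-1) ^ k * ((m - k - 2).factorial : ℂ) * poch (1 / 2 + lam) k *
      poch (1 / 2 - lam) k / k.factorial) m (convergesOnDisc_digammaCoeff hm (h.add_re_pos hn)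
      (h.sub_re_pos hn)) (convergesOnDisc_logCoeff hm _ _)) (fun w hw => ?_) hw
  · have e := hypergeometric_connection_log hm (h.add_re_pos hn) (h.sub_re_pos hn)
      (rhoParam_two_mul m lam) hw
    have e1 := half_sub_rho_add (2 * m) lam
    have e2 := half_sub_rho_sub (2 * m) lam
    have e3 : ((2 * m : ℕ) : ℂ) / 2 = m := by push_cast; ring
    rw [e3] at e1 e2 ⊢
    rw [e, e1, e2, mul_comm (Complex.Gamma (1 / 2 - lam))]
    refine congrArg (· + _) (congrArg (_ * ·) (Finset.sum_congr rfl fun k _ => ?_))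
    ring

end Parameters

/-! ### Estimates for the remainder after the leading term at z = 1 -/

theorem ConvergesOnDisc.exists_norm_sub_le {t : ℕ → ℂ} (ht : ConvergesOnDisc t) :
    ∃ C, 0 ≤ C ∧ ∀ w : ℂ, ‖w‖ ≤ 1 / 2 → ‖powerSum t w - t 0‖ ≤ C * ‖w‖ := by
  have hs := (summable_nat_add_iff 1).2 (ht (1 / 2) (by norm_num) (by norm_num))
  refine ⟨∑' k, ‖t (k + 1)‖ * (1 / 2) ^ (k + 1) * 2, tsum_nonneg fun _ => by positivity,
    fun w hw => ?_⟩
  have hw1 : ‖w‖ < 1 := by linarith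
  rw [powerSum, (ht.hasSum hw1).summable.tsum_eq_zero_add, pow_zero, mul_one, add_sub_cancel_left]
  rw [← tsum_mul_right]
  refine tsum_of_norm_bounded ((hs.mul_right 2).mul_right ‖w‖).hasSum fun k => ?_
  rw [norm_mul, norm_pow, pow_succ, pow_succ]
  have h1 : ‖w‖ ^ k ≤ (1 / 2) ^ k := pow_le_pow_left₀ (norm_nonneg _) hw k
  calc ‖t (k + 1)‖ * (‖w‖ ^ k * ‖w‖) ≤ ‖t (k + 1)‖ * ((1 / 2) ^ k * ‖w‖) := by gcongr
    _ = _ := by ring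

theorem ConvergesOnDisc.exists_norm_le {t : ℕ → ℂ} (ht : ConvergesOnDisc t) :
    ∃ C, 0 ≤ C ∧ ∀ w : ℂ, ‖w‖ ≤ 1 / 2 → ‖powerSum t w‖ ≤ C := by
  obtain ⟨C, hC, h⟩ := ht.exists_norm_sub_le
  refine ⟨C + ‖t 0‖, by positivity, fun w hw => ?_⟩
  have h1 := (norm_add_le (powerSum t w - t 0) (t 0)).trans (add_le_add_left (h w hw) _)
  rw [sub_add_cancel] at h1
  nlinarith [norm_nonneg w]

theorem norm_log_le_add {w : ℂ} : ‖Complex.log w‖ ≤ |Real.log ‖w‖| + Real.pi := by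
  refine (Complex.norm_le_abs_re_add_abs_im _).trans ?_
  rw [Complex.log_re, Complex.log_im]
  exact add_le_add_right (Complex.abs_arg_le_pi w) _

/-- Trades the logarithm for half a power. The constant is 2 + 4: the real part costs 2 and π is at
most 4. -/
theorem norm_log_le_rpow {w : ℂ} (hw0 : w ≠ 0) (hw : ‖w‖ ≤ 1) :
    ‖Complex.log w‖ ≤ 6 * ‖w‖ ^ (-(1 / 2 : ℝ)) := by
  have h0 : 0 < ‖w‖ := norm_pos_iff.2 hw0
  have h1 : |Real.log ‖w‖| ≤ 2 * ‖w‖ ^ (-(1 / 2 : ℝ)) := by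
    rw [abs_of_nonpos (Real.log_nonpos h0.le hw), ← Real.log_inv, Real.rpow_neg h0.le,
      ← Real.inv_rpow h0.le]
    refine (Real.log_le_rpow_div (inv_nonneg.2 h0.le) (by norm_num : (0 : ℝ) < 1 / 2)).trans_eq ?_
    ring
  have h2 : 1 ≤ ‖w‖ ^ (-(1 / 2 : ℝ)) :=
    Real.one_le_rpow_of_pos_of_le_one_of_nonpos h0 hw (by norm_num)
  have := norm_log_le_add (w := w)
  linarith [Real.pi_le_four]

section Remainder

variable {n : ℕ} {lam : ℂ}

theorem mem_slitDisc {w : ℂ} (hw : w ∈ Complex.slitPlane) (hw1 : ‖w‖ ≤ 1 / 2) : w ∈ slitDisc :=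
  ⟨hw, mem_ball_zero_iff.2 (by linarith)⟩

theorem gaussCoeff_zero (a b c : ℂ) : gaussCoeff a b c 0 = 1 := by simp [gaussCoeff, poch_zero]

theorem norm_leading_power {w : ℂ} (n : ℕ) :
    ‖w ^ ((2 - n : ℂ) / 2)‖ = ‖w‖ ^ ((2 - n : ℝ) / 2) := by
  rw [← Complex.norm_cpow_real]
  push_cast
  rfl

/-- The exponent (n-3)/2 is nonnegative and lies strictly below the leading order (n-2)/2. It also
leaves room for the regular series, and for the logarithm when n is even, so one bound serves all n
≥ 3. -/
theorem exists_hgf_sub_leading_le_odd (hn : 3 ≤ n) (h : IsSpectralParam n lam) (ho : Odd n) :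
    ∃ C, 0 ≤ C ∧ ∀ w ∈ Complex.slitPlane, ‖w‖ ≤ 1 / 2 →
      ‖hgf n lam (1 - w) - leadingGeThree n lam (1 - w)‖ ≤ C * ‖w‖ ^ (-(((n : ℝ) - 3) / 2)) := by
  have hn' : (3 : ℝ) ≤ n := by exact_mod_cast hn
  obtain ⟨C1, hC1, h1⟩ := (convergesOnDisc_gaussCoeff (rhoParam n + lam) (rhoParam n - lam)
    ((n : ℂ) / 2)).exists_norm_le
  obtain ⟨C2, hC2, h2⟩ := (convergesOnDisc_gaussCoeff (1 / 2 - lam) (1 / 2 + lam)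
    ((4 - n : ℂ) / 2)).exists_norm_sub_le
  set α := Complex.Gamma (n / 2) * Complex.Gamma ((2 - n) / 2) /
        (Complex.Gamma (1 / 2 + lam) * Complex.Gamma (1 / 2 - lam)) with hα
  set β := Complex.Gamma (n / 2) * Complex.Gamma ((n - 2) / 2) /
        (Complex.Gamma (rhoParam n + lam) * Complex.Gamma (rhoParam n - lam)) with hβ
  refine ⟨‖α‖ * C1 + ‖β‖ * C2, by positivity, fun w hw hw1 => ?_⟩
  have hr : 0 < ‖w‖ := norm_pos_iff.2 (Complex.slitPlane_ne_zero hw)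
  have e : hgf n lam (1 - w) - leadingGeThree n lam (1 - w) =
      α * powerSum (gaussCoeff (rhoParam n + lam) (rhoParam n - lam) ((n : ℂ) / 2)) w +
      β * (w ^ ((2 - n : ℂ) / 2) *
        (powerSum (gaussCoeff (1 / 2 - lam) (1 / 2 + lam) ((4 - n : ℂ) / 2)) w -
          gaussCoeff (1 / 2 - lam) (1 / 2 + lam) ((4 - n : ℂ) / 2) 0)) := by
    rw [hgf_one_sub_odd (by omega) h ho (mem_slitDisc hw hw1), leadingGeThree, sub_sub_cancel,
      gaussCoeff_zero]
    ring
  rw [e]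
  have i1 : 1 ≤ ‖w‖ ^ (-(((n : ℝ) - 3) / 2)) :=
    Real.one_le_rpow_of_pos_of_le_one_of_nonpos hr (by linarith) (by linarith)
  have i2 : ‖w‖ ^ ((2 - n : ℝ) / 2) * ‖w‖ ≤ ‖w‖ ^ (-(((n : ℝ) - 3) / 2)) := by
    rw [← Real.rpow_add_one hr.ne']
    exact Real.rpow_le_rpow_of_exponent_ge hr (by linarith) (by linarith)
  refine (norm_add_le _ _).trans ?_
  rw [norm_mul, norm_mul, norm_mul, norm_leading_power]
  have j1 := h1 w hw1
  have j2 := h2 w hw1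
  have j3 : 0 ≤ ‖w‖ ^ ((2 - n : ℝ) / 2) := Real.rpow_nonneg hr.le _
  calc _ ≤ ‖α‖ * (C1 * 1) + ‖β‖ * (‖w‖ ^ ((2 - n : ℝ) / 2) * (C2 * ‖w‖)) := by
        rw [mul_one]; gcongr
    _ = ‖α‖ * (C1 * 1) + ‖β‖ * (C2 * (‖w‖ ^ ((2 - n : ℝ) / 2) * ‖w‖)) := by ring
    _ ≤ ‖α‖ * (C1 * ‖w‖ ^ (-(((n : ℝ) - 3) / 2))) +
        ‖β‖ * (C2 * ‖w‖ ^ (-(((n : ℝ) - 3) / 2))) := by gcongr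
    _ = _ := by ring

theorem logCoeff_zero (m : ℕ) (a b : ℂ) : logCoeff m a b 0 = ((m - 1).factorial : ℂ)⁻¹ := by
  simp [logCoeff, poch_zero]

theorem exists_hgf_sub_leading_le_even {m : ℕ} (hm : 2 ≤ m) (h : IsSpectralParam (2 * m) lam) :
    ∃ C, 0 ≤ C ∧ ∀ w ∈ Complex.slitPlane, ‖w‖ ≤ 1 / 2 →
      ‖hgf (2 * m) lam (1 - w) - leadingGeThree (2 * m) lam (1 - w)‖ ≤
        C * ‖w‖ ^ (-((((2 * m : ℕ) : ℝ) - 3) / 2)) := by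
  have hn : 2 ≤ 2 * m := by omega
  have hm' : (2 : ℝ) ≤ m := by exact_mod_cast hm
  obtain ⟨C1, hC1, h1⟩ := (convergesOnDisc_digammaCoeff (m := m) (by omega) (h.add_re_pos hn)
    (h.sub_re_pos hn)).exists_norm_le
  obtain ⟨C2, hC2, h2⟩ := (convergesOnDisc_logCoeff (m := m) (by omega) (rhoParam (2 * m) + lam)
    (rhoParam (2 * m) - lam)).exists_norm_le
  set d : ℕ → ℂ := fun k => (-1) ^ k * ((m - k - 2).factorial : ℂ) *
          poch (1 / 2 + lam) k * poch (1 / 2 - lam) k / k.factorial with hd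
  set α := Complex.Gamma m /
        (Complex.Gamma (rhoParam (2 * m) + lam) * Complex.Gamma (rhoParam (2 * m) - lam)) with hα
  set β := (-1) ^ (m - 1) * Complex.Gamma m /
        (Complex.Gamma (1 / 2 + lam) * Complex.Gamma (1 / 2 - lam)) with hβ
  refine ⟨‖α‖ * ∑ k ∈ Finset.range (m - 2), ‖d (k + 1)‖ + ‖β‖ * (C1 + 6 * C2), by positivity,
    fun w hw hw1 => ?_⟩
  have hw0 := Complex.slitPlane_ne_zero hw
  have hr : 0 < ‖w‖ := norm_pos_iff.2 hw0
  -- The term k = 0 of the finite sum is the leading term; it cancels and the sum starts at k = 1.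
  have e : hgf (2 * m) lam (1 - w) - leadingGeThree (2 * m) lam (1 - w) =
      α * ∑ k ∈ Finset.range (m - 2), d (k + 1) * w ^ (((k + 1 : ℕ) : ℤ) + 1 - (m : ℤ)) +
      β * (powerSum (digammaCoeff m (rhoParam (2 * m) + lam) (rhoParam (2 * m) - lam)) w -
          Complex.log w *
            powerSum (logCoeff m (rhoParam (2 * m) + lam) (rhoParam (2 * m) - lam)) w) := by
    have e1 : m - 1 = m - 2 + 1 := by omega
    have e2 : Complex.Gamma ((((2 * m : ℕ) : ℂ) - 2) / 2) = ((m - 2).factorial : ℂ) := by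
      rw [← Complex.Gamma_nat_eq_factorial, Nat.cast_sub hm]
      congr 1
      push_cast
      ring
    have e3 : w ^ ((2 - ((2 * m : ℕ) : ℂ)) / 2) = w ^ (((0 : ℕ) : ℤ) + 1 - (m : ℤ)) := by
      rw [← Complex.cpow_intCast]
      congr 1
      push_cast
      ring
    have e4 : (((2 * m : ℕ) : ℂ)) / 2 = m := by push_cast; ring
    rw [hgf_one_sub_even hn h (mem_slitDisc hw hw1), leadingGeThree, sub_sub_cancel, e2, e3, e4,
      e1, Finset.sum_range_succ', ← e1]
    simp only [hα, hβ, hd, poch_zero, pow_zero, Nat.factorial_zero, Nat.cast_one, Nat.sub_zero]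
    ring
  rw [e]
  set Q := ‖w‖ ^ (-((((2 * m : ℕ) : ℝ) - 3) / 2)) with hQ
  have i1 : 1 ≤ Q := Real.one_le_rpow_of_pos_of_le_one_of_nonpos hr (by linarith)
    (by push_cast; linarith)
  have i2 : ‖w‖ ^ (-(1 / 2 : ℝ)) ≤ Q := Real.rpow_le_rpow_of_exponent_ge hr (by linarith)
    (by push_cast; linarith)
  have i3 : ∀ k : ℕ, ‖w ^ (((k + 1 : ℕ) : ℤ) + 1 - (m : ℤ))‖ ≤ Q := fun k => by
    rw [norm_zpow, ← Real.rpow_intCast]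
    refine Real.rpow_le_rpow_of_exponent_ge hr (by linarith) ?_
    have : (0 : ℝ) ≤ k := k.cast_nonneg
    push_cast
    linarith
  have i4 := norm_log_le_rpow hw0 (by linarith)
  have i5 : ‖∑ k ∈ Finset.range (m - 2), d (k + 1) * w ^ (((k + 1 : ℕ) : ℤ) + 1 - (m : ℤ))‖ ≤
      (∑ k ∈ Finset.range (m - 2), ‖d (k + 1)‖) * Q := by
    rw [Finset.sum_mul]
    refine norm_sum_le_of_le _ fun k _ => ?_
    rw [norm_mul]
    exact mul_le_mul_of_nonneg_left (i3 k) (norm_nonneg _)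
  refine (norm_add_le _ _).trans ?_
  rw [norm_mul, norm_mul]
  have j1 := h1 w hw1
  have j2 := h2 w hw1
  have i6 : ‖powerSum (digammaCoeff m (rhoParam (2 * m) + lam) (rhoParam (2 * m) - lam)) w -
          Complex.log w *
            powerSum (logCoeff m (rhoParam (2 * m) + lam) (rhoParam (2 * m) - lam)) w‖ ≤
      (C1 + 6 * C2) * Q := by
    refine (norm_sub_le _ _).trans ?_
    rw [norm_mul]
    calc _ ≤ C1 * 1 + 6 * ‖w‖ ^ (-(1 / 2 : ℝ)) * C2 := by rw [mul_one]; gcongr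
      _ ≤ C1 * Q + 6 * Q * C2 := by gcongr
      _ = _ := by ring
  calc _ ≤ ‖α‖ * ((∑ k ∈ Finset.range (m - 2), ‖d (k + 1)‖) * Q) + ‖β‖ * ((C1 + 6 * C2) * Q) := by
        gcongr
    _ = _ := by ring

theorem exists_hgf_sub_leading_le (hn : 3 ≤ n) (h : IsSpectralParam n lam) :
    ∃ C, 0 ≤ C ∧ ∀ w ∈ Complex.slitPlane, ‖w‖ ≤ 1 / 2 →
      ‖hgf n lam (1 - w) - leadingGeThree n lam (1 - w)‖ ≤ C * ‖w‖ ^ (-(((n : ℝ) - 3) / 2)) := by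
  rcases Nat.even_or_odd' n with ⟨m, rfl | hm⟩
  · exact exists_hgf_sub_leading_le_even (by omega) h
  · exact exists_hgf_sub_leading_le_odd hn h ⟨m, hm⟩

/-- For n = 2, ρ = 1/2, so the coefficient of the logarithmic series is that of the leading term.
After subtraction the logarithm is multiplied by O(|w|), hence bounded. -/
theorem exists_hgf_sub_leadingTwo_le (h : IsSpectralParam 2 lam) :
    ∃ C, 0 ≤ C ∧ ∀ w ∈ Complex.slitPlane, ‖w‖ ≤ 1 / 2 →
      ‖hgf 2 lam (1 - w) - leadingTwo lam (1 - w)‖ ≤ C := by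
  obtain ⟨C1, hC1, h1⟩ := (convergesOnDisc_digammaCoeff (m := 1) le_rfl (h.add_re_pos le_rfl)
    (h.sub_re_pos le_rfl)).exists_norm_le
  obtain ⟨C2, hC2, h2⟩ := (convergesOnDisc_logCoeff (m := 1) le_rfl (rhoParam 2 + lam)
    (rhoParam 2 - lam)).exists_norm_sub_le
  set β := 1 / (Complex.Gamma (rhoParam 2 + lam) * Complex.Gamma (rhoParam 2 - lam)) with hβ
  refine ⟨‖β‖ * (C1 + 6 * C2), by positivity, fun w hw hw1 => ?_⟩
  have hw0 := Complex.slitPlane_ne_zero hw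
  have hr : 0 < ‖w‖ := norm_pos_iff.2 hw0
  have e : hgf 2 lam (1 - w) - leadingTwo lam (1 - w) =
      β * (powerSum (digammaCoeff 1 (rhoParam 2 + lam) (rhoParam 2 - lam)) w -
          Complex.log w * (powerSum (logCoeff 1 (rhoParam 2 + lam) (rhoParam 2 - lam)) w -
            logCoeff 1 (rhoParam 2 + lam) (rhoParam 2 - lam) 0)) := by
    have e1 := hgf_one_sub_even (m := 1) le_rfl h (mem_slitDisc hw hw1)
    have e2 : rhoParam 2 = 1 / 2 := by rw [rhoParam]; norm_num
    simp only [mul_one, Nat.sub_self, Finset.range_zero, Finset.sum_empty, mul_zero, zero_add,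
      pow_zero, Nat.cast_one, Complex.Gamma_one] at e1
    rw [e1, leadingTwo, sub_sub_cancel, logCoeff_zero, ← hβ, hβ, e2]
    simp only [Nat.sub_self, Nat.factorial_zero, Nat.cast_one, inv_one]
    ring
  rw [e, norm_mul]
  have j1 := h1 w hw1
  have j2 := h2 w hw1
  have i4 := norm_log_le_rpow hw0 (by linarith)
  have i2 : ‖w‖ ^ (-(1 / 2 : ℝ)) * ‖w‖ ≤ 1 := by
    rw [← Real.rpow_add_one hr.ne']
    exact Real.rpow_le_one hr.le (by linarith) (by norm_num)
  refine mul_le_mul_of_nonneg_left ((norm_sub_le _ _).trans ?_) (norm_nonneg _)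
  rw [norm_mul]
  calc _ ≤ C1 + 6 * ‖w‖ ^ (-(1 / 2 : ℝ)) * (C2 * ‖w‖) := by gcongr
    _ = C1 + 6 * C2 * (‖w‖ ^ (-(1 / 2 : ℝ)) * ‖w‖) := by ring
    _ ≤ C1 + 6 * C2 * 1 := by gcongr
    _ = _ := by ring

/-! ### Behaviour at `z = 1` as functions -/

theorem tendsto_norm_one_sub_cutPlane :
    Tendsto (fun z : ℂ => ‖1 - z‖) (𝓝[cutPlane] 1) (𝓝[>] 0) := by
  refine tendsto_nhdsWithin_iff.2 ⟨?_, ?_⟩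
  · have h : Continuous fun z : ℂ => ‖1 - z‖ := by fun_prop
    exact (h.tendsto' 1 0 (by simp)).mono_left nhdsWithin_le_nhds
  · filter_upwards [self_mem_nhdsWithin] with z hz
    exact norm_pos_iff.2 (Complex.slitPlane_ne_zero (mem_cutPlane.1 hz))

theorem eventually_near_one :
    ∀ᶠ z in 𝓝[cutPlane] (1 : ℂ), 1 - z ∈ Complex.slitPlane ∧ ‖1 - z‖ ≤ 1 / 2 := by
  filter_upwards [self_mem_nhdsWithin,
    tendsto_norm_one_sub_cutPlane (Ioc_mem_nhdsGT (show (0 : ℝ) < 1 / 2 by norm_num))] with z hz h2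
  exact ⟨mem_cutPlane.1 hz, h2.2⟩

theorem isEquivalent_leadingTwo (h : IsSpectralParam 2 lam) :
    Asymptotics.IsEquivalent (𝓝[cutPlane] 1) (hgf 2 lam) (leadingTwo lam) := by
  obtain ⟨C, hC, hb⟩ := exists_hgf_sub_leadingTwo_le h
  have hβ : 1 / (Complex.Gamma (rhoParam 2 + lam) * Complex.Gamma (rhoParam 2 - lam)) ≠ 0 :=
    one_div_ne_zero (mul_ne_zero (Complex.Gamma_ne_zero_of_re_pos (h.add_re_pos le_rfl))
      (Complex.Gamma_ne_zero_of_re_pos (h.sub_re_pos le_rfl)))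
  have h1 : (hgf 2 lam - leadingTwo lam) =O[𝓝[cutPlane] 1] fun _ => (1 : ℝ) := by
    refine Asymptotics.IsBigO.of_bound C ?_
    filter_upwards [eventually_near_one] with z hz
    have := hb (1 - z) hz.1 hz.2
    rw [sub_sub_cancel] at this
    simpa using this
  refine h1.trans_isLittleO (Asymptotics.isLittleO_const_left.2 (Or.inr ?_))
  have h2 : Tendsto (fun z : ℂ => -Real.log ‖1 - z‖) (𝓝[cutPlane] 1) atTop :=
    tendsto_neg_atBot_atTop.comp (Real.tendsto_log_nhdsGT_zero.comp tendsto_norm_one_sub_cutPlane)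
  refine tendsto_atTop_mono (fun z => ?_) (h2.const_mul_atTop (norm_pos_iff.2 hβ))
  simp only [Function.comp, leadingTwo, norm_mul]
  refine mul_le_mul_of_nonneg_left ?_ (norm_nonneg _)
  rw [norm_neg, ← Complex.log_re]
  exact (neg_le_abs _).trans (Complex.abs_re_le_norm _)

theorem leading_const_ne_zero (hn : 3 ≤ n) (h : IsSpectralParam n lam) :
    Complex.Gamma (n / 2) * Complex.Gamma ((n - 2) / 2) /
      (Complex.Gamma (rhoParam n + lam) * Complex.Gamma (rhoParam n - lam)) ≠ 0 := by
  have hn' : (3 : ℝ) ≤ n := by exact_mod_cast hn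
  have h1 : ∀ x : ℝ, 0 < x → Complex.Gamma x ≠ 0 := fun x hx =>
    Complex.Gamma_ne_zero_of_re_pos (by simpa using hx)
  have h2 := h1 (n / 2) (by linarith)
  have h3 := h1 ((n - 2) / 2) (by linarith)
  push_cast at h2 h3
  exact div_ne_zero (mul_ne_zero h2 h3)
    (mul_ne_zero (Complex.Gamma_ne_zero_of_re_pos (h.add_re_pos (by omega)))
      (Complex.Gamma_ne_zero_of_re_pos (h.sub_re_pos (by omega))))

theorem rpow_isLittleO {q : ℝ} {p : ℝ} (h : p < q) :
    (fun x : ℝ => x ^ q) =o[𝓝[>] 0] fun x : ℝ => x ^ p := by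
  refine Asymptotics.isLittleO_of_tendsto' ?_ ?_
  · filter_upwards [self_mem_nhdsWithin] with x hx h0
    exact absurd h0 (Real.rpow_pos_of_pos hx _).ne'
  · have h1 : Tendsto (fun x : ℝ => x ^ (q - p)) (𝓝[>] 0) (𝓝 0) := by
      have := (Real.continuousAt_rpow_const 0 (q - p) (Or.inr (by linarith))).tendsto
      rw [Real.zero_rpow (by linarith)] at this
      exact this.mono_left nhdsWithin_le_nhds
    refine h1.congr' ?_
    filter_upwards [self_mem_nhdsWithin] with x hx
    rw [Real.rpow_sub hx]

theorem isEquivalent_leadingGeThree (hn : 3 ≤ n) (h : IsSpectralParam n lam) :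
    Asymptotics.IsEquivalent (𝓝[cutPlane] 1) (hgf n lam) (leadingGeThree n lam) := by
  obtain ⟨C, hC, hb⟩ := exists_hgf_sub_leading_le hn h
  have h1 : (hgf n lam - leadingGeThree n lam) =O[𝓝[cutPlane] 1]
      fun z => ‖1 - z‖ ^ (-(((n : ℝ) - 3) / 2)) := by
    refine Asymptotics.IsBigO.of_bound C ?_
    filter_upwards [eventually_near_one] with z hz
    have := hb (1 - z) hz.1 hz.2
    rw [sub_sub_cancel] at this
    rwa [Real.norm_of_nonneg (Real.rpow_nonneg (norm_nonneg _) _)]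
  have h2 : (fun z : ℂ => ‖1 - z‖ ^ (-(((n : ℝ) - 3) / 2))) =o[𝓝[cutPlane] 1]
      fun z => ‖1 - z‖ ^ ((2 - n : ℝ) / 2) :=
    (rpow_isLittleO (by linarith)).comp_tendsto tendsto_norm_one_sub_cutPlane
  refine (h1.trans_isLittleO h2).trans_isBigO ?_
  have h3 : (fun z : ℂ => (1 - z) ^ ((2 - n : ℂ) / 2)) =O[𝓝[cutPlane] 1] leadingGeThree n lam :=
    (Asymptotics.isBigO_refl _ _).const_mul_right (leading_const_ne_zero hn h)
  refine Asymptotics.IsBigO.trans (Asymptotics.IsBigO.of_bound 1 ?_) h3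
  filter_upwards with z
  rw [norm_leading_power, Real.norm_of_nonneg (Real.rpow_nonneg (norm_nonneg _) _), one_mul]

end Remainder

/-! ### Behaviour at `z = 1` as distributions -/

section Line

variable {σ : ℝ}

theorem sq_eq_one_of_sign (hσ : σ = 1 ∨ σ = -1) : σ * σ = 1 := by
  rcases hσ with rfl | rfl <;> norm_num

theorem le_norm_one_sub_line (hσ : σ = 1 ∨ σ = -1) (x : ℝ) {y : ℝ} (hy : 0 ≤ y) :
    y ≤ ‖1 - ((x : ℂ) + (σ * y : ℝ) * Complex.I)‖ := by
  have h := Complex.abs_im_le_norm (1 - ((x : ℂ) + (σ * y : ℝ) * Complex.I))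
  have e : (1 - ((x : ℂ) + (σ * y : ℝ) * Complex.I)).im = -(σ * y) := by simp
  have h2 : |σ| = 1 := by rcases hσ with rfl | rfl <;> simp
  rw [e, abs_neg, abs_mul, h2, one_mul, abs_of_nonneg hy] at h
  exact h

theorem sideHalfPlane_subset_cutPlane (σ : ℝ) : sideHalfPlane σ ⊆ cutPlane := fun z hz => by
  rw [mem_cutPlane, Complex.mem_slitPlane_iff]
  right
  intro h
  simp only [Complex.sub_im, Complex.one_im, zero_sub, neg_eq_zero] at h
  simp [sideHalfPlane, h] at hz

theorem line_mem_continuation (hσ : σ = 1 ∨ σ = -1) {x y : ℝ} (h : 0 < y ∨ x ≠ 1) :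
    (x : ℂ) + (σ * y : ℝ) * Complex.I ∈ {z : ℂ | σ * Complex.I * (1 - z) ∈ Complex.slitPlane} := by
  have h2 := sq_eq_one_of_sign hσ
  have hσ0 : σ ≠ 0 := by rintro rfl; simp at h2
  simp only [mem_ofPred_eq, Complex.mem_slitPlane_iff]
  have e1 : (σ * Complex.I * (1 - ((x : ℂ) + (σ * y : ℝ) * Complex.I))).re = y := by
    simp [← mul_assoc, h2]
  have e2 : (σ * Complex.I * (1 - ((x : ℂ) + (σ * y : ℝ) * Complex.I))).im = σ * (1 - x) := by
    simp
  rw [e1, e2]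
  rcases h with h | h
  · exact Or.inl h
  · exact Or.inr (mul_ne_zero hσ0 (sub_ne_zero.2 (Ne.symm h)))

theorem rpow_le_of_le_norm {p : ℝ} {N : ℕ} (hp0 : 0 ≤ p) (hp : p ≤ N + 1 / 2) {y r : ℝ} (hy : 0 < y)
    (hy1 : y ≤ 1) (hr : y ≤ r) : r ^ (-p) ≤ y ^ (-((N : ℝ) + 1 / 2)) :=
  (Real.rpow_le_rpow_of_nonpos hy hr (by linarith)).trans
    (Real.rpow_le_rpow_of_exponent_ge hy hy1 (by linarith))

theorem one_le_rpow_growth {N : ℕ} {y : ℝ} (hy : 0 < y) (hy1 : y ≤ 1) :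
    1 ≤ y ^ (-((N : ℝ) + 1 / 2)) :=
  Real.one_le_rpow_of_pos_of_le_one_of_nonpos hy hy1
    (by have : (0 : ℝ) ≤ N := N.cast_nonneg; linarith)

end Line

/-! ### Polynomial growth at the real line -/

section Growth

variable {n : ℕ} {lam : ℂ} {σ : ℝ}

theorem hasPolynomialGrowth_leadingGeThree (hn : 3 ≤ n) (lam : ℂ) (hσ : σ = 1 ∨ σ = -1) :
    HasPolynomialGrowth (leadingGeThree n lam) σ n := fun M => by
  have hn' : (3 : ℝ) ≤ n := by exact_mod_cast hn
  refine ⟨‖Complex.Gamma (n / 2) * Complex.Gamma ((n - 2) / 2) /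
      (Complex.Gamma (rhoParam n + lam) * Complex.Gamma (rhoParam n - lam))‖, norm_nonneg _,
    fun x _ y hy hy1 => ?_⟩
  rw [leadingGeThree, norm_mul, norm_leading_power]
  refine mul_le_mul_of_nonneg_left ?_ (norm_nonneg _)
  rw [show ((2 - n : ℝ) / 2) = -(((n : ℝ) - 2) / 2) by ring]
  exact rpow_le_of_le_norm (by linarith) (by linarith) hy hy1 (le_norm_one_sub_line hσ x hy.le)

theorem hasPolynomialGrowth_leadingTwo (lam : ℂ) (hσ : σ = 1 ∨ σ = -1) :
    HasPolynomialGrowth (leadingTwo lam) σ 1 := fun M => by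
  set β := 1 / (Complex.Gamma (rhoParam 2 + lam) * Complex.Gamma (rhoParam 2 - lam)) with hβ
  refine ⟨‖β‖ * (|M| + 3 + Real.pi), by have := Real.pi_pos; positivity, fun x hx y hy hy1 => ?_⟩
  set w := 1 - ((x : ℂ) + (σ * y : ℝ) * Complex.I) with hw
  have h1 := le_norm_one_sub_line hσ x hy.le
  rw [← hw] at h1
  have hr : 0 < ‖w‖ := hy.trans_le h1
  have h2 : ‖w‖ ≤ |M| + 2 := by
    have e : ‖((σ * y : ℝ) : ℂ) * Complex.I‖ = y := by
      have h2 : |σ| = 1 := by rcases hσ with rfl | rfl <;> simp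
      rw [norm_mul, Complex.norm_I, mul_one, Complex.norm_real, Real.norm_eq_abs, abs_mul, h2,
        one_mul, abs_of_pos hy]
    have hx2 : ‖(x : ℂ)‖ ≤ |M| := by
      rw [Complex.norm_real, Real.norm_eq_abs]
      exact (abs_le.2 hx).trans (le_abs_self M)
    calc ‖w‖ ≤ ‖(1 : ℂ)‖ + (‖(x : ℂ)‖ + ‖((σ * y : ℝ) : ℂ) * Complex.I‖) :=
          (norm_sub_le _ _).trans (add_le_add_right (norm_add_le _ _) _)
      _ ≤ |M| + 2 := by rw [e, norm_one]; linarith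
  have h3 : |Real.log ‖w‖| ≤ ‖w‖ + ‖w‖⁻¹ := by
    have i1 := Real.log_le_self hr.le
    have i2 := Real.neg_inv_le_log hr.le
    have i3 := inv_pos.2 hr
    exact abs_le.2 ⟨by linarith, by linarith⟩
  have h4 : ‖w‖⁻¹ ≤ y ^ (-(((1 : ℕ) : ℝ) + 1 / 2)) := by
    rw [← Real.rpow_neg_one]
    exact rpow_le_of_le_norm (by norm_num) (by norm_num) hy hy1 h1
  have h5 := one_le_rpow_growth (N := 1) hy hy1
  rw [leadingTwo, norm_mul, norm_neg, mul_assoc]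
  refine mul_le_mul_of_nonneg_left ?_ (norm_nonneg _)
  refine norm_log_le_add.trans ?_
  have h6 : (|M| + 2 + Real.pi) * 1 ≤ (|M| + 2 + Real.pi) * y ^ (-(((1 : ℕ) : ℝ) + 1 / 2)) :=
    mul_le_mul_of_nonneg_left h5 (by have := Real.pi_pos; positivity)
  linarith

theorem exists_norm_hgf_le (hn : 2 ≤ n) (h : IsSpectralParam n lam) :
    ∃ C, 0 ≤ C ∧ ∀ w ∈ Complex.slitPlane, ‖w‖ ≤ 1 / 2 →
      ‖hgf n lam (1 - w)‖ ≤ C * ‖w‖ ^ (-(n : ℝ)) := by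
  have hmono : ∀ {w : ℂ} {p : ℝ}, w ∈ Complex.slitPlane → ‖w‖ ≤ 1 / 2 → -(n : ℝ) ≤ p →
      ‖w‖ ^ p ≤ ‖w‖ ^ (-(n : ℝ)) := fun hw hw1 hp =>
    Real.rpow_le_rpow_of_exponent_ge (norm_pos_iff.2 (Complex.slitPlane_ne_zero hw))
      (by linarith) hp
  rcases hn.eq_or_lt with rfl | hn
  · obtain ⟨C, hC, hb⟩ := exists_hgf_sub_leadingTwo_le h
    set β := 1 / (Complex.Gamma (rhoParam 2 + lam) * Complex.Gamma (rhoParam 2 - lam)) with hβ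
    refine ⟨C + ‖β‖ * 6, by positivity, fun w hw hw1 => ?_⟩
    have h1 := norm_add_le (hgf 2 lam (1 - w) - leadingTwo lam (1 - w)) (leadingTwo lam (1 - w))
    rw [sub_add_cancel] at h1
    have h2 : ‖leadingTwo lam (1 - w)‖ ≤ ‖β‖ * (6 * ‖w‖ ^ (-((2 : ℕ) : ℝ))) := by
      rw [leadingTwo, sub_sub_cancel, norm_mul, norm_neg]
      refine mul_le_mul_of_nonneg_left ?_ (norm_nonneg _)
      refine (norm_log_le_rpow (Complex.slitPlane_ne_zero hw) (by linarith)).trans ?_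
      exact mul_le_mul_of_nonneg_left (hmono hw hw1 (by norm_num)) (by norm_num)
    have h3 := hmono hw hw1 (p := 0) (by norm_num)
    rw [Real.rpow_zero] at h3
    have h4 := mul_le_mul_of_nonneg_left h3 hC
    linarith [hb w hw hw1]
  · have hn' : (3 : ℝ) ≤ n := by exact_mod_cast hn
    obtain ⟨C, hC, hb⟩ := exists_hgf_sub_leading_le hn h
    set β := Complex.Gamma (n / 2) * Complex.Gamma ((n - 2) / 2) /
      (Complex.Gamma (rhoParam n + lam) * Complex.Gamma (rhoParam n - lam)) with hβ
    refine ⟨C + ‖β‖, by positivity, fun w hw hw1 => ?_⟩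
    have h1 := norm_add_le (hgf n lam (1 - w) - leadingGeThree n lam (1 - w))
      (leadingGeThree n lam (1 - w))
    rw [sub_add_cancel] at h1
    have h2 : ‖leadingGeThree n lam (1 - w)‖ ≤ ‖β‖ * ‖w‖ ^ (-(n : ℝ)) := by
      rw [leadingGeThree, sub_sub_cancel, norm_mul, norm_leading_power]
      exact mul_le_mul_of_nonneg_left (hmono hw hw1 (by linarith)) (norm_nonneg _)
    have h4 := mul_le_mul_of_nonneg_left (hmono hw hw1 (p := -(((n : ℝ) - 3) / 2)) (by linarith)) hC
    linarith [hb w hw hw1]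

theorem hgf_continuation (hn : 2 ≤ n) (h : IsSpectralParam n lam) (hσ : σ = 1 ∨ σ = -1) :
    ∃ Ψ : ℂ → ℂ, DifferentiableOn ℂ Ψ {z | σ * Complex.I * (1 - z) ∈ Complex.slitPlane} ∧
      ∀ z : ℂ, 0 < σ * z.im → hgf n lam z = Ψ z :=
  gaussHypergeometric_continuation (h.sub_re_pos hn) h.half_sub_re_pos hσ

/-- Within distance 1/2 of z = 1 the local expansion gives |1-z|^(-n), and |1-z| ≥ y. On the rest of
the strip the continuation across the cut is continuous on a compact set that includes y = 0, hence
bounded. -/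
theorem hasPolynomialGrowth_hgf (hn : 2 ≤ n) (h : IsSpectralParam n lam) (hσ : σ = 1 ∨ σ = -1) :
    HasPolynomialGrowth (hgf n lam) σ n := fun M => by
  obtain ⟨Ψ, hΨ, hΨe⟩ := hgf_continuation hn h hσ
  obtain ⟨C1, hC1, h1⟩ := exists_norm_hgf_le hn h
  set K : Set (ℝ × ℝ) := (Icc (-M) M ×ˢ Icc 0 1) ∩
    {p | 1 / 2 ≤ ‖1 - ((p.1 : ℂ) + (σ * p.2 : ℝ) * Complex.I)‖} with hK
  have hKc : IsCompact K := (isCompact_Icc.prod isCompact_Icc).inter_right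
    (isClosed_le continuous_const (by fun_prop))
  obtain ⟨C2, hC2⟩ := hKc.exists_bound_of_continuousOn
    (f := fun p : ℝ × ℝ => Ψ ((p.1 : ℂ) + (σ * p.2 : ℝ) * Complex.I))
    (hΨ.continuousOn.comp (by fun_prop) fun p hp => by
      refine line_mem_continuation hσ ?_
      by_contra! hc
      have h3 : p.2 = 0 := le_antisymm hc.1 hp.1.2.1
      have h4 := hp.2
      simp only [mem_ofPred_eq, h3, hc.2] at h4
      norm_num at h4)
  refine ⟨C1 + |C2|, by positivity, fun x hx y hy hy1 => ?_⟩
  set w := 1 - ((x : ℂ) + (σ * y : ℝ) * Complex.I) with hw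
  have hz : (x : ℂ) + (σ * y : ℝ) * Complex.I = 1 - w := by rw [hw, sub_sub_cancel]
  have hzm := line_mem_sideHalfPlane hσ x hy
  have hws : w ∈ Complex.slitPlane := mem_cutPlane.1 (sideHalfPlane_subset_cutPlane σ hzm)
  have hY := one_le_rpow_growth (N := n) hy hy1
  rcases le_total ‖w‖ (1 / 2) with hw1 | hw1
  · have i1 := h1 w hws hw1
    have i2 : ‖w‖ ^ (-(n : ℝ)) ≤ y ^ (-((n : ℝ) + 1 / 2)) :=
      rpow_le_of_le_norm (by positivity) (by linarith) hy hy1 (le_norm_one_sub_line hσ x hy.le)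
    rw [hz]
    calc _ ≤ C1 * ‖w‖ ^ (-(n : ℝ)) := i1
      _ ≤ (C1 + |C2|) * y ^ (-((n : ℝ) + 1 / 2)) := by
        gcongr
        linarith [abs_nonneg C2]
  · have i1 := hC2 (x, y) ⟨⟨hx, hy.le, hy1⟩, hw1⟩
    rw [hΨe _ hzm]
    refine i1.trans ((le_abs_self C2).trans ?_)
    nlinarith [abs_nonneg C2]

end Growth

/-! ### Scaling of boundary values at 1 -/

section Rescale

variable {σ : ℝ} {F L : ℂ → ℂ}

/-- Substitution x ↦ 1 + εx, with the height scaled too; the factor ε⁻¹ of the test function cancels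
the Jacobian. -/
theorem smear_rescale (F : ℂ → ℂ) (σ : ℝ) (φ : 𝓓((⊤ : Opens ℝ), ℝ)) {ε : ℝ} (hε : 0 < ε) (y : ℝ) :
    smear F σ (rescale φ 1 ε) (ε * y) = smear (fun z => F (1 + ε * z)) σ φ y := by
  simp only [smear]
  have h1 := Measure.integral_comp_mul_left (fun x : ℝ => ((rescale φ 1 ε (x + 1) : ℝ) : ℂ) *
    F (((x + 1 : ℝ) : ℂ) + (σ * (ε * y) : ℝ) * Complex.I)) ε
  rw [integral_add_right_eq_self (fun x : ℝ => ((rescale φ 1 ε x : ℝ) : ℂ) *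
    F ((x : ℂ) + (σ * (ε * y) : ℝ) * Complex.I)) 1, abs_of_pos (inv_pos.2 hε)] at h1
  have h2 : ∀ I : ℂ, I = ε • (ε⁻¹ • I) := fun I => by rw [smul_smul, mul_inv_cancel₀ hε.ne', one_smul]
  rw [h2 (∫ x : ℝ, ((rescale φ 1 ε x : ℝ) : ℂ) * F ((x : ℂ) + (σ * (ε * y) : ℝ) * Complex.I)), ← h1,
    ← integral_smul]
  refine integral_congr_ae (ae_of_all _ fun x => ?_)
  simp only [rescale_apply φ 1 hε]
  rw [add_sub_cancel_right, mul_div_cancel_left₀ _ hε.ne', Complex.real_smul]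
  have hε' : (ε : ℂ) ≠ 0 := by exact_mod_cast hε.ne'
  have e : (((ε * x + 1 : ℝ) : ℂ) + (σ * (ε * y) : ℝ) * Complex.I) =
      1 + ε * ((x : ℂ) + (σ * y : ℝ) * Complex.I) := by push_cast; ring
  rw [e]
  push_cast
  field_simp

/-- If the difference of two functions is `O(|1 - z|^{-q})` at `z = 1`, then the difference of their
boundary values on test functions concentrated at `1` at scale `ε` is `O(ε^{-q})`. -/
theorem boundaryValue_sub_isBigO (hσ : σ = 1 ∨ σ = -1) (hF : DifferentiableOn ℂ F (sideHalfPlane σ))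
    (hL : DifferentiableOn ℂ L (sideHalfPlane σ)) {T S : 𝓓'((⊤ : Opens ℝ), ℂ)}
    (hT : IsBoundaryValue F σ T) (hS : IsBoundaryValue L σ S) {C q : ℝ} (hC : 0 ≤ C) (hq : 0 ≤ q)
    (hb : ∀ w ∈ Complex.slitPlane, ‖w‖ ≤ 1 / 2 → ‖F (1 - w) - L (1 - w)‖ ≤ C * ‖w‖ ^ (-q))
    (φ : 𝓓((⊤ : Opens ℝ), ℝ)) :
    (fun ε : ℝ => T (rescale φ 1 ε) - S (rescale φ 1 ε)) =O[𝓝[>] 0] fun ε : ℝ => ε ^ (-q) := by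
  obtain ⟨M, hM, hsupp⟩ := exists_tsupport_subset φ
  set N := ⌈q⌉₊ with hN
  have hqN : q ≤ N := Nat.le_ceil q
  obtain ⟨B, hB0, hB⟩ := exists_iteratedDeriv_bound φ.contDiff φ.hasCompactSupport (N + 1)
  -- For ε below this bound and |x| ≤ M, 0 < y ≤ 1, the point 1 + ε(x + iσy) is within 1/2 of 1, so
  -- `hb` applies.
  have hM1 : 0 < 1 / (2 * (M + 1)) := by positivity
  refine Asymptotics.IsBigO.of_bound (3 ^ (N + 1) * (B * C * (2 * M))) ?_
  filter_upwards [Ioc_mem_nhdsGT hM1] with ε hε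
  have hε0 : 0 < ε := hε.1
  have hσ2 : |σ| = 1 := by rcases hσ with rfl | rfl <;> simp
  have hmaps : MapsTo (fun z : ℂ => 1 + ε * z) (sideHalfPlane σ) (sideHalfPlane σ) := fun z hz => by
    have e : (1 + ε * z).im = ε * z.im := by simp
    simp only [sideHalfPlane, mem_ofPred_eq] at hz ⊢
    rw [e]
    nlinarith [mul_pos hε0 hz]
  have hF' : DifferentiableOn ℂ (fun z => F (1 + ε * z)) (sideHalfPlane σ) :=
    hF.comp (by fun_prop) hmaps
  have hL' : DifferentiableOn ℂ (fun z => L (1 + ε * z)) (sideHalfPlane σ) :=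
    hL.comp (by fun_prop) hmaps
  -- The test function stays fixed and the scaling is put into F - L: on the strip the rescaled
  -- difference is at most C ε^(-q) y^(-N-1/2), so the only dependence on ε in the bound is ε^(-q).
  obtain ⟨l, hl, hl2⟩ := smear_tendsto hσ (hF'.sub hL') φ.contDiff hM.le hB0
    (C := C * ε ^ (-q)) (by positivity) hsupp hB (fun x hx y hy hy1 => by
      set z := (x : ℂ) + (σ * y : ℝ) * Complex.I with hz
      have hzm : z ∈ sideHalfPlane σ := line_mem_sideHalfPlane hσ x hy
      have h1 := hb (1 - (1 + ε * z))
        (mem_cutPlane.1 (sideHalfPlane_subset_cutPlane σ (hmaps hzm)))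
      have hyz : y ≤ ‖z‖ := by
        have h := Complex.abs_im_le_norm z
        have e : z.im = σ * y := by simp [hz]
        rwa [e, abs_mul, hσ2, one_mul, abs_of_pos hy] at h
      have hzM : ‖z‖ ≤ M + 1 := by
        refine (norm_add_le _ _).trans (add_le_add ?_ ?_)
        · rw [Complex.norm_real]; exact abs_le.2 hx
        · rw [norm_mul, Complex.norm_I, mul_one, Complex.norm_real, Real.norm_eq_abs, abs_mul, hσ2,
            one_mul, abs_of_pos hy]
          exact hy1
      have e1 : ‖1 - (1 + (ε : ℂ) * z)‖ = ε * ‖z‖ := by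
        rw [sub_add_cancel_left, norm_neg, norm_mul, Complex.norm_real, Real.norm_of_nonneg hε0.le]
      rw [e1, sub_sub_cancel] at h1
      have h2 := h1 (by
        calc ε * ‖z‖ ≤ 1 / (2 * (M + 1)) * (M + 1) := by gcongr; exact hε.2
          _ = 1 / 2 := by field_simp)
      refine h2.trans ?_
      rw [Real.mul_rpow hε0.le (norm_nonneg _), mul_assoc]
      gcongr
      exact rpow_le_of_le_norm hq (by linarith) hy hy1 hyz)
  have hεt : Tendsto (fun y : ℝ => ε * y) (𝓝[>] 0) (𝓝[>] 0) := by
    refine tendsto_nhdsWithin_iff.2 ⟨?_, ?_⟩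
    · exact ((continuous_const_mul ε).tendsto' 0 0 (mul_zero ε)).mono_left nhdsWithin_le_nhds
    · filter_upwards [self_mem_nhdsWithin] with y hy
      exact mul_pos hε0 hy
  have hlim := ((hT (rescale φ 1 ε)).comp hεt).sub ((hS (rescale φ 1 ε)).comp hεt)
  have hTS : T (rescale φ 1 ε) - S (rescale φ 1 ε) = l := by
    refine tendsto_nhds_unique (hlim.congr' ?_) hl
    filter_upwards [self_mem_nhdsWithin] with y hy
    have e1 := smear_rescale F σ φ hε0 y
    have e2 := smear_rescale L σ φ hε0 y
    simp only [smear] at e1 e2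
    simp only [Function.comp]
    rw [e1, e2, ← integral_sub (smear_integrable hσ hF'.continuousOn φ hy)
      (smear_integrable hσ hL'.continuousOn φ hy), smear]
    refine integral_congr_ae (ae_of_all _ fun x => ?_)
    simp [mul_sub]
  rw [hTS, Real.norm_of_nonneg (Real.rpow_nonneg hε0.le _)]
  exact hl2.trans_eq (by ring)

end Rescale

/-! ### The boundary value on `(1, ∞)` -/

section Boundary

variable {σ : ℝ} {F Ψ : ℂ → ℂ}

theorem continuousOn_continuation_line (hσ : σ = 1 ∨ σ = -1)
    (hΨ : DifferentiableOn ℂ Ψ {z | σ * Complex.I * (1 - z) ∈ Complex.slitPlane}) :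
    ContinuousOn (fun p : ℝ × ℝ => Ψ ((p.2 : ℂ) + (σ * p.1 : ℝ) * Complex.I)) (univ ×ˢ Ioi 1) :=
  hΨ.continuousOn.comp (by fun_prop) fun _ hp => line_mem_continuation hσ (Or.inr (ne_of_gt hp.2))

/-- The continuation is continuous in (y, x) up to y = 0, hence uniformly continuous over the
compact set [0, 1] × K. -/
theorem tendstoUniformlyOn_line (hσ : σ = 1 ∨ σ = -1)
    (hΨ : DifferentiableOn ℂ Ψ {z | σ * Complex.I * (1 - z) ∈ Complex.slitPlane})
    (hF : ∀ z : ℂ, 0 < σ * z.im → F z = Ψ z) {K : Set ℝ} (hK : IsCompact K) (hK1 : K ⊆ Ioi 1) :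
    TendstoUniformlyOn (fun (y : ℝ) (x : ℝ) => F ((x : ℂ) + (σ * y : ℝ) * Complex.I))
      (fun x => Ψ x) (𝓝[>] 0) K := by
  have h1 : UniformContinuousOn
      (Function.uncurry fun (y x : ℝ) => Ψ ((x : ℂ) + (σ * y : ℝ) * Complex.I)) (Icc 0 1 ×ˢ K) :=
    (isCompact_Icc.prod hK).uniformContinuousOn_of_continuous
      ((continuousOn_continuation_line hσ hΨ).mono (prod_mono (subset_univ _) hK1))
  have h2 := UniformContinuousOn.tendstoUniformlyOn
    (F := fun (y x : ℝ) => Ψ ((x : ℂ) + (σ * y : ℝ) * Complex.I)) h1 (left_mem_Icc.2 zero_le_one)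
  have h3 : 𝓝[>] (0 : ℝ) ≤ 𝓝[Icc 0 1] 0 :=
    nhdsWithin_le_of_mem (mem_of_superset (Ioc_mem_nhdsGT one_pos) Ioc_subset_Icc_self)
  have h4 : TendstoUniformlyOn (fun (y : ℝ) (x : ℝ) => Ψ ((x : ℂ) + (σ * y : ℝ) * Complex.I))
      (fun x => Ψ x) (𝓝[>] 0) K := by
    intro u hu
    filter_upwards [h3 (h2 u hu)] with y hy x hx
    simpa using hy x hx
  refine h4.congr ?_
  filter_upwards [self_mem_nhdsWithin] with y hy x _
  exact (hF _ (line_mem_sideHalfPlane hσ x hy)).symm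

theorem continuousOn_continuation (hσ : σ = 1 ∨ σ = -1)
    (hΨ : DifferentiableOn ℂ Ψ {z | σ * Complex.I * (1 - z) ∈ Complex.slitPlane}) :
    ContinuousOn (fun x : ℝ => Ψ x) (Ioi 1) := by
  have h := (continuousOn_continuation_line hσ hΨ).comp (f := fun x : ℝ => ((0 : ℝ), x)) (s := Ioi 1)
    (by fun_prop) fun x hx => ⟨mem_univ _, hx⟩
  simpa [Function.comp_def] using h

/-- Dominated convergence: the support of φ is compact in (1, ∞), where the continuation is bounded
up to the cut. -/
theorem boundaryValue_eq_integral (hσ : σ = 1 ∨ σ = -1)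
    (hΨ : DifferentiableOn ℂ Ψ {z | σ * Complex.I * (1 - z) ∈ Complex.slitPlane})
    (hF : ∀ z : ℂ, 0 < σ * z.im → F z = Ψ z) (hFd : DifferentiableOn ℂ F (sideHalfPlane σ))
    {T : 𝓓'((⊤ : Opens ℝ), ℂ)} (hT : IsBoundaryValue F σ T) (φ : 𝓓((⊤ : Opens ℝ), ℝ))
    (hφ : tsupport φ ⊆ Ioi 1) : T φ = ∫ x : ℝ, ((φ x : ℝ) : ℂ) * Ψ x := by
  refine tendsto_nhds_unique (hT φ) ?_
  have hK : IsCompact (tsupport φ) := φ.hasCompactSupport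
  obtain ⟨C, hC⟩ := (isCompact_Icc.prod hK).exists_bound_of_continuousOn (s := Icc (0 : ℝ) 1 ×ˢ _)
    ((continuousOn_continuation_line hσ hΨ).mono (prod_mono (subset_univ _) hφ))
  have hU := tendstoUniformlyOn_line hσ hΨ hF hK hφ
  refine tendsto_integral_filter_of_dominated_convergence (fun x => ‖φ x‖ * C) ?_ ?_ ?_ ?_
  · filter_upwards [self_mem_nhdsWithin] with y hy
    exact (smear_integrable hσ hFd.continuousOn φ hy).aestronglyMeasurable
  · filter_upwards [Ioc_mem_nhdsGT (show (0 : ℝ) < 1 from one_pos)] with y hy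
    refine ae_of_all _ fun x => ?_
    rw [norm_mul, Complex.norm_real]
    by_cases hx : x ∈ tsupport φ
    · rw [hF _ (line_mem_sideHalfPlane hσ x hy.1)]
      exact mul_le_mul_of_nonneg_left (hC (y, x) ⟨⟨hy.1.le, hy.2⟩, hx⟩) (norm_nonneg _)
    · rw [image_eq_zero_of_notMem_tsupport hx]; simp
  · exact ((φ.continuous.integrable_of_hasCompactSupport φ.hasCompactSupport).norm).mul_const C
  · refine ae_of_all _ fun x => ?_
    by_cases hx : x ∈ tsupport φ
    · exact (hU.tendsto_at hx).const_mul _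
    · rw [image_eq_zero_of_notMem_tsupport hx]; simp

end Boundary

/-! ### The formulas on `(1, 2)` -/

section Formulas

variable {n : ℕ} {lam : ℂ} {σ x : ℝ}

theorem tendsto_one_sub_line (σ x : ℝ) :
    Tendsto (fun y : ℝ => 1 - ((x : ℂ) + (σ * y : ℝ) * Complex.I)) (𝓝[>] 0) (𝓝 (1 - x)) := by
  have h : Continuous fun y : ℝ => 1 - ((x : ℂ) + (σ * y : ℝ) * Complex.I) := by fun_prop
  exact (h.tendsto' 0 (1 - x) (by simp)).mono_left nhdsWithin_le_nhds

theorem norm_one_sub_ofReal (hx : 1 < x) : ‖(1 - x : ℂ)‖ = x - 1 := by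
  rw [show (1 - x : ℂ) = ((1 - x : ℝ) : ℂ) by push_cast; rfl, Complex.norm_real, Real.norm_eq_abs,
    abs_of_neg (by linarith), neg_sub]

theorem eventually_line_mem_slitDisc (hσ : σ = 1 ∨ σ = -1) (hx : x ∈ Ioo (1 : ℝ) 2) :
    ∀ᶠ y : ℝ in 𝓝[>] 0, 1 - ((x : ℂ) + (σ * y : ℝ) * Complex.I) ∈ slitDisc := by
  have h1 : (1 - x : ℂ) ∈ Metric.ball (0 : ℂ) 1 := by
    rw [mem_ball_zero_iff, norm_one_sub_ofReal hx.1]; linarith [hx.2]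
  filter_upwards [self_mem_nhdsWithin, tendsto_one_sub_line σ x (Metric.isOpen_ball.mem_nhds h1)]
    with y hy h2
  exact ⟨mem_cutPlane.1 (sideHalfPlane_subset_cutPlane σ (line_mem_sideHalfPlane hσ x hy)), h2⟩

/-- For σ = 1 the point 1 - z approaches the negative axis from below, where the argument tends to
-π; for σ = -1 it comes from above. The signs of iπ in both explicit formulas originate here. -/
theorem tendsto_log_line (hσ : σ = 1 ∨ σ = -1) (hx : 1 < x) :
    Tendsto (fun y : ℝ => Complex.log (1 - ((x : ℂ) + (σ * y : ℝ) * Complex.I))) (𝓝[>] 0)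
      (𝓝 (Real.log (x - 1) - σ * Complex.I * Real.pi)) := by
  have hre : (1 - x : ℂ).re < 0 := by simpa using hx
  have him : (1 - x : ℂ).im = 0 := by simp
  have e : ∀ y : ℝ, (1 - ((x : ℂ) + (σ * y : ℝ) * Complex.I)).im = -(σ * y) := fun y => by simp
  rw [← norm_one_sub_ofReal hx]
  rcases hσ with rfl | rfl
  · have h := (Complex.tendsto_log_nhdsWithin_im_neg_of_re_neg_of_im_zero hre him).comp
      (tendsto_nhdsWithin_iff.2 ⟨tendsto_one_sub_line 1 x, by
        filter_upwards [self_mem_nhdsWithin] with y hy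
        rw [e]
        simpa using hy⟩)
    rw [show (((1 : ℝ) : ℂ) * Complex.I * Real.pi) = Real.pi * Complex.I by push_cast; ring]
    exact h
  · have h := (Complex.tendsto_log_nhdsWithin_im_nonneg_of_re_neg_of_im_zero hre him).comp
      (tendsto_nhdsWithin_iff.2 ⟨tendsto_one_sub_line (-1) x, by
        filter_upwards [self_mem_nhdsWithin] with y hy
        rw [e]
        simpa using le_of_lt hy⟩)
    rw [sub_eq_add_neg,
      show -(((-1 : ℝ) : ℂ) * Complex.I * Real.pi) = Real.pi * Complex.I by push_cast; ring]
    exact h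

theorem tendsto_powerSum_line {t : ℕ → ℂ} (ht : ConvergesOnDisc t) (σ : ℝ)
    (hx : x ∈ Ioo (1 : ℝ) 2) :
    Tendsto (fun y : ℝ => powerSum t (1 - ((x : ℂ) + (σ * y : ℝ) * Complex.I))) (𝓝[>] 0)
      (𝓝 (powerSum t (1 - x))) :=
  (ht.differentiableAt (by rw [norm_one_sub_ofReal hx.1]; linarith [hx.2])).continuousAt.tendsto.comp
    (tendsto_one_sub_line σ x)

theorem tendsto_oddFormula (hn : 2 ≤ n) (h : IsSpectralParam n lam) (ho : Odd n)
    (hσ : σ = 1 ∨ σ = -1) (hx : x ∈ Ioo (1 : ℝ) 2) :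
    Tendsto (fun y : ℝ => hgf n lam ((x : ℂ) + (σ * y : ℝ) * Complex.I)) (𝓝[>] 0)
      (𝓝 (oddFormula n lam σ x)) := by
  have hx0 : ((x - 1 : ℝ) : ℂ) ≠ 0 := by
    have : x - 1 ≠ 0 := by linarith [hx.1]
    exact_mod_cast this
  have l1 : Tendsto (fun y : ℝ => (1 - ((x : ℂ) + (σ * y : ℝ) * Complex.I)) ^ ((2 - n : ℂ) / 2))
      (𝓝[>] 0) (𝓝 (Complex.exp (-(σ * Complex.I * Real.pi * ((2 - n) / 2))) *
        ((x - 1 : ℝ) : ℂ) ^ ((2 - n : ℂ) / 2))) := by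
    have l2 := ((tendsto_log_line hσ hx.1).mul_const ((2 - n : ℂ) / 2)).cexp
    rw [Complex.cpow_def_of_ne_zero hx0, ← Complex.exp_add, ← Complex.ofReal_log (by linarith [hx.1])]
    rw [show -(σ * Complex.I * Real.pi * ((2 - n : ℂ) / 2)) +
      (Real.log (x - 1) : ℂ) * ((2 - n : ℂ) / 2) =
      (Real.log (x - 1) - σ * Complex.I * Real.pi) * ((2 - n : ℂ) / 2) by ring]
    refine l2.congr' ?_
    filter_upwards [eventually_line_mem_slitDisc hσ hx] with y hy
    rw [Complex.cpow_def_of_ne_zero (Complex.slitPlane_ne_zero hy.1)]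
  have l3 := ((tendsto_powerSum_line (convergesOnDisc_gaussCoeff (rhoParam n + lam)
    (rhoParam n - lam) ((n : ℂ) / 2)) σ hx).const_mul (Complex.Gamma (n / 2) *
      Complex.Gamma ((2 - n) / 2) / (Complex.Gamma (1 / 2 + lam) * Complex.Gamma (1 / 2 - lam)))).add
    ((l1.mul (tendsto_powerSum_line (convergesOnDisc_gaussCoeff (1 / 2 - lam) (1 / 2 + lam)
      ((4 - n : ℂ) / 2)) σ hx)).const_mul (Complex.Gamma (n / 2) * Complex.Gamma ((n - 2) / 2) /
      (Complex.Gamma (rhoParam n + lam) * Complex.Gamma (rhoParam n - lam))))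
  rw [oddFormula, ordinaryHypergeometric_eq_powerSum, ordinaryHypergeometric_eq_powerSum]
  refine (l3.congr' ?_).trans (le_of_eq (congrArg 𝓝 (by ring)))
  filter_upwards [eventually_line_mem_slitDisc hσ hx] with y hy
  rw [← hgf_one_sub_odd hn h ho hy, sub_sub_cancel]

theorem hasSum_evenTerm {m : ℕ} (hn : 2 ≤ 2 * m) (h : IsSpectralParam (2 * m) lam)
    (hx : x ∈ Ioo (1 : ℝ) 2) :
    HasSum (evenTerm m lam σ x)
      (powerSum (digammaCoeff m (rhoParam (2 * m) + lam) (rhoParam (2 * m) - lam)) (1 - x) -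
        (Real.log (x - 1) - σ * Complex.I * Real.pi) *
          powerSum (logCoeff m (rhoParam (2 * m) + lam) (rhoParam (2 * m) - lam)) (1 - x)) := by
  have hm : 1 ≤ m := by omega
  have hx1 : ‖(1 - x : ℂ)‖ < 1 := by rw [norm_one_sub_ofReal hx.1]; linarith [hx.2]
  refine (((convergesOnDisc_digammaCoeff hm (h.add_re_pos hn) (h.sub_re_pos hn)).hasSum hx1).sub
    (((convergesOnDisc_logCoeff hm _ _).hasSum hx1).mul_left _)).of_terms_eq fun k => ?_
  rw [digammaCoeff, logCoeff, evenTerm]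
  ring

theorem tendsto_evenFormula {m : ℕ} (hn : 2 ≤ 2 * m) (h : IsSpectralParam (2 * m) lam)
    (hσ : σ = 1 ∨ σ = -1) (hx : x ∈ Ioo (1 : ℝ) 2) :
    Tendsto (fun y : ℝ => hgf (2 * m) lam ((x : ℂ) + (σ * y : ℝ) * Complex.I)) (𝓝[>] 0)
      (𝓝 (evenFormula m lam σ x)) := by
  have hm : 1 ≤ m := by omega
  have hx0 : (1 - x : ℂ) ≠ 0 := by
    rw [← norm_pos_iff, norm_one_sub_ofReal hx.1]; linarith [hx.1]
  have l1 := tendsto_finsetSum (Finset.range (m - 1)) fun k _ =>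
    (((continuousAt_zpow₀ (1 - x : ℂ) ((k : ℤ) + 1 - (m : ℤ)) (Or.inl hx0)).tendsto.comp
      (tendsto_one_sub_line σ x)).const_mul ((-1) ^ k * ((m - k - 2).factorial : ℂ) *
          poch (1 / 2 + lam) k * poch (1 / 2 - lam) k / k.factorial))
  have l2 := (tendsto_powerSum_line (convergesOnDisc_digammaCoeff hm (h.add_re_pos hn)
    (h.sub_re_pos hn)) σ hx).sub ((tendsto_log_line hσ hx.1).mul
      (tendsto_powerSum_line (convergesOnDisc_logCoeff hm (rhoParam (2 * m) + lam)
        (rhoParam (2 * m) - lam)) σ hx))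
  rw [evenFormula, (hasSum_evenTerm hn h hx).tsum_eq]
  refine ((l1.const_mul _).add (l2.const_mul _)).congr' ?_
  filter_upwards [eventually_line_mem_slitDisc hσ hx] with y hy
  have e := hgf_one_sub_even hn h hy
  rw [sub_sub_cancel] at e
  exact e.symm

end Formulas

/-! ### Holomorphy of the leading terms, and the main theorem -/

theorem differentiableOn_leadingTwo (lam : ℂ) (σ : ℝ) :
    DifferentiableOn ℂ (leadingTwo lam) (sideHalfPlane σ) := fun z hz => by
  have h := mem_cutPlane.1 (sideHalfPlane_subset_cutPlane σ hz)
  have h1 : DifferentiableAt ℂ (fun z : ℂ => Complex.log (1 - z)) z :=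
    DifferentiableAt.clog (by fun_prop) h
  exact (h1.neg.const_mul _).differentiableWithinAt

theorem differentiableOn_leadingGeThree (n : ℕ) (lam : ℂ) (σ : ℝ) :
    DifferentiableOn ℂ (leadingGeThree n lam) (sideHalfPlane σ) := fun z hz => by
  have h := mem_cutPlane.1 (sideHalfPlane_subset_cutPlane σ hz)
  have h1 : DifferentiableAt ℂ (fun z : ℂ => (1 - z) ^ ((2 - n : ℂ) / 2)) z :=
    DifferentiableAt.cpow_const (by fun_prop) h
  exact (h1.const_mul _).differentiableWithinAt

theorem mainTheorem4 (n : ℕ) (hn : 2 ≤ n) (lam : ℂ) (hlam : IsSpectralParam n lam) :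
    -- the function `₂F₁(ρ + λ, ρ - λ; n/2; z)` is the holomorphic extension of the Gauss series
    (DifferentiableOn ℂ (hgf n lam) cutPlane ∧
      ∀ z : ℂ, ‖z‖ < 1 → hgf n lam z =
        ordinaryHypergeometric (rhoParam n + lam) (rhoParam n - lam) ((n : ℂ) / 2) z) ∧
    -- both boundary values, `σ = 1` for `x + i0` and `σ = -1` for `x - i0`
    (∀ σ : ℝ, (σ = 1 ∨ σ = -1) →
      ∃ (T : 𝓓'((⊤ : Opens ℝ), ℂ)) (f : ℝ → ℂ),
        -- existence in the sense of distributions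
        IsBoundaryValue (hgf n lam) σ T ∧
        -- uniform convergence on compact subsets of `(1, ∞)`
        (∀ K : Set ℝ, IsCompact K → K ⊆ Ioi 1 →
          TendstoUniformlyOn
            (fun (y : ℝ) (x : ℝ) => hgf n lam ((x : ℂ) + (σ * y : ℝ) * Complex.I))
            f (𝓝[>] 0) K) ∧
        ContinuousOn f (Ioi 1) ∧
        (∀ φ : 𝓓((⊤ : Opens ℝ), ℝ), tsupport φ ⊆ Ioi 1 →
          T φ = ∫ x : ℝ, ((φ x : ℝ) : ℂ) * f x) ∧
        -- explicit formulas on `1 < x < 2`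
        (Odd n → ∀ x ∈ Ioo (1 : ℝ) 2, f x = oddFormula n lam σ x) ∧
        (∀ m : ℕ, n = 2 * m → ∀ x ∈ Ioo (1 : ℝ) 2,
          Summable (evenTerm m lam σ x) ∧ f x = evenFormula m lam σ x) ∧
        -- behaviour near `1` as distributions
        (n = 2 → ∃ S : 𝓓'((⊤ : Opens ℝ), ℂ), IsBoundaryValue (leadingTwo lam) σ S ∧
          DistribAsympAt T S 1 (fun ε => Real.log ε)) ∧
        (3 ≤ n → ∃ S : 𝓓'((⊤ : Opens ℝ), ℂ), IsBoundaryValue (leadingGeThree n lam) σ S ∧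
          DistribAsympAt T S 1 (fun ε => ε ^ ((2 - n : ℝ) / 2)))) ∧
    -- behaviour near `1` as functions on the cut plane
    (n = 2 → Asymptotics.IsEquivalent (𝓝[cutPlane] 1) (hgf n lam) (leadingTwo lam)) ∧
    (3 ≤ n → Asymptotics.IsEquivalent (𝓝[cutPlane] 1) (hgf n lam) (leadingGeThree n lam)) := by
  obtain ⟨hd, he⟩ := hgf_spec hn hlam
  refine ⟨⟨hd, fun z hz => he (mem_ball_zero_iff.2 hz)⟩, fun σ hσ => ?_, ?_,
    fun h3 => isEquivalent_leadingGeThree h3 hlam⟩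
  · have hdσ := hd.mono (sideHalfPlane_subset_cutPlane σ)
    obtain ⟨T, hT⟩ := exists_isBoundaryValue hσ hdσ (hasPolynomialGrowth_hgf hn hlam hσ)
    obtain ⟨Ψ, hΨ, hΨe⟩ := hgf_continuation hn hlam hσ
    -- The continuation and the explicit formula are limits of the same function along the same
    -- vertical line, so they agree on (1, 2).
    have hpt : ∀ x ∈ Ioo (1 : ℝ) 2, Tendsto
        (fun y : ℝ => hgf n lam ((x : ℂ) + (σ * y : ℝ) * Complex.I)) (𝓝[>] 0) (𝓝 (Ψ x)) :=
      fun x hx => (tendstoUniformlyOn_line hσ hΨ hΨe isCompact_singleton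
        (singleton_subset_iff.2 hx.1)).tendsto_at (mem_singleton x)
    refine ⟨T, fun x => Ψ x, hT, fun K hK hK1 => tendstoUniformlyOn_line hσ hΨ hΨe hK hK1,
      continuousOn_continuation hσ hΨ, boundaryValue_eq_integral hσ hΨ hΨe hdσ hT,
      fun ho x hx => tendsto_nhds_unique (hpt x hx) (tendsto_oddFormula hn hlam ho hσ hx),
      ?_, ?_, fun h3 => ?_⟩
    · rintro m rfl x hx
      exact ⟨(hasSum_evenTerm hn hlam hx).summable,
        tendsto_nhds_unique (hpt x hx) (tendsto_evenFormula hn hlam hσ hx)⟩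
    · rintro rfl
      have hL := differentiableOn_leadingTwo lam σ
      obtain ⟨S, hS⟩ := exists_isBoundaryValue hσ hL (hasPolynomialGrowth_leadingTwo lam hσ)
      obtain ⟨C, hC, hb⟩ := exists_hgf_sub_leadingTwo_le hlam
      refine ⟨S, hS, fun φ => ?_⟩
      -- Here q = 0: the difference stays bounded while log ε diverges.
      have h1 := boundaryValue_sub_isBigO hσ hdσ hL hT hS hC le_rfl
        (fun w hw hw1 => by simpa using hb w hw hw1) φ
      simp only [neg_zero, Real.rpow_zero] at h1
      refine h1.trans_isLittleO (Asymptotics.isLittleO_const_left.2 (Or.inr ?_))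
      exact tendsto_abs_atBot_atTop.comp Real.tendsto_log_nhdsGT_zero
    · have hn3 : (3 : ℝ) ≤ n := by exact_mod_cast h3
      have hL := differentiableOn_leadingGeThree n lam σ
      obtain ⟨S, hS⟩ := exists_isBoundaryValue hσ hL (hasPolynomialGrowth_leadingGeThree h3 lam hσ)
      obtain ⟨C, hC, hb⟩ := exists_hgf_sub_leading_le h3 hlam
      -- Here q = (n-3)/2, strictly less than (n-2)/2, which turns the O into the required o.
      exact ⟨S, hS, fun φ => (boundaryValue_sub_isBigO hσ hdσ hL hT hS hC
        (by linarith) hb φ).trans_isLittleO (rpow_isLittleO (by linarith))⟩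
  · rintro rfl
    exact isEquivalent_leadingTwo hlam
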